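/- **Setting.** Let $\chi_1,\chi_2$ be Dirichlet characters modulo $r_1,r_2\ge 1$, with $\chi_i(-1)=(-1)^{\kappa_i}$, $\kappa_i\in\{0,1\}$; a character modulo $r$ is *principal* if it equals $1$ on all integers coprime to $r$. Let $L(\chi,s)$ be the (analytically continued) Dirichlet $L$-function, $\phi$ Euler's totient, $\gamma$ Euler's constant, $\psi=\Gamma'/\Gamma$. For $s_1,s_2\in\mathbb C$, $y>0$, $q=e^{-2\pi y}$ put $$\Xi_{s_1,s_2}(\chi_1,\chi_2;y)=\sum_{n_1,n_2\ge1}\frac{\chi_1(n_1)}{n_1^{s_1}}\frac{\chi_2(n_2)}{n_2^{s_2}}\,q^{n_1n_2},\qquad c_k(s_1,s_2)=\frac{(-2\pi)^k}{k!}L(\chi_1,s_1-k)\,L(\chi_2,s_2-k),$$ $$A_{s_1,s_2}(\chi_1,\chi_2)=\begin{cases}(2\pi)^{s_2-1}\,\Gamma(1-s_2)\,L(\chi_1,s_1+1-s_2)\,\dfrac{\phi(r_2)}{r_2}&\text{if }\chi_2\text{ is principal},\\ 0&\text{otherwise.}\end{cases}$$ For functions $f,E$ of $y$ we write $f(y)\sim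 E(y)+\sum_{k\ge0}a_ky^k$ if for every $N\ge 0$, $f(y)-E(y)-\sum_{k<N}a_ky^k=O(y^N)$ as $y\to0^+$. Call $(s_1,s_2)$ *generic* if: $s_i\notin\{1,2,3,\dots\}$ whenever $\chi_i$ is principal ($i=1,2$), and $s_1\ne s_2$ if both characters are principal. **Theorem.** The double series defining $\Xi$ converges absolutely for all $s_1,s_2\in\mathbb C$ and $y>0$, and the following hold. 1. If neither character is principal, then for all $s_1,s_2\in\mathbb C$, $\ \Xi_{s_1,s_2}(\chi_1,\chi_2;y)\sim\sum_{k\ge0}\frac{(-2\pi y)^k}{k!}L(\chi_1,s_1-k)L(\chi_2,s_2-k)$. 2. For all generic $(s_1,s_2)$, $$\Xi_{s_1,s_2}(\chi_1,\chi_2;y)\sim y^{s_2-1}A_{s_1,s_2}(\chi_1,\chi_2)+y^{s_1-1}A_{s_2,s_1}(\chi_2,\chi_1)+\sum_{k\ge0}c_k(s_1,s_2)\,y^k .$$ 3. Let $\chi_2$ be principal, and let $m\ge1$ be an integer. If $\chi_1$ is principal, let $s_1\ne m$. Then, for $y>0$, the limit as $s\to m$ of $$(2\pi y)^{s-1}\Gamma(1-s)L(\chi_1,s_1+1-s)\frac{\phi(r_2)}{r_2}+\frac{(-2\pi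 y)^{m-1}}{(m-1)!}L(\chi_1,s_1+1-m)L(\chi_2,s+1-m)$$ exists and equals $$\Lambda_{s_1,m}(y)=\Big[L'(\chi_1,s_1{+}1{-}m)+\Big(\sum_{p\mid r_2}\frac{\log p}{p-1}+\gamma+\psi(m)-\log(2\pi y)\Big)L(\chi_1,s_1{+}1{-}m)\Big]\frac{(-2\pi y)^{m-1}}{(m-1)!}\frac{\phi(r_2)}{r_2},$$ where $p$ runs over the primes dividing $r_2$. Moreover (assuming $s_1\notin\{1,2,\dots\}$ if $\chi_1$ is principal) $$\Xi_{s_1,m}(\chi_1,\chi_2;y)\sim \Lambda_{s_1,m}(y)+y^{s_1-1}A_{m,s_1}(\chi_2,\chi_1)+\sum_{k\ge0,\,k\ne m-1}c_k(s_1,m)\,y^k .$$ 4. For arbitrary $s_1,s_2\in\mathbb C$ the expansion is the limit of the generic one: let $N\ge0$ be an integer such that $N\ge s_i$ for each $i\in\{1,2\}$ for which $\chi_i$ is principal and $s_i$ is a positive integer. Then for every $y>0$ the limit $$R_N(y)=\lim_{(s_1',s_2')\to(s_1,s_2)}\Big[y^{s_2'-1}A_{s_1',s_2'}(\chi_1,\chi_2)+y^{s_1'-1}A_{s_2',s_1'}(\chi_2,\chi_1)+\sum_{k<N}c_k(s_1',s_2')\,y^k\Big],$$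 taken over generic $(s_1',s_2')$, exists, and $\Xi_{s_1,s_2}(\chi_1,\chi_2;y)-R_N(y)=O(y^N)$ as $y\to0^+$. 5. (Termination) For $s_1,s_2\in\mathbb C$, one has $c_k(s_1,s_2)=0$ for all sufficiently large $k$ if and only if $s_1,s_2\in\mathbb Z$ and $s_1+s_2\equiv\kappa_1+\kappa_2+1\pmod 2$. The responsible trivial zeros are $L(\chi_i,-\kappa_i-2j)=0$ for all integers $j\ge0$ (only $j\ge 1$ if $\chi_i$ is principal). 6. (One trivial character) Let $\chi=\chi_1$ be non-principal and let $\mathbf 1$ be the trivial character modulo $1$. For every $s\in\mathbb C$, with $\mathcal L_s(\chi;y)=\sum_{n\ge1}\frac{\chi(n)}{n^s}\frac{q^n}{1-q^n}$, one has $\mathcal L_s(\chi;y)=\Xi_{s,0}(\chi,\mathbf 1;y)$ and $$\mathcal L_s(\chi;y)\sim\frac{L(\chi,s+1)}{2\pi y}+\sum_{k\ge0}\frac{(-2\pi y)^k}{k!}\zeta(-k)L(\chi,s-k);$$ the first term is the limit of $\frac{(-2\pi y)^z}{\Gamma(z+1)}\zeta(-z)L(\chi,s-z)$ as $z\to-1$,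 $z\in\mathbb C$ (principal branch of the power). With $\tilde{\mathcal L}_s(\chi;y)=\sum_{n\ge1}\chi(n)\,\mathrm{Li}_s(q^n)$, where $\mathrm{Li}_s(z)=\sum_{n\ge1}z^n/n^s$, one has $\tilde{\mathcal L}_s(\chi;y)=\Xi_{0,s}(\chi,\mathbf 1;y)$, and for $s\notin\{1,2,\dots\}$ $$\tilde{\mathcal L}_s(\chi;y)\sim(2\pi y)^{s-1}\Gamma(1-s)L(\chi,1-s)+\sum_{k\ge0}\frac{(-2\pi y)^k}{k!}\zeta(s-k)L(\chi,-k),$$ while for an integer $s=m\ge1$ $$\tilde{\mathcal L}_m(\chi;y)\sim\Big[L'(\chi,1-m)+\big(\gamma+\psi(m)-\log(2\pi y)\big)L(\chi,1-m)\Big]\frac{(-2\pi y)^{m-1}}{(m-1)!}+\sum_{k\ge0,\,k\ne m-1}\frac{(-2\pi y)^k}{k!}\zeta(m-k)L(\chi,-k).$$ -/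

import Mathlib

open Filter Topology Asymptotics

noncomputable section

namespace TwistedLambert

/-- The `(n₁, n₂)` term of the double series defining `Ξ`. -/
def xiSummand {r₁ r₂ : ℕ} (χ₁ : DirichletCharacter ℂ r₁) (χ₂ : DirichletCharacter ℂ r₂)
    (s₁ s₂ q : ℂ) (p : ℕ+ × ℕ+) : ℂ :=
  χ₁ ((p.1 : ℕ) : ZMod r₁) / ((p.1 : ℕ) : ℂ) ^ s₁ *
    (χ₂ ((p.2 : ℕ) : ZMod r₂) / ((p.2 : ℕ) : ℂ) ^ s₂) * q ^ ((p.1 : ℕ) * (p.2 : ℕ))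

/-- The two-parameter series `Ξ_{s₁,s₂}(χ₁,χ₂;q)`. -/
def Xi {r₁ r₂ : ℕ} (χ₁ : DirichletCharacter ℂ r₁) (χ₂ : DirichletCharacter ℂ r₂)
    (s₁ s₂ q : ℂ) : ℂ :=
  ∑' p : ℕ+ × ℕ+, xiSummand χ₁ χ₂ s₁ s₂ q p

/-- The nome `q = e^{-2πy}`. -/
def nome (y : ℝ) : ℂ := Complex.exp (-(2 * Real.pi * y))

/-- The twisted Lambert series `𝓛_s(χ;q) = ∑ χ(n) n^{-s} q^n / (1 - q^n)`. -/
def lambert {r : ℕ} (χ : DirichletCharacter ℂ r) (s q : ℂ) : ℂ :=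
  ∑' n : ℕ+, χ ((n : ℕ) : ZMod r) / ((n : ℕ) : ℂ) ^ s * (q ^ (n : ℕ) / (1 - q ^ (n : ℕ)))

/-- The polylogarithm `Li_s(z)`, `|z| < 1`. -/
def polylog (s z : ℂ) : ℂ := ∑' n : ℕ+, z ^ (n : ℕ) / ((n : ℕ) : ℂ) ^ s

/-- The Lambert series `∑ χ(n) Li_s(q^n)` with the character on the other index. -/
def lambertTilde {r : ℕ} (χ : DirichletCharacter ℂ r) (s q : ℂ) : ℂ :=
  ∑' n : ℕ+, χ ((n : ℕ) : ZMod r) * polylog s (q ^ (n : ℕ))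

/-- The coefficient of `y^k` in `∑ (-2πy)^k / k! · L(χ₁, s₁ - k) L(χ₂, s₂ - k)`. -/
def pertCoeff {r₁ r₂ : ℕ} [NeZero r₁] [NeZero r₂] (χ₁ : DirichletCharacter ℂ r₁)
    (χ₂ : DirichletCharacter ℂ r₂) (s₁ s₂ : ℂ) (k : ℕ) : ℂ :=
  (-(2 * Real.pi : ℂ)) ^ k / (k.factorial : ℂ) *
    (DirichletCharacter.LFunction χ₁ (s₁ - k) * DirichletCharacter.LFunction χ₂ (s₂ - k))

open Classical in
/-- The coefficient `A_{s₁,s₂}(χ₁,χ₂)` of `y^{s₂-1}`, non-zero only if `χ₂` is principal. -/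
def coeffA {r₁ r₂ : ℕ} [NeZero r₁] (χ₁ : DirichletCharacter ℂ r₁)
    (χ₂ : DirichletCharacter ℂ r₂) (s₁ s₂ : ℂ) : ℂ :=
  if χ₂ = 1 then
    (2 * Real.pi : ℂ) ^ (s₂ - 1) * Complex.Gamma (1 - s₂) *
      DirichletCharacter.LFunction χ₁ (s₁ + 1 - s₂) * ((r₂.totient : ℂ) / (r₂ : ℂ))
  else 0

/-- The two isolated terms `y^{s₂-1} A_{s₁,s₂}(χ₁,χ₂) + y^{s₁-1} A_{s₂,s₁}(χ₂,χ₁)`. -/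
def isolatedTerms {r₁ r₂ : ℕ} [NeZero r₁] [NeZero r₂] (χ₁ : DirichletCharacter ℂ r₁)
    (χ₂ : DirichletCharacter ℂ r₂) (s₁ s₂ : ℂ) (y : ℝ) : ℂ :=
  (y : ℂ) ^ (s₂ - 1) * coeffA χ₁ χ₂ s₁ s₂ + (y : ℂ) ^ (s₁ - 1) * coeffA χ₂ χ₁ s₂ s₁

/-- The isolated terms plus the terms `k < N` of the power series. -/
def pertPartial {r₁ r₂ : ℕ} [NeZero r₁] [NeZero r₂] (χ₁ : DirichletCharacter ℂ r₁)
    (χ₂ : DirichletCharacter ℂ r₂) (s₁ s₂ : ℂ) (N : ℕ) (y : ℝ) : ℂ :=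
  isolatedTerms χ₁ χ₂ s₁ s₂ y + ∑ k ∈ Finset.range N, pertCoeff χ₁ χ₂ s₁ s₂ k * (y : ℂ) ^ k

/-- The parameters at which no term of the expansion is singular: a parameter attached to a
principal character is not a positive integer, and the parameters differ if both characters
are principal. -/
def Generic {r₁ r₂ : ℕ} (χ₁ : DirichletCharacter ℂ r₁) (χ₂ : DirichletCharacter ℂ r₂)
    (s₁ s₂ : ℂ) : Prop :=
  (χ₁ = 1 → ∀ n : ℕ, s₁ ≠ n + 1) ∧ (χ₂ = 1 → ∀ n : ℕ, s₂ ≠ n + 1) ∧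
    (χ₁ = 1 → χ₂ = 1 → s₁ ≠ s₂)

/-- The finite term that arises at `s₂ = m = n + 1` for a principal character `χ₂` modulo `r₂`:
`[L'(χ₁,s₁+1-m) + (∑_{p ∣ r₂} log p/(p-1) + γ + ψ(m) - log(2πy)) L(χ₁,s₁+1-m)]
  · (-2πy)^{m-1}/(m-1)! · φ(r₂)/r₂`. -/
def logTerm {r₁ : ℕ} [NeZero r₁] (χ₁ : DirichletCharacter ℂ r₁) (r₂ : ℕ) (s₁ : ℂ) (n : ℕ)
    (y : ℝ) : ℂ :=
  (deriv (DirichletCharacter.LFunction χ₁) (s₁ - n) +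
      ((∑ p ∈ r₂.primeFactors, Real.log p / ((p : ℝ) - 1) : ℝ) +
        (Real.eulerMascheroniConstant : ℂ) + Complex.digamma (n + 1) -
        (Real.log (2 * Real.pi * y) : ℂ)) * DirichletCharacter.LFunction χ₁ (s₁ - n)) *
    ((-(2 * Real.pi * y : ℂ)) ^ n / (n.factorial : ℂ)) * ((r₂.totient : ℂ) / (r₂ : ℂ))

/-- `f(y) ∼ E(y) + ∑_{k ≥ 0} a_k y^k` as `y → 0⁺`, in the sense of Poincaré. -/
def PoincareExpansion (f E : ℝ → ℂ) (a : ℕ → ℂ) : Prop :=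
  ∀ N : ℕ, (fun y : ℝ => f y - (E y + ∑ k ∈ Finset.range N, a k * (y : ℂ) ^ k))
    =O[𝓝[>] (0 : ℝ)] (fun y : ℝ => y ^ N)

end TwistedLambert

end

/-! The Cahen–Mellin integral writes each `q ^ (n₁ n₂)` as an integral of `(2πy n₁n₂)^(-z) Γ(z)`
over a vertical line. Summing over `n₁, n₂` on a line far enough to the right turns Ξ into the
Mellin–Barnes integral of `(2πy)^(-z) Γ(z) L(χ₁, z + s₁) L(χ₂, z + s₂)` (`hasSum_xiSummand`). On
vertical strips Γ decays exponentially (`norm_Gamma_le_vertical`), while the L-functions grow at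
most polynomially (`polyBounded_LFunction`), so the line may be moved to `re z = -M - 1/2` at the
price of residues (`integral_vertical_sub_eq_sum_residues`). The integral left over is `O(y ^ (M +
1/2))`. The poles of Γ at `-k` contribute the power series, and the pole of `L(χᵢ, z + sᵢ)` at `1 -
sᵢ`, present only for principal `χᵢ`, contributes an isolated term. Genericity says that all these
poles are simple (`Xi_eq_pertPartial_add_lineIntegral`).

At other parameters poles collide and single residues blow up. But Ξ and the shifted integral are
continuous in `(s₁, s₂)`, hence so is their difference, and the sum of the residues has a limit
(`exists_limit_expansion`). For `s₂ → m` this limit is explicit: the two singular terms, multiplied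
by `s - m`, have a sum that is differentiable and vanishes at `m`, so the limit is a derivative
(`tendsto_logTerm`); it collects ψ from Γ, γ and the primes from the principal L-function, and the
logarithm from the power.

For termination, the functional equation of the inducing primitive character shows that an
L-function has only its trivial zeros in `re s < 0` (`LFunction_ne_zero_of_re_neg`). For large `k`
each character therefore kills coefficients of one parity of `k` at most, and only if its parameter
is an integer. Termination means that the two characters take opposite parities. -/

namespace TwistedLambert

open Complex Set MeasureTheory

/-! ### Decay of the Gamma function on vertical lines -/

section GammaDecay

/-- On the line `re s = 1/2` one has `1 - s = conj s`, so the reflection formula gives `|Γ(s)|² = π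
/ cosh(πτ)`. -/
lemma norm_Gamma_half_add_le (τ : ℝ) :
    ‖Complex.Gamma (1 / 2 + τ * I)‖ ≤ √(2 * Real.pi) * Real.exp (-(Real.pi / 2) * |τ|) := by
  have h := Complex.Gamma_mul_Gamma_one_sub (1 / 2 + τ * I)
  have hc : (1 : ℂ) - (1 / 2 + τ * I) = (starRingEnd ℂ) (1 / 2 + τ * I) := by
    apply Complex.ext <;> (simp; try norm_num)
  have hs : Complex.sin (Real.pi * (1 / 2 + τ * I)) = (Real.cosh (Real.pi * τ) : ℂ) := by
    rw [show (Real.pi : ℂ) * (1 / 2 + τ * I) = ((Real.pi * τ : ℝ) : ℂ) * I + Real.pi / 2 by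
      push_cast; ring, Complex.sin_add_pi_div_two, Complex.cos_mul_I, Complex.ofReal_cosh]
  rw [hc, Complex.Gamma_conj, Complex.mul_conj, hs] at h
  have h2 : ‖Complex.Gamma (1 / 2 + τ * I)‖ ^ 2 = Real.pi / Real.cosh (Real.pi * τ) := by
    rw [← Complex.normSq_eq_norm_sq]
    exact_mod_cast h
  have hcosh : Real.exp (Real.pi * |τ|) / 2 ≤ Real.cosh (Real.pi * τ) := by
    rw [← Real.cosh_abs, abs_mul, abs_of_pos Real.pi_pos, Real.cosh_eq]
    have := Real.exp_pos (-(Real.pi * |τ|))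
    linarith
  have hle : ‖Complex.Gamma (1 / 2 + τ * I)‖ ^ 2 ≤
      (√(2 * Real.pi) * Real.exp (-(Real.pi / 2) * |τ|)) ^ 2 := by
    rw [h2, mul_pow, Real.sq_sqrt (by positivity), ← Real.exp_nat_mul]
    rw [show ((2 : ℕ) : ℝ) * (-(Real.pi / 2) * |τ|) = -(Real.pi * |τ|) by push_cast; ring,
      Real.exp_neg, div_le_iff₀ (Real.cosh_pos _)]
    have : 0 < Real.exp (Real.pi * |τ|) := Real.exp_pos _
    calc Real.pi = 2 * Real.pi * (Real.exp (Real.pi * |τ|))⁻¹ * (Real.exp (Real.pi * |τ|) / 2) := by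
          field_simp
      _ ≤ _ := by gcongr
  exact le_of_sq_le_sq hle (by positivity)

lemma norm_Gamma_nat_add_half_le (K : ℕ) : ∃ C : ℝ, 0 < C ∧ ∀ τ : ℝ, 1 ≤ |τ| →
    ‖Complex.Gamma (K + 1 / 2 + τ * I)‖ ≤ C * |τ| ^ K * Real.exp (-(Real.pi / 2) * |τ|) := by
  induction K with
  | zero =>
    refine ⟨√(2 * Real.pi), by positivity, fun τ _ => ?_⟩
    simpa using norm_Gamma_half_add_le τ
  | succ K ih =>
    obtain ⟨C, hC, h⟩ := ih
    refine ⟨(K + 3 / 2) * C, by positivity, fun τ hτ => ?_⟩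
    have hne : (K + 1 / 2 + τ * I : ℂ) ≠ 0 := by
      intro h0
      have := congrArg Complex.re h0
      simp at this
      have : (0 : ℝ) ≤ K := K.cast_nonneg
      linarith
    have e : ((K + 1 : ℕ) + 1 / 2 + τ * I : ℂ) = (K + 1 / 2 + τ * I) + 1 := by push_cast; ring
    rw [e, Complex.Gamma_add_one _ hne, norm_mul]
    have hn : ‖(K + 1 / 2 + τ * I : ℂ)‖ ≤ (K + 3 / 2) * |τ| := by
      calc ‖(K + 1 / 2 + τ * I : ℂ)‖ ≤ ‖(K + 1 / 2 : ℂ)‖ + ‖(τ * I : ℂ)‖ := norm_add_le _ _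
        _ = (K + 1 / 2) + |τ| := by
            rw [show (K + 1 / 2 : ℂ) = ((K + 1 / 2 : ℝ) : ℂ) by push_cast; ring,
              Complex.norm_real, norm_mul, Complex.norm_real, Complex.norm_I, mul_one,
              Real.norm_eq_abs, Real.norm_eq_abs, abs_of_nonneg (by positivity)]
        _ ≤ _ := by nlinarith [(K.cast_nonneg : (0 : ℝ) ≤ K)]
    calc _ ≤ (K + 3 / 2) * |τ| * (C * |τ| ^ K * Real.exp (-(Real.pi / 2) * |τ|)) := by
          gcongr
          exact h τ hτ
      _ = _ := by ring

/-- The integrand has modulus at most 1. This lets the Beta function compare Γ on different vertical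
lines. -/
lemma norm_betaIntegral_le_one {u v : ℂ} (hu : 1 ≤ u.re) (hv : 1 ≤ v.re) :
    ‖Complex.betaIntegral u v‖ ≤ 1 := by
  have := intervalIntegral.norm_integral_le_of_norm_le_const (a := (0 : ℝ)) (b := 1) (C := 1)
    (f := fun x : ℝ => (x : ℂ) ^ (u - 1) * (1 - (x : ℂ)) ^ (v - 1)) ?_
  · simpa [Complex.betaIntegral] using this
  · intro x hx
    rw [uIoc_of_le zero_le_one] at hx
    rw [norm_mul]
    rcases eq_or_lt_of_le hx.2 with h1 | h1
    · subst h1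
      -- At `x = 1` the second base is 0, and the power is 1 or 0 according as `v = 1` or not.
      rcases eq_or_ne (v - 1) 0 with h0 | h0
      · simp [h0]
      · simp [Complex.zero_cpow h0]
    have e : (1 - x : ℂ) = ((1 - x : ℝ) : ℂ) := by push_cast; ring
    rw [e, Complex.norm_cpow_eq_rpow_re_of_pos hx.1,
      Complex.norm_cpow_eq_rpow_re_of_pos (by linarith)]
    exact mul_le_one₀ (Real.rpow_le_one hx.1.le hx.2 (by simpa using hu)) (by
      apply Real.rpow_nonneg; linarith)
      (Real.rpow_le_one (by linarith) (by linarith [hx.1]) (by simpa using hv))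

/-- In `Γ(s) Γ(v) = Γ(s + v) B(s, v)` the real number `v` is chosen to carry `s` to the
half-integral line `re = K + 1/2`, where the decay is known. Then `|B| ≤ 1`, and `Γ(v)` is bounded
below because `v` stays in a compact interval. -/
lemma norm_Gamma_le_of_one_le_re (b : ℝ) : ∃ (C : ℝ) (A : ℕ), 0 < C ∧ ∀ s : ℂ, 1 ≤ s.re → s.re ≤ b →
    1 ≤ |s.im| → ‖Complex.Gamma s‖ ≤ C * |s.im| ^ A * Real.exp (-(Real.pi / 2) * |s.im|) := by
  -- This size of `K` gives `v = K + 1/2 - re s ≥ 1` throughout the strip.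
  obtain ⟨K, hK⟩ := exists_nat_ge (b + 1 / 2)
  obtain ⟨C, hC, h⟩ := norm_Gamma_nat_add_half_le K
  have hcont : ContinuousOn Real.Gamma (Icc 1 (K + 1)) := fun x hx =>
    (Real.differentiableAt_Gamma fun m => by
      have : (0 : ℝ) ≤ m := m.cast_nonneg
      linarith [hx.1]).continuousAt.continuousWithinAt
  obtain ⟨v₀, hv₀, hmin⟩ := isCompact_Icc.exists_isMinOn
    ⟨1, left_mem_Icc.2 (by have : (0 : ℝ) ≤ K := K.cast_nonneg
                           linarith)⟩ hcont
  have hpos : 0 < Real.Gamma v₀ := Real.Gamma_pos_of_pos (by linarith [hv₀.1])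
  refine ⟨C / Real.Gamma v₀, K, by positivity, fun s h1 h2 him => ?_⟩
  set v : ℝ := K + 1 / 2 - s.re with hv
  have hv1 : 1 ≤ v := by linarith
  have hvK : v ≤ K + 1 := by linarith
  have hbeta := Complex.Gamma_mul_Gamma_eq_betaIntegral (s := s) (t := (v : ℂ)) (by linarith)
    (by simp; linarith)
  have e : s + v = K + 1 / 2 + s.im * I := by
    apply Complex.ext <;> simp [hv]
  have hn := congrArg norm hbeta
  rw [norm_mul, norm_mul, Complex.Gamma_ofReal, Complex.norm_real,
    Real.norm_of_nonneg (Real.Gamma_pos_of_pos (by linarith)).le, e] at hn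
  rw [div_mul_eq_mul_div, div_mul_eq_mul_div, le_div_iff₀ hpos]
  calc ‖Complex.Gamma s‖ * Real.Gamma v₀ ≤ ‖Complex.Gamma s‖ * Real.Gamma v := by
        gcongr
        exact hmin ⟨hv1, hvK⟩
    _ = _ := hn
    _ ≤ ‖Complex.Gamma (K + 1 / 2 + s.im * I)‖ * 1 := by
        gcongr
        exact norm_betaIntegral_le_one h1 (by simpa using hv1)
    _ ≤ _ := by rw [mul_one]; exact h _ him

/-- `Γ(s) = Γ(s + 1) / s` with `|s| ≥ 1` moves the bound one unit to the left, and the induction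
counts the units needed to bring `a` up to 1. -/
lemma norm_Gamma_le_vertical (a b : ℝ) : ∃ (C : ℝ) (A : ℕ), 0 < C ∧ ∀ s : ℂ, a ≤ s.re → s.re ≤ b →
    1 ≤ |s.im| → ‖Complex.Gamma s‖ ≤ C * |s.im| ^ A * Real.exp (-(Real.pi / 2) * |s.im|) := by
  obtain ⟨m, hm⟩ := exists_nat_ge (1 - a)
  induction m generalizing a b with
  | zero =>
    obtain ⟨C, A, hC, h⟩ := norm_Gamma_le_of_one_le_re b
    exact ⟨C, A, hC, fun s h1 h2 h3 => h s (by simp at hm; linarith) h2 h3⟩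
  | succ m ih =>
    obtain ⟨C, A, hC, h⟩ := ih (a + 1) (b + 1) (by push_cast at hm; linarith)
    refine ⟨C, A, hC, fun s h1 h2 h3 => ?_⟩
    have hs1 : 1 ≤ ‖s‖ := h3.trans (Complex.abs_im_le_norm s)
    have hs0 : s ≠ 0 := norm_pos_iff.1 (by linarith)
    have := h (s + 1) (by simpa using h1) (by simpa using h2) (by simpa using h3)
    rw [Complex.Gamma_add_one _ hs0, norm_mul] at this
    simp only [add_im, one_im, add_zero] at this
    calc ‖Complex.Gamma s‖ ≤ ‖s‖ * ‖Complex.Gamma s‖ :=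
          le_mul_of_one_le_left (norm_nonneg _) hs1
      _ ≤ _ := this

end GammaDecay

/-! ### Polynomial growth of `L`-functions of periodic functions on vertical strips -/

section PolynomialGrowth

/-- The `k`-th term (with `t = k + x`) of the series continuing `(s - 1) ζ(s, x)` to `0 < re s`. -/
noncomputable def hurwitzTerm (t : ℝ) (s : ℂ) : ℂ :=
  (s - 1) * (t : ℂ) ^ (-s) - (t : ℂ) ^ (1 - s) + ((t + 1 : ℝ) : ℂ) ^ (1 - s)

lemma hasDerivAt_ofReal_add_cpow {t v : ℝ} (h : 0 < t + v) (c : ℂ) :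
    HasDerivAt (fun v : ℝ => ((t + v : ℝ) : ℂ) ^ c) (c * ((t + v : ℝ) : ℂ) ^ (c - 1)) v := by
  have h1 : HasDerivAt (fun z : ℂ => (t + z) ^ c) (c * (t + v) ^ (c - 1) * 1) (v : ℂ) := by
    refine HasDerivAt.cpow_const ((hasDerivAt_id _).const_add _) (Or.inl ?_)
    simpa using h
  simpa using h1.comp_ofReal

/-- The term is the increment over `v ∈ [0, 1]` of `(t + v)^(1-s) + v (s - 1) t^(-s)`. Its
derivative is `-(s - 1)` times an increment of `t ↦ t^(-s)`, so the mean value inequality applies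
twice and gains the power that makes the series converge for `re s > 0`. -/
lemma norm_hurwitzTerm_le {t : ℝ} (ht : 0 < t) {s : ℂ} (hs : 0 ≤ s.re) :
    ‖hurwitzTerm t s‖ ≤ ‖s - 1‖ * ‖s‖ * t ^ (-s.re - 1) := by
  have key : ∀ v ∈ Icc (0 : ℝ) 1, ‖((t + v : ℝ) : ℂ) ^ (-s) - (t : ℂ) ^ (-s)‖ ≤
      ‖s‖ * t ^ (-s.re - 1) := by
    intro v hv
    have := norm_image_sub_le_of_norm_deriv_le_segment_01'
      (f := fun w : ℝ => ((t + w * v : ℝ) : ℂ) ^ (-s))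
      (f' := fun w : ℝ => v * (-s * ((t + w * v : ℝ) : ℂ) ^ (-s - 1)))
      (C := ‖s‖ * t ^ (-s.re - 1)) (fun w hw => ?_) (fun w hw => ?_)
    · simpa using this
    · have hp : 0 < t + w * v := by nlinarith [hw.1, hv.1, mul_nonneg hw.1 hv.1]
      have h := (hasDerivAt_ofReal_add_cpow hp (-s)).scomp w
        ((hasDerivAt_id w).mul_const v)
      simpa [Function.comp_def] using h.hasDerivWithinAt
    · have hp : 0 < t + w * v := by nlinarith [hw.1, hv.1, mul_nonneg hw.1 hv.1]
      rw [norm_mul, norm_mul, norm_neg, Complex.norm_cpow_eq_rpow_re_of_pos hp, Complex.norm_real,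
        Real.norm_of_nonneg hv.1]
      have : (t + w * v) ^ (-s - 1).re ≤ t ^ (-s.re - 1) := by
        simp only [sub_re, neg_re, one_re]
        exact Real.rpow_le_rpow_of_nonpos ht (by nlinarith [mul_nonneg hw.1 hv.1]) (by linarith)
      calc _ ≤ 1 * (‖s‖ * t ^ (-s.re - 1)) := by gcongr; exact hv.2
        _ = _ := one_mul _
  have := norm_image_sub_le_of_norm_deriv_le_segment_01'
      (f := fun v : ℝ => ((t + v : ℝ) : ℂ) ^ (1 - s) + v * ((s - 1) * (t : ℂ) ^ (-s)))
      (f' := fun v : ℝ => (1 - s) * ((t + v : ℝ) : ℂ) ^ (1 - s - 1) + 1 * ((s - 1) * (t : ℂ) ^ (-s)))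
      (C := ‖s - 1‖ * ‖s‖ * t ^ (-s.re - 1)) (fun v hv => ?_) (fun v hv => ?_)
  · rw [show hurwitzTerm t s = ((t + (1 : ℝ) : ℝ) : ℂ) ^ (1 - s) +
      ((1 : ℝ) : ℂ) * ((s - 1) * (t : ℂ) ^ (-s)) - (((t + (0 : ℝ) : ℝ) : ℂ) ^ (1 - s) +
      ((0 : ℝ) : ℂ) * ((s - 1) * (t : ℂ) ^ (-s))) by
        simp only [hurwitzTerm, add_zero, ofReal_one, ofReal_zero]; ring]
    exact this
  · have hp : 0 < t + v := by linarith [hv.1]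
    exact ((hasDerivAt_ofReal_add_cpow hp (1 - s)).add
      ((hasDerivAt_id v).ofReal_comp.mul_const _)).hasDerivWithinAt
  · rw [show (1 - s) * ((t + v : ℝ) : ℂ) ^ (1 - s - 1) + 1 * ((s - 1) * (t : ℂ) ^ (-s)) =
      -(s - 1) * (((t + v : ℝ) : ℂ) ^ (-s) - (t : ℂ) ^ (-s)) by
        rw [show 1 - s - 1 = -s by ring]; ring, norm_mul, norm_neg, mul_assoc]
    gcongr
    exact key v ⟨hv.1, hv.2.le⟩

lemma differentiable_hurwitzTerm {t : ℝ} (ht : 0 < t) : Differentiable ℂ (hurwitzTerm t) := by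
  have h1 : (t : ℂ) ≠ 0 := by exact_mod_cast ht.ne'
  have h2 : ((t + 1 : ℝ) : ℂ) ≠ 0 := by exact_mod_cast (by linarith : t + 1 ≠ 0)
  unfold hurwitzTerm
  intro s
  refine ((DifferentiableAt.mul (by fun_prop) ?_).sub ?_).add ?_
  · exact DifferentiableAt.const_cpow (by fun_prop) (Or.inl h1)
  · exact DifferentiableAt.const_cpow (by fun_prop) (Or.inl h1)
  · exact DifferentiableAt.const_cpow (by fun_prop) (Or.inl h2)

/-- A majorant uniform in `σ ∈ [c, b]`, used for both differentiability and growth. The index `k =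
0` is kept apart because `(0 : ℝ) ^ (-c - 1)` has the default value 0. -/
lemma rpow_nat_add_le {x : ℝ} (hx : 0 < x) (hx1 : x ≤ 1) {σ c b : ℝ} (hc : c ≤ σ) (hb : σ ≤ b)
    (h0 : 0 ≤ c) (k : ℕ) :
    (k + x) ^ (-σ - 1) ≤ x ^ (-b - 1) * (if k = 0 then 1 else (k : ℝ) ^ (-c - 1)) := by
  split_ifs with hk
  · subst hk
    simp only [CharP.cast_eq_zero, zero_add, mul_one]
    exact Real.rpow_le_rpow_of_exponent_ge hx hx1 (by linarith)
  · have hk1 : (1 : ℝ) ≤ k := by exact_mod_cast Nat.one_le_iff_ne_zero.2 hk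
    have h1 : 1 ≤ x ^ (-b - 1) := Real.one_le_rpow_of_pos_of_le_one_of_nonpos hx hx1 (by linarith)
    calc ((k : ℝ) + x) ^ (-σ - 1) ≤ (k : ℝ) ^ (-σ - 1) :=
          Real.rpow_le_rpow_of_nonpos (by linarith) (by linarith) (by linarith)
      _ ≤ (k : ℝ) ^ (-c - 1) := Real.rpow_le_rpow_of_exponent_le hk1 (by linarith)
      _ ≤ _ := le_mul_of_one_le_left (by positivity) h1

lemma summable_rpow_majorant {c : ℝ} (hc : 0 < c) :
    Summable fun k : ℕ => if k = 0 then (1 : ℝ) else (k : ℝ) ^ (-c - 1) := by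
  refine (summable_nat_add_iff 1).1 ?_
  simp only [Nat.add_eq_zero_iff, one_ne_zero, and_false, if_false]
  exact (summable_nat_add_iff 1).2 (Real.summable_nat_rpow.2 (by linarith))

/-- The continuation of `(s - 1) ζ(s, x)` to `0 < re s`. -/
noncomputable def hurwitzSum (x : ℝ) (s : ℂ) : ℂ :=
  (x : ℂ) ^ (1 - s) + ∑' k : ℕ, hurwitzTerm (k + x) s

lemma differentiableAt_hurwitzSum {x : ℝ} (hx : 0 < x) (hx1 : x ≤ 1) {s : ℂ} (hs : 0 < s.re) :
    DifferentiableAt ℂ (hurwitzSum x) s := by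
  have h1 : (x : ℂ) ≠ 0 := by exact_mod_cast hx.ne'
  refine DifferentiableAt.add (DifferentiableAt.const_cpow (by fun_prop) (Or.inl h1)) ?_
  -- On this bounded neighbourhood `re` stays above a positive constant, so one summable majorant
  -- serves all its points.
  set U : Set ℂ := {z | s.re / 2 < z.re} ∩ Metric.ball 0 (‖s‖ + 1) with hU
  have hUo : IsOpen U := (isOpen_lt continuous_const continuous_re).inter Metric.isOpen_ball
  have hsU : s ∈ U := ⟨by simp only [mem_ofPred_eq]; linarith, by simp⟩
  refine (Complex.differentiableOn_tsum_of_summable_norm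
    (u := fun k : ℕ => (‖s‖ + 1 + 1) * (‖s‖ + 1) * (x ^ (-(‖s‖ + 1) - 1) *
      (if k = 0 then 1 else (k : ℝ) ^ (-(s.re / 2) - 1))))
    (((summable_rpow_majorant (by linarith)).mul_left _).mul_left _)
    (fun k => (differentiable_hurwitzTerm (by positivity)).differentiableOn) hUo ?_).differentiableAt
    (hUo.mem_nhds hsU)
  intro k w hw
  have hw1 : ‖w‖ ≤ ‖s‖ + 1 := by
    have := hw.2
    rw [Metric.mem_ball, dist_zero_right] at this
    exact this.le
  have hw2 : s.re / 2 < w.re := hw.1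
  refine (norm_hurwitzTerm_le (by positivity) (by linarith)).trans ?_
  have hk := rpow_nat_add_le hx hx1 hw2.le ((Complex.re_le_norm w).trans hw1) (by linarith) k
  have : ‖w - 1‖ ≤ ‖s‖ + 1 + 1 := (norm_sub_le _ _).trans (by simpa using hw1)
  gcongr

lemma norm_hurwitzSum_le {x : ℝ} (hx : 0 < x) (hx1 : x ≤ 1) {c b : ℝ} (hc : 0 < c) :
    ∃ C : ℝ, 0 < C ∧ ∀ s : ℂ, c ≤ s.re → s.re ≤ b → ‖hurwitzSum x s‖ ≤ C * (1 + ‖s - 1‖ * ‖s‖) := by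
  set S := ∑' k : ℕ, if k = 0 then (1 : ℝ) else (k : ℝ) ^ (-c - 1)
  have hS : 0 ≤ S := tsum_nonneg fun k => by split_ifs <;> positivity
  refine ⟨x ^ (1 - b) + x ^ (-b - 1) * S, by positivity, fun s h1 h2 => ?_⟩
  have hbound : ∀ k : ℕ, ‖hurwitzTerm (k + x) s‖ ≤ ‖s - 1‖ * ‖s‖ * (x ^ (-b - 1) *
      (if k = 0 then 1 else (k : ℝ) ^ (-c - 1))) := fun k => by
    refine (norm_hurwitzTerm_le (by positivity) (by linarith)).trans ?_
    have hk := rpow_nat_add_le hx hx1 h1 h2 hc.le k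
    gcongr
  have hsum := (((summable_rpow_majorant hc).mul_left (x ^ (-b - 1))).mul_left (‖s - 1‖ * ‖s‖))
  have ht := tsum_of_norm_bounded hsum.hasSum hbound
  rw [tsum_mul_left, tsum_mul_left] at ht
  have hx' : ‖(x : ℂ) ^ (1 - s)‖ ≤ x ^ (1 - b) := by
    rw [Complex.norm_cpow_eq_rpow_re_of_pos hx]
    exact Real.rpow_le_rpow_of_exponent_ge hx hx1 (by simp; linarith)
  calc ‖hurwitzSum x s‖ ≤ x ^ (1 - b) + ‖s - 1‖ * ‖s‖ * (x ^ (-b - 1) * S) :=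
        (norm_add_le _ _).trans (add_le_add hx' ht)
    _ ≤ _ := by
        have : 0 ≤ x ^ (1 - b) := by positivity
        have : 0 ≤ x ^ (-b - 1) * S := by positivity
        have : 0 ≤ ‖s - 1‖ * ‖s‖ := by positivity
        nlinarith [mul_nonneg (by positivity : 0 ≤ x ^ (1 - b)) this]

/-- For `re s > 1` the differences `(k + 1 + x)^(1-s) - (k + x)^(1-s)` telescope to `-x^(1-s)`,
which cancels the leading term of `hurwitzSum`. -/
lemma hurwitzSum_eq_of_one_lt_re {x : ℝ} (hx : 0 < x) (hx1 : x ≤ 1) {s : ℂ} (hs : 1 < s.re) :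
    hurwitzSum x s = (s - 1) * HurwitzZeta.hurwitzZeta x s := by
  have h1 := HurwitzZeta.hasSum_hurwitzZeta_of_one_lt_re ⟨hx.le, hx1⟩ hs
  have h2 : HasSum (fun k : ℕ => (((k + 1 : ℕ) + x : ℝ) : ℂ) ^ (1 - s) - ((k + x : ℝ) : ℂ) ^ (1 - s))
      (0 - (x : ℂ) ^ (1 - s)) := by
    have hterm : ∀ k : ℕ, (((k + 1 : ℕ) + x : ℝ) : ℂ) ^ (1 - s) - ((k + x : ℝ) : ℂ) ^ (1 - s) =
        hurwitzTerm (k + x) s - (s - 1) * (1 / (k + x) ^ s) := fun k => by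
      rw [hurwitzTerm, one_div, ← Complex.cpow_neg]
      push_cast
      rw [show (k : ℂ) + 1 + x = k + x + 1 by ring]
      ring
    have hs1 : Summable fun k : ℕ => hurwitzTerm (k + x) s := by
      refine Summable.of_norm_bounded (((summable_rpow_majorant (c := s.re)
        (by linarith)).mul_left (x ^ (-s.re - 1))).mul_left (‖s - 1‖ * ‖s‖)) fun k => ?_
      refine (norm_hurwitzTerm_le (by positivity) (by linarith)).trans ?_
      have hk := rpow_nat_add_le hx hx1 le_rfl le_rfl (by linarith : 0 ≤ s.re) k
      gcongr
    have hsum : Summable fun k : ℕ =>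
        (((k + 1 : ℕ) + x : ℝ) : ℂ) ^ (1 - s) - ((k + x : ℝ) : ℂ) ^ (1 - s) := by
      simp_rw [hterm]
      exact hs1.sub (h1.summable.mul_left _)
    refine (hsum.hasSum_iff_tendsto_nat).2 ?_
    simp_rw [Finset.sum_range_sub (fun k : ℕ => ((k + x : ℝ) : ℂ) ^ (1 - s))]
    simp only [CharP.cast_eq_zero, zero_add]
    refine Tendsto.sub_const ?_ _
    refine tendsto_zero_iff_norm_tendsto_zero.2 ?_
    have : ∀ k : ℕ, ‖((k + x : ℝ) : ℂ) ^ (1 - s)‖ = ((k : ℝ) + x) ^ (-(s.re - 1)) := fun k => by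
      rw [Complex.norm_cpow_eq_rpow_re_of_pos (by positivity)]
      simp
    simp_rw [this]
    exact (tendsto_rpow_neg_atTop (by linarith)).comp
      (tendsto_atTop_add_const_right _ _ tendsto_natCast_atTop_atTop)
  have h3 := (h1.mul_left (s - 1)).add h2
  have h4 : HasSum (fun k : ℕ => hurwitzTerm (k + x) s)
      ((s - 1) * HurwitzZeta.hurwitzZeta x s + (0 - (x : ℂ) ^ (1 - s))) := by
    refine h3.congr_fun ?_ |> fun h => h
    intro k
    rw [hurwitzTerm, one_div, ← Complex.cpow_neg]
    push_cast
    rw [show (k : ℂ) + 1 + x = k + x + 1 by ring]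
    ring
  rw [hurwitzSum, h4.tsum_eq]
  ring

/-- The identity theorem on `re s > 0`, once the singularity of `(s - 1) ζ(s, x)` at 1 has been
filled with the residue 1. -/
lemma hurwitzSum_eq {x : ℝ} (hx : 0 < x) (hx1 : x ≤ 1) {s : ℂ} (hs : 0 < s.re) (hs1 : s ≠ 1) :
    hurwitzSum x s = (s - 1) * HurwitzZeta.hurwitzZeta x s := by
  set F : ℂ → ℂ := Function.update (fun s => (s - 1) * HurwitzZeta.hurwitzZeta x s) 1 1 with hF
  have hFd : DifferentiableOn ℂ F {s | 0 < s.re} := by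
    have hU : {s : ℂ | 0 < s.re} ∈ 𝓝 (1 : ℂ) :=
      (isOpen_lt continuous_const continuous_re).mem_nhds (by simp)
    rw [← Complex.differentiableOn_compl_singleton_and_continuousAt_iff hU]
    constructor
    · refine DifferentiableOn.congr (f := fun s => (s - 1) * HurwitzZeta.hurwitzZeta x s) ?_ ?_
      · intro z hz
        exact (DifferentiableAt.mul (by fun_prop)
          (HurwitzZeta.differentiableAt_hurwitzZeta _ hz.2)).differentiableWithinAt
      · intro z hz
        exact Function.update_of_ne hz.2 _ _
    · exact continuousAt_update_same.2 (HurwitzZeta.hurwitzZeta_residue_one _)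
  have hopen : IsOpen {s : ℂ | 0 < s.re} := isOpen_lt continuous_const continuous_re
  have hSd : DifferentiableOn ℂ (hurwitzSum x) {s | 0 < s.re} := fun z hz =>
    (differentiableAt_hurwitzSum hx hx1 hz).differentiableWithinAt
  have := (hSd.analyticOnNhd hopen).eqOn_of_preconnected_of_eventuallyEq
    (hFd.analyticOnNhd hopen) (convex_halfSpace_re_gt 0).isPreconnected (z₀ := 2) (by simp) ?_ hs
  · rw [this, hF, Function.update_of_ne hs1]
  · have : {s : ℂ | 1 < s.re} ∈ 𝓝 (2 : ℂ) :=
      (isOpen_lt continuous_const continuous_re).mem_nhds (by simp)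
    filter_upwards [this] with z hz
    have hz1 : z ≠ 1 := by rintro rfl; simp at hz
    rw [hF, Function.update_of_ne hz1]
    exact hurwitzSum_eq_of_one_lt_re hx hx1 hz

/-- Polynomial growth on the vertical strip `a ≤ re s ≤ b`, away from the real axis. -/
def PolyBoundedOnStrip (f : ℂ → ℂ) (a b : ℝ) : Prop :=
  ∃ (C : ℝ) (A : ℕ), 0 < C ∧ ∀ s : ℂ, a ≤ s.re → s.re ≤ b → 1 ≤ |s.im| → ‖f s‖ ≤ C * |s.im| ^ A

lemma exists_norm_le_mul_abs_im (a b : ℝ) : ∃ B : ℝ, 0 < B ∧ ∀ s : ℂ, a ≤ s.re → s.re ≤ b →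
    1 ≤ |s.im| → ‖s‖ ≤ B * |s.im| := by
  refine ⟨|a| + |b| + 1, by positivity, fun s h1 h2 h3 => ?_⟩
  have : |s.re| ≤ |a| + |b| := by
    rw [abs_le]
    constructor
    · linarith [neg_abs_le a, abs_nonneg b]
    · linarith [le_abs_self b, abs_nonneg a]
  have h := Complex.norm_le_abs_re_add_abs_im s
  nlinarith [abs_nonneg a, abs_nonneg b]

lemma polyBounded_hurwitzZeta {x : ℝ} (hx : 0 < x) (hx1 : x ≤ 1) {c : ℝ} (hc : 0 < c) (b : ℝ) :
    PolyBoundedOnStrip (HurwitzZeta.hurwitzZeta x) c b := by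
  obtain ⟨C, hC, h⟩ := norm_hurwitzSum_le hx hx1 (b := b) hc
  obtain ⟨B, hB, hB'⟩ := exists_norm_le_mul_abs_im c b
  refine ⟨C * (1 + B), 1, by positivity, fun s h1 h2 h3 => ?_⟩
  have him : 1 ≤ ‖s - 1‖ := h3.trans (by simpa using Complex.abs_im_le_norm (s - 1))
  have hs1 : s ≠ 1 := by rintro rfl; simp at him; linarith
  have e := h s h1 h2
  rw [hurwitzSum_eq hx hx1 (by linarith) hs1, norm_mul] at e
  have hb := hB' s h1 h2 h3
  have : ‖s - 1‖ * ‖HurwitzZeta.hurwitzZeta x s‖ ≤ ‖s - 1‖ * (C * (1 + B) * |s.im|) := by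
    refine e.trans ?_
    calc C * (1 + ‖s - 1‖ * ‖s‖) ≤ C * (‖s - 1‖ * |s.im| + ‖s - 1‖ * (B * |s.im|)) := by
          gcongr
          nlinarith
      _ = _ := by ring
  rw [pow_one]
  exact le_of_mul_le_mul_left this (by linarith)

lemma PolyBoundedOnStrip.const_mul {f : ℂ → ℂ} {a b : ℝ} (h : PolyBoundedOnStrip f a b) (c : ℂ) :
    PolyBoundedOnStrip (fun s => c * f s) a b := by
  obtain ⟨C, A, hC, h⟩ := h
  refine ⟨(‖c‖ + 1) * C, A, by positivity, fun s h1 h2 h3 => ?_⟩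
  rw [norm_mul, mul_assoc]
  gcongr
  · linarith
  · exact h s h1 h2 h3

lemma PolyBoundedOnStrip.add {f g : ℂ → ℂ} {a b : ℝ} (hf : PolyBoundedOnStrip f a b)
    (hg : PolyBoundedOnStrip g a b) : PolyBoundedOnStrip (fun s => f s + g s) a b := by
  obtain ⟨C, A, hC, hf⟩ := hf
  obtain ⟨D, B, hD, hg⟩ := hg
  refine ⟨C + D, max A B, by positivity, fun s h1 h2 h3 => ?_⟩
  calc ‖f s + g s‖ ≤ C * |s.im| ^ A + D * |s.im| ^ B :=
        (norm_add_le _ _).trans (add_le_add (hf s h1 h2 h3) (hg s h1 h2 h3))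
    _ ≤ C * |s.im| ^ max A B + D * |s.im| ^ max A B := by
        gcongr
        · exact le_max_left _ _
        · exact le_max_right _ _
    _ = _ := by ring

lemma PolyBoundedOnStrip.mul {f g : ℂ → ℂ} {a b : ℝ} (hf : PolyBoundedOnStrip f a b)
    (hg : PolyBoundedOnStrip g a b) : PolyBoundedOnStrip (fun s => f s * g s) a b := by
  obtain ⟨C, A, hC, hf⟩ := hf
  obtain ⟨D, B, hD, hg⟩ := hg
  refine ⟨C * D, A + B, by positivity, fun s h1 h2 h3 => ?_⟩
  rw [norm_mul]
  calc _ ≤ C * |s.im| ^ A * (D * |s.im| ^ B) := by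
        gcongr
        exacts [hf s h1 h2 h3, hg s h1 h2 h3]
    _ = _ := by ring

lemma PolyBoundedOnStrip.sum {ι : Type*} (t : Finset ι) {f : ι → ℂ → ℂ} {a b : ℝ}
    (h : ∀ i ∈ t, PolyBoundedOnStrip (f i) a b) :
    PolyBoundedOnStrip (fun s => ∑ i ∈ t, f i s) a b := by
  classical
  induction t using Finset.induction_on with
  | empty => exact ⟨1, 0, one_pos, fun s _ _ _ => by simp⟩
  | insert i t hi ih =>
    simp_rw [Finset.sum_insert hi]
    exact (h i (Finset.mem_insert_self _ _)).add
      (ih fun j hj => h j (Finset.mem_insert_of_mem hj))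

lemma polyBounded_cpow {x : ℝ} (hx : 0 < x) (c a b : ℝ) (d : ℂ) :
    PolyBoundedOnStrip (fun s => (x : ℂ) ^ (c * s + d)) a b := by
  have hcont : ContinuousOn (fun σ : ℝ => x ^ (c * σ + d.re)) (Icc a b) :=
    (Continuous.rpow continuous_const (by fun_prop) fun _ => Or.inl hx.ne').continuousOn
  obtain ⟨C, hC⟩ := isCompact_Icc.exists_bound_of_continuousOn hcont
  refine ⟨|C| + 1, 0, by positivity, fun s h1 h2 _ => ?_⟩
  rw [Complex.norm_cpow_eq_rpow_re_of_pos hx, pow_zero, mul_one]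
  have := hC s.re ⟨h1, h2⟩
  rw [Real.norm_of_nonneg (by positivity)] at this
  simp only [add_re, mul_re, ofReal_re, ofReal_im, zero_mul, sub_zero]
  linarith [le_abs_self C]

/-! ### From the Hurwitz zeta function to `L`-functions of periodic functions -/

variable {N : ℕ} [NeZero N]

lemma polyBounded_LFunction_right (Φ : ZMod N → ℂ) {c : ℝ} (hc : 0 < c) (b : ℝ) :
    PolyBoundedOnStrip (ZMod.LFunction Φ) c b := by
  unfold ZMod.LFunction
  refine PolyBoundedOnStrip.mul (f := fun s => (N : ℂ) ^ (-s)) ?_ (PolyBoundedOnStrip.sum _ fun j _ =>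
    PolyBoundedOnStrip.const_mul ?_ _)
  · have := polyBounded_cpow (x := N) (by exact_mod_cast Nat.pos_of_ne_zero (NeZero.ne N)) (-1) c b 0
    simpa using this
  -- The representative is taken in `(0, 1]`, so that the class of 0 is represented by 1: the bounds
  -- need `0 < x`.
  · obtain ⟨x, hx, hxj⟩ : ∃ x ∈ Ioc (0 : ℝ) (0 + 1), (x : UnitAddCircle) = ZMod.toAddCircle j := by
      have := AddCircle.coe_image_Ioc_eq (1 : ℝ) 0
      have h : ZMod.toAddCircle j ∈ (univ : Set UnitAddCircle) := mem_univ _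
      rw [← this] at h
      exact h
    rw [← hxj]
    exact polyBounded_hurwitzZeta hx.1 (by linarith [hx.2]) hc b

lemma PolyBoundedOnStrip.comp_one_sub {f : ℂ → ℂ} {a b : ℝ}
    (hf : PolyBoundedOnStrip f (1 - b) (1 - a)) : PolyBoundedOnStrip (fun s => f (1 - s)) a b := by
  obtain ⟨C, A, hC, hf⟩ := hf
  refine ⟨C, A, hC, fun s h1 h2 h3 => ?_⟩
  simpa using hf (1 - s) (by simp; linarith) (by simp; linarith) (by simpa using h3)

/-- The exponentials in the functional equation grow at most like `exp(π |im s| / 2)`, exactly the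
rate at which Γ decays. -/
lemma polyBounded_Gamma_mul_exp (a b : ℝ) {c : ℂ} (hc : c = Real.pi * I ∨ c = -Real.pi * I) :
    PolyBoundedOnStrip (fun s => Complex.Gamma s * Complex.exp (c * s / 2)) a b := by
  obtain ⟨C, A, hC, h⟩ := norm_Gamma_le_vertical a b
  refine ⟨C, A, hC, fun s h1 h2 h3 => ?_⟩
  have hexp : ‖Complex.exp (c * s / 2)‖ ≤ Real.exp (Real.pi / 2 * |s.im|) := by
    rw [Complex.norm_exp, Real.exp_le_exp]
    have hre : (c * s / 2).re = (c * s).re / 2 := by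
      rw [show c * s / 2 = c * s / (2 : ℝ) by push_cast; rfl, Complex.div_ofReal_re]
    rw [hre]
    have hp := Real.pi_pos
    rcases hc with rfl | rfl
    · simp
      nlinarith [neg_abs_le s.im, le_abs_self s.im]
    · simp
      nlinarith [neg_abs_le s.im, le_abs_self s.im]
  rw [norm_mul]
  calc _ ≤ C * |s.im| ^ A * Real.exp (-(Real.pi / 2) * |s.im|) * Real.exp (Real.pi / 2 * |s.im|) := by
        gcongr
        exact h s h1 h2 h3
    _ = C * |s.im| ^ A := by
        rw [mul_assoc, ← Real.exp_add]
        simp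

/-- `L`-functions of periodic functions grow polynomially in vertical strips. -/
lemma polyBounded_LFunction (Φ : ZMod N → ℂ) (a b : ℝ) :
    PolyBoundedOnStrip (ZMod.LFunction Φ) a b := by
  have hr := polyBounded_LFunction_right Φ (c := 1 / 2) (by norm_num) b
  have h1 : PolyBoundedOnStrip (fun w => (N : ℂ) ^ (w - 1)) (1 - 1 / 2) (1 - a) := by
    have := polyBounded_cpow (x := N) (by exact_mod_cast Nat.pos_of_ne_zero (NeZero.ne N)) 1
      (1 - 1 / 2) (1 - a) (-1)
    simpa [sub_eq_add_neg] using this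
  have h2 : PolyBoundedOnStrip (fun w => (2 * Real.pi : ℂ) ^ (-w)) (1 - 1 / 2) (1 - a) := by
    have := polyBounded_cpow (x := 2 * Real.pi) (by positivity) (-1) (1 - 1 / 2) (1 - a) 0
    simpa using this
  have h3 := (polyBounded_Gamma_mul_exp (1 - 1 / 2) (1 - a) (Or.inl rfl)).mul
    (polyBounded_LFunction_right (ZMod.dft Φ) (c := 1 - 1 / 2) (by norm_num) (1 - a))
  have h4 := (polyBounded_Gamma_mul_exp (1 - 1 / 2) (1 - a) (Or.inr rfl)).mul
    (polyBounded_LFunction_right (ZMod.dft fun x => Φ (-x)) (c := 1 - 1 / 2) (by norm_num) (1 - a))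
  -- The right-hand side of the functional equation, evaluated at `1 - s`, bounds the part of the
  -- strip left of `re s = 1/2`.
  have hl := ((h1.mul h2).mul (h3.add h4)).comp_one_sub
  clear h1 h2 h3 h4
  obtain ⟨C, A, hC, h⟩ := hr
  obtain ⟨D, B, hD, h'⟩ := hl
  refine ⟨C + D, max A B, by positivity, fun s h1 h2 h3 => ?_⟩
  have hpos : 0 < |s.im| := by linarith
  rcases le_total (1 / 2) s.re with hs | hs
  · calc ‖ZMod.LFunction Φ s‖ ≤ C * |s.im| ^ A := h s hs h2 h3
      _ ≤ (C + D) * |s.im| ^ max A B := by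
        gcongr
        · linarith
        · exact le_max_left _ _
  -- All exceptional points of the functional equation are real, and here `|im s| ≥ 1`.
  · have hne : ∀ z : ℂ, z.im = 0 → 1 - s ≠ z := fun z hz hs => by
      have := congrArg Complex.im hs
      simp [hz] at this
      simp [this] at hpos
    have hfe := ZMod.LFunction_one_sub Φ (s := 1 - s) (fun n => hne _ (by simp))
      (Or.inr (hne _ (by simp)))
    rw [sub_sub_cancel] at hfe
    have e := h' s h1 hs h3
    calc ‖ZMod.LFunction Φ s‖ ≤ D * |s.im| ^ B := by
          refine le_trans (le_of_eq ?_) e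
          rw [hfe]
          congr 1
          ring
      _ ≤ (C + D) * |s.im| ^ max A B := by
        gcongr
        · linarith
        · exact le_max_right _ _

end PolynomialGrowth

/-! ### Moving a vertical line of integration -/

section ResidueTheorem

/-- Riemann's theorem at all points of `S` simultaneously: `g` is the punctured limit of `f` at
every point, which is `f` itself wherever `f` is continuous. -/
lemma exists_differentiableOn_of_removable {f : ℂ → ℂ} {U : Set ℂ} (hU : IsOpen U) (S : Finset ℂ)
    (hd : ∀ z ∈ U, z ∉ S → DifferentiableAt ℂ f z)
    (hr : ∀ p ∈ S, Tendsto (fun z => (z - p) * f z) (𝓝[≠] p) (𝓝 0)) :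
    ∃ g : ℂ → ℂ, DifferentiableOn ℂ g U ∧ ∀ z ∈ U, z ∉ S → g z = f z := by
  have hval : ∀ z ∈ U, z ∉ S → limUnder (𝓝[≠] z) f = f z := fun z hz hzS =>
    ((hd z hz hzS).continuousAt.tendsto.mono_left nhdsWithin_le_nhds).limUnder_eq
  refine ⟨fun z => limUnder (𝓝[≠] z) f, fun p hp => ?_, hval⟩
  set V : Set ℂ := U \ (S.erase p : Finset ℂ) with hV
  have hVo : IsOpen V := hU.sdiff (S.erase p).finite_toSet.isClosed
  have hpV : V ∈ 𝓝 p := hVo.mem_nhds ⟨hp, by simp⟩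
  have hVS : ∀ z ∈ V, z ≠ p → z ∉ S := fun z hz hzp hzS => hz.2 (by simp [hzp, hzS])
  by_cases hpS : p ∈ S
  -- The value `f p` is arbitrary, but it is multiplied by `z - p` and does no harm.
  · have ho : (fun z => f z - f p) =o[𝓝[≠] p] fun z => (z - p)⁻¹ := by
      rw [isLittleO_iff_tendsto' (by
        filter_upwards [self_mem_nhdsWithin] with z hz h0
        exact absurd (sub_eq_zero.1 (inv_eq_zero.1 h0)) hz)]
      have h0 : Tendsto (fun z : ℂ => (z - p) * f p) (𝓝[≠] p) (𝓝 0) := by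
        have : Tendsto (fun z : ℂ => (z - p) * f p) (𝓝 p) (𝓝 ((p - p) * f p)) :=
          (by fun_prop : Continuous fun z : ℂ => (z - p) * f p).tendsto p
        simpa using this.mono_left nhdsWithin_le_nhds
      have := (hr p hpS).sub h0
      simp only [sub_zero] at this
      refine this.congr fun z => ?_
      rw [div_inv_eq_mul]
      ring
    have := Complex.differentiableOn_update_limUnder_of_isLittleO hpV (fun z hz =>
      (hd z hz.1.1 (hVS z hz.1 hz.2)).differentiableWithinAt) ho
    refine ((this.differentiableAt hpV).congr_of_eventuallyEq ?_).differentiableWithinAt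
    filter_upwards [hpV] with z hz
    rcases eq_or_ne z p with rfl | hzp
    · simp
    · rw [Function.update_of_ne hzp]
      exact hval z hz.1 (hVS z hz hzp)
  · refine ((hd p hp hpS).congr_of_eventuallyEq ?_).differentiableWithinAt
    filter_upwards [hpV] with z hz
    exact hval z hz.1 fun hzS => hz.2 (by
      simp only [Finset.coe_erase, Set.mem_sdiff, Finset.mem_coe, mem_singleton_iff]
      exact ⟨hzS, fun h => hpS (h ▸ hzS)⟩)

/-- Smallness at both ends of a closed vertical strip. -/
def VanishesVertically (f : ℂ → ℂ) (a b : ℝ) : Prop :=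
  ∀ ε > 0, ∃ T : ℝ, ∀ z : ℂ, a ≤ z.re → z.re ≤ b → T ≤ |z.im| → ‖f z‖ ≤ ε

lemma VanishesVertically.sub {f g : ℂ → ℂ} {a b : ℝ} (hf : VanishesVertically f a b)
    (hg : VanishesVertically g a b) : VanishesVertically (fun z => f z - g z) a b := by
  intro ε hε
  obtain ⟨T, hT⟩ := hf (ε / 2) (by positivity)
  obtain ⟨T', hT'⟩ := hg (ε / 2) (by positivity)
  refine ⟨max T T', fun z h1 h2 h3 => ?_⟩
  calc _ ≤ ε / 2 + ε / 2 := (norm_sub_le _ _).trans (add_le_add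
        (hT z h1 h2 ((le_max_left _ _).trans h3)) (hT' z h1 h2 ((le_max_right _ _).trans h3)))
    _ = ε := by ring

lemma VanishesVertically.const_mul {f : ℂ → ℂ} {a b : ℝ} (hf : VanishesVertically f a b) (c : ℂ) :
    VanishesVertically (fun z => c * f z) a b := by
  intro ε hε
  obtain ⟨T, hT⟩ := hf (ε / (‖c‖ + 1)) (by positivity)
  refine ⟨T, fun z h1 h2 h3 => ?_⟩
  rw [norm_mul]
  calc ‖c‖ * ‖f z‖ ≤ (‖c‖ + 1) * (ε / (‖c‖ + 1)) := by
        gcongr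
        · linarith
        · exact hT z h1 h2 h3
    _ = ε := by field_simp

/-- Cauchy's theorem on the rectangle `[a, b] × [-R, R]`; the two horizontal sides vanish as `R →
∞`. -/
lemma integral_vertical_eq_of_differentiableOn {f : ℂ → ℂ} {a b : ℝ} (hab : a ≤ b)
    (hf : DifferentiableOn ℂ f {z | a ≤ z.re ∧ z.re ≤ b})
    (ha : Integrable fun τ : ℝ => f (a + τ * I)) (hb : Integrable fun τ : ℝ => f (b + τ * I))
    (hv : VanishesVertically f a b) :
    ∫ τ : ℝ, f (b + τ * I) = ∫ τ : ℝ, f (a + τ * I) := by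
  have hA := intervalIntegral_tendsto_integral ha tendsto_neg_atTop_atBot tendsto_id
  have hB := intervalIntegral_tendsto_integral hb tendsto_neg_atTop_atBot tendsto_id
  have hAB := hB.sub hA
  refine sub_eq_zero.1 (tendsto_nhds_unique hAB ?_)
  rw [Metric.tendsto_atTop]
  intro ε hε
  -- The two horizontal sides have total length `2 (b - a)`; the extra 2 makes the final inequality
  -- strict and covers `a = b`.
  obtain ⟨T, hT⟩ := hv (ε / (2 * (b - a) + 2)) (by
    have : 0 ≤ b - a := by linarith
    positivity)
  refine ⟨max T 0, fun R hR => ?_⟩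
  have hR0 : 0 ≤ R := (le_max_right _ _).trans hR
  have hRT : T ≤ R := (le_max_left _ _).trans hR
  have hrect := Complex.integral_boundary_rect_eq_zero_of_differentiableOn f
    (a + (-R : ℝ) * I) (b + R * I) (hf.mono fun z hz => by
      have := hz.1
      simp [uIcc_of_le hab] at this
      exact this)
  simp only [add_re, ofReal_re, mul_re, I_re, mul_zero, ofReal_im, I_im, mul_one, sub_self,
    add_zero, add_im, mul_im, zero_add] at hrect
  have hh : ∀ R' : ℝ, |R'| = R → ‖∫ x : ℝ in a..b, f (x + R' * I)‖ ≤
      ε / (2 * (b - a) + 2) * |b - a| := fun R' hR' =>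
    intervalIntegral.norm_integral_le_of_norm_le_const fun x hx => by
      rw [uIoc_of_le hab] at hx
      exact hT _ (by simpa using hx.1.le) (by simpa using hx.2) (by simpa [hR'] using hRT)
  have h1 := hh (-R) (by rw [abs_neg, abs_of_nonneg hR0])
  have h2 := hh R (abs_of_nonneg hR0)
  rw [dist_zero_right]
  simp only [id]
  set X := ∫ x : ℝ in a..b, f (x + (-R : ℝ) * I)
  set Y := ∫ x : ℝ in a..b, f (x + R * I)
  set P := ∫ τ : ℝ in -R..R, f (b + τ * I)
  set Q := ∫ τ : ℝ in -R..R, f (a + τ * I)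
  have : P - Q = I * (X - Y) := by
    have : X - Y + I * (P - Q) = 0 := by
      simp only [smul_eq_mul] at hrect
      linear_combination hrect
    linear_combination -I * this + (P - Q) * I_mul_I
  rw [this, norm_mul, norm_I, one_mul]
  have hba : 0 ≤ b - a := by linarith
  calc ‖X - Y‖ ≤ ε / (2 * (b - a) + 2) * |b - a| + ε / (2 * (b - a) + 2) * |b - a| :=
        (norm_sub_le _ _).trans (add_le_add h1 h2)
    _ = ε * (2 * (b - a) / (2 * (b - a) + 2)) := by rw [abs_of_nonneg hba]; ring
    _ < ε * 1 := by
        gcongr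
        rw [div_lt_one (by positivity)]
        linarith
    _ = ε := mul_one ε

/-! ### Integrals of principal parts along vertical lines -/

lemma integral_two_mul_div_sq_add_sq {α : ℝ} (hα : α ≠ 0) :
    Integrable (fun τ : ℝ => 2 * α / (α ^ 2 + τ ^ 2)) ∧
      ∫ τ : ℝ, 2 * α / (α ^ 2 + τ ^ 2) = 2 * Real.pi * (|α| / α) := by
  have e : (fun τ : ℝ => 2 * α / (α ^ 2 + τ ^ 2)) =
      fun τ => 2 / α * (1 + (α⁻¹ * τ) ^ 2)⁻¹ := by
    funext τ
    have : 0 < α ^ 2 + τ ^ 2 := by positivity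
    have : 0 < 1 + (α⁻¹ * τ) ^ 2 := by positivity
    have h2 : 1 + (α⁻¹ * τ) ^ 2 = (α ^ 2 + τ ^ 2) / α ^ 2 := by field_simp
    rw [h2]
    field_simp
  rw [e]
  refine ⟨((integrable_inv_one_add_sq).comp_mul_left' (inv_ne_zero hα)).const_mul _, ?_⟩
  rw [integral_const_mul, Measure.integral_comp_mul_left (fun x : ℝ => (1 + x ^ 2)⁻¹),
    integral_univ_inv_one_add_sq, inv_inv, smul_eq_mul]
  field_simp

/-- A single `1 / (α + iτ)` is not integrable; the difference of two decays like `τ⁻²`. -/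
lemma integrable_inv_sub_inv {α β : ℝ} (hα : α ≠ 0) (hβ : β ≠ 0) :
    Integrable fun τ : ℝ => (α + τ * I : ℂ)⁻¹ - (β + τ * I : ℂ)⁻¹ := by
  have hne : ∀ γ : ℝ, γ ≠ 0 → ∀ τ : ℝ, (γ + τ * I : ℂ) ≠ 0 := fun γ hγ τ h => hγ (by
    simpa using congrArg Complex.re h)
  have hn : ∀ γ τ : ℝ, ‖(γ + τ * I : ℂ)‖ ^ 2 = γ ^ 2 + τ ^ 2 := fun γ τ => by
    rw [← Complex.normSq_eq_norm_sq, Complex.normSq_add_mul_I]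
  have hmaj := ((integral_two_mul_div_sq_add_sq (abs_ne_zero.2 hα)).1.const_mul
    (|β - α| / (2 * |α|))).add ((integral_two_mul_div_sq_add_sq (abs_ne_zero.2 hβ)).1.const_mul
    (|β - α| / (2 * |β|)))
  refine hmaj.mono' (Continuous.aestronglyMeasurable ?_) (Eventually.of_forall fun τ => ?_)
  · exact ((by fun_prop : Continuous fun τ : ℝ => (α + τ * I : ℂ)).inv₀ (hne α hα)).sub
      ((by fun_prop : Continuous fun τ : ℝ => (β + τ * I : ℂ)).inv₀ (hne β hβ))
  · rw [inv_sub_inv (hne α hα τ) (hne β hβ τ), norm_div, norm_mul]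
    have e1 : (β + τ * I - (α + τ * I) : ℂ) = ((β - α : ℝ) : ℂ) := by push_cast; ring
    rw [e1, Complex.norm_real, Real.norm_eq_abs]
    have hx : 0 < ‖(α + τ * I : ℂ)‖ := norm_pos_iff.2 (hne α hα τ)
    have hy : 0 < ‖(β + τ * I : ℂ)‖ := norm_pos_iff.2 (hne β hβ τ)
    simp only [Pi.add_apply, sq_abs]
    rw [← hn α τ, ← hn β τ]
    set x := ‖(α + τ * I : ℂ)‖
    set y := ‖(β + τ * I : ℂ)‖
    have hα' : 0 < |α| := abs_pos.2 hα
    have hβ' : 0 < |β| := abs_pos.2 hβ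
    have : 1 / (x * y) ≤ 1 / x ^ 2 + 1 / y ^ 2 := by
      have h1 : 1 / (x * y) = (1 / x) * (1 / y) := by field_simp
      have h2 : 1 / x ^ 2 = (1 / x) ^ 2 := by field_simp
      have h3 : 1 / y ^ 2 = (1 / y) ^ 2 := by field_simp
      rw [h1, h2, h3]
      nlinarith [sq_nonneg (1 / x - 1 / y), sq_nonneg (1 / x), sq_nonneg (1 / y)]
    calc |β - α| / (x * y) = |β - α| * (1 / (x * y)) := by ring
      _ ≤ |β - α| * (1 / x ^ 2 + 1 / y ^ 2) := by gcongr
      _ = _ := by field_simp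

/-- Averaging over `τ ↦ -τ` leaves the real Poisson kernels. The signs `|α| / α` record on which
side of the line each pole lies, and produce the jump when a pole is crossed. -/
lemma integral_inv_sub_inv {α β : ℝ} (hα : α ≠ 0) (hβ : β ≠ 0) :
    ∫ τ : ℝ, ((α + τ * I : ℂ)⁻¹ - (β + τ * I : ℂ)⁻¹) =
      ((Real.pi * (|α| / α - |β| / β) : ℝ) : ℂ) := by
  have hne : ∀ γ : ℝ, γ ≠ 0 → ∀ τ : ℝ, (γ + τ * I : ℂ) ≠ 0 := fun γ hγ τ h => hγ (by
    simpa using congrArg Complex.re h)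
  set f : ℝ → ℂ := fun τ => (α + τ * I : ℂ)⁻¹ - (β + τ * I : ℂ)⁻¹ with hf
  have hfi : Integrable f := integrable_inv_sub_inv hα hβ
  have hpt : ∀ γ : ℝ, γ ≠ 0 → ∀ τ : ℝ, (γ + τ * I : ℂ)⁻¹ + (γ + (-τ : ℝ) * I : ℂ)⁻¹ =
      ((2 * γ / (γ ^ 2 + τ ^ 2) : ℝ) : ℂ) := fun γ hγ τ => by
    have h1 := hne γ hγ τ
    have h2 := hne γ hγ (-τ)
    have h3 : ((γ : ℂ) ^ 2 + (τ : ℂ) ^ 2) ≠ 0 := by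
      exact_mod_cast (by positivity : γ ^ 2 + τ ^ 2 ≠ 0)
    push_cast at h2 ⊢
    rw [inv_add_inv h1 h2, div_eq_div_iff (mul_ne_zero h1 h2) h3]
    linear_combination 2 * (γ : ℂ) * (τ : ℂ) ^ 2 * I_sq
  have hsum : (fun τ => f τ + f (-τ)) = fun τ : ℝ =>
      ((2 * α / (α ^ 2 + τ ^ 2) - 2 * β / (β ^ 2 + τ ^ 2) : ℝ) : ℂ) := by
    funext τ
    rw [Complex.ofReal_sub, ← hpt α hα τ, ← hpt β hβ τ]
    simp only [hf]
    ring
  have h2 : ∫ τ, (f τ + f (-τ)) = 2 * ∫ τ, f τ := by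
    rw [integral_add hfi hfi.comp_neg, integral_neg_eq_self]
    ring
  rw [hsum, integral_complex_ofReal, integral_sub (integral_two_mul_div_sq_add_sq hα).1
    (integral_two_mul_div_sq_add_sq hβ).1, (integral_two_mul_div_sq_add_sq hα).2,
    (integral_two_mul_div_sq_add_sq hβ).2] at h2
  have : ((Real.pi * (|α| / α - |β| / β) : ℝ) : ℂ) =
      ((2 * Real.pi * (|α| / α) - 2 * Real.pi * (|β| / β) : ℝ) : ℂ) / 2 := by
    push_cast
    ring
  rw [this, h2]
  ring

/-- A rational function with a simple pole of residue one at `p`, and its other pole at `p - B`. -/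
noncomputable def poleKernel (B : ℝ) (p z : ℂ) : ℂ := (z - p)⁻¹ - (z - (p - B))⁻¹

lemma poleKernel_line (B : ℝ) (p : ℂ) (c τ : ℝ) : poleKernel B p (c + τ * I) =
    (((c - p.re : ℝ) : ℂ) + ((τ - p.im : ℝ) : ℂ) * I)⁻¹ -
      (((c - p.re + B : ℝ) : ℂ) + ((τ - p.im : ℝ) : ℂ) * I)⁻¹ := by
  have : p = p.re + p.im * I := (re_add_im p).symm
  unfold poleKernel
  congr 2
  · nth_rewrite 1 [this]
    push_cast
    ring
  · nth_rewrite 1 [this]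
    push_cast
    ring

lemma integrable_poleKernel {B c : ℝ} {p : ℂ} (h1 : c ≠ p.re) (h2 : c - p.re + B ≠ 0) :
    Integrable fun τ : ℝ => poleKernel B p (c + τ * I) := by
  simp_rw [poleKernel_line]
  exact (integrable_inv_sub_inv (sub_ne_zero.2 h1) h2).comp_sub_right p.im

lemma integral_poleKernel {B c : ℝ} {p : ℂ} (h1 : c ≠ p.re) (h2 : c - p.re + B ≠ 0) :
    ∫ τ : ℝ, poleKernel B p (c + τ * I) = ((Real.pi * (|c - p.re| / (c - p.re) -
      |c - p.re + B| / (c - p.re + B)) : ℝ) : ℂ) := by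
  simp_rw [poleKernel_line]
  rw [integral_sub_right_eq_self (fun τ : ℝ => (((c - p.re : ℝ) : ℂ) + τ * I)⁻¹ -
      (((c - p.re + B : ℝ) : ℂ) + τ * I)⁻¹) p.im]
  exact integral_inv_sub_inv (sub_ne_zero.2 h1) h2

lemma vanishesVertically_poleKernel (B : ℝ) (p : ℂ) (a b : ℝ) :
    VanishesVertically (poleKernel B p) a b := by
  intro ε hε
  refine ⟨|p.im| + 2 / ε, fun z _ _ h => ?_⟩
  have key : ∀ q : ℂ, q.im = p.im → ‖(z - q)⁻¹‖ ≤ ε / 2 := fun q hq => by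
    have h1 : 2 / ε ≤ ‖z - q‖ := by
      calc 2 / ε ≤ |z.im| - |p.im| := by linarith
        _ ≤ |z.im - p.im| := abs_sub_abs_le_abs_sub _ _
        _ = |(z - q).im| := by simp [hq]
        _ ≤ _ := abs_im_le_norm _
    rw [norm_inv]
    calc ‖z - q‖⁻¹ ≤ (2 / ε)⁻¹ := by gcongr
      _ = ε / 2 := inv_div _ _
  calc _ ≤ ε / 2 + ε / 2 := (norm_sub_le _ _).trans (add_le_add (key p rfl) (key _ (by simp)))
    _ = ε := by ring

lemma differentiableAt_poleKernel {B : ℝ} {p z : ℂ} (h1 : z ≠ p) (h2 : z ≠ p - B) :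
    DifferentiableAt ℂ (poleKernel B p) z := by
  unfold poleKernel
  exact ((by fun_prop : DifferentiableAt ℂ (fun z : ℂ => z - p) z).inv (sub_ne_zero.2 h1)).sub
    ((by fun_prop : DifferentiableAt ℂ (fun z : ℂ => z - (p - B)) z).inv (sub_ne_zero.2 h2))

lemma tendsto_sub_mul_poleKernel {B : ℝ} (hB : B ≠ 0) (p : ℂ) :
    Tendsto (fun z => (z - p) * poleKernel B p z) (𝓝[≠] p) (𝓝 1) := by
  have hB' : p ≠ p - B := fun h => hB (by
    have : (B : ℂ) = 0 := by linear_combination h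
    exact_mod_cast this)
  have hc : ContinuousAt (fun z : ℂ => 1 - (z - p) * (z - (p - B))⁻¹) p :=
    continuousAt_const.sub ((by fun_prop : ContinuousAt (fun z : ℂ => z - p) p).mul
      ((by fun_prop : ContinuousAt (fun z : ℂ => z - (p - B)) p).inv₀ (sub_ne_zero.2 hB')))
  have := hc.tendsto.mono_left (nhdsWithin_le_nhds (s := {p}ᶜ))
  simp only [sub_self, zero_mul, sub_zero] at this
  refine this.congr' ?_
  filter_upwards [self_mem_nhdsWithin] with z hz
  have : z - p ≠ 0 := sub_ne_zero.2 hz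
  rw [poleKernel, mul_sub, mul_inv_cancel₀ this]

lemma tendsto_sub_mul_zero_of_continuousAt {f : ℂ → ℂ} {p : ℂ} (hf : ContinuousAt f p) :
    Tendsto (fun z => (z - p) * f z) (𝓝[≠] p) (𝓝 0) := by
  have hc : ContinuousAt (fun z : ℂ => (z - p) * f z) p :=
    (by fun_prop : ContinuousAt (fun z : ℂ => z - p) p).mul hf
  simpa using hc.tendsto.mono_left (nhdsWithin_le_nhds (s := {p}ᶜ))

/-- **Residue theorem for a vertical strip** with finitely many simple poles. -/
theorem integral_vertical_sub_eq_sum_residues {H : ℂ → ℂ} {a b : ℝ} (hab : a ≤ b) {U : Set ℂ}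
    (hU : IsOpen U) (hsub : {z : ℂ | a ≤ z.re ∧ z.re ≤ b} ⊆ U) (S : Finset ℂ)
    (hS : ∀ p ∈ S, a < p.re ∧ p.re < b) (hd : ∀ z ∈ U, z ∉ S → DifferentiableAt ℂ H z)
    (ρ : ℂ → ℂ) (hρ : ∀ p ∈ S, Tendsto (fun z => (z - p) * H z) (𝓝[≠] p) (𝓝 (ρ p)))
    (ha : Integrable fun τ : ℝ => H (a + τ * I)) (hb : Integrable fun τ : ℝ => H (b + τ * I))
    (hv : VanishesVertically H a b) :
    (∫ τ : ℝ, H (b + τ * I)) - ∫ τ : ℝ, H (a + τ * I) = 2 * Real.pi * ∑ p ∈ S, ρ p := by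
  classical
  -- `B` exceeds the width of the strip, so the auxiliary pole `p - B` of each kernel lies to the
  -- left of it; `U'` trims `U` to avoid these poles.
  set B : ℝ := b - a + 1 with hB
  set U' : Set ℂ := U ∩ {z | ∀ p ∈ S, (p.re - B) < z.re} with hU'
  have hU'o : IsOpen U' := by
    refine hU.inter ?_
    have : {z : ℂ | ∀ p ∈ S, (p.re - B) < z.re} = ⋂ p ∈ S, {z : ℂ | p.re - B < z.re} := by
      ext z; simp
    rw [this]
    exact isOpen_biInter_finset fun p _ => isOpen_lt continuous_const continuous_re
  -- With the principal parts subtracted, the singularities on `S` are removable and the two line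
  -- integrals agree. The residue sum then comes from the kernels alone.
  set G : ℂ → ℂ := fun z => H z - ∑ p ∈ S, ρ p * poleKernel B p z with hG
  have hpk : ∀ p ∈ S, ∀ z ∈ U', z ≠ p → DifferentiableAt ℂ (poleKernel B p) z :=
    fun p hp z hz hzp => differentiableAt_poleKernel hzp fun h => by
      have := hz.2 p hp
      rw [h] at this
      simp at this
  have hSU : ∀ p ∈ S, p ∈ U' := fun p hp => ⟨hsub ⟨(hS p hp).1.le, (hS p hp).2.le⟩, fun q hq => by
    have := hS p hp
    have := hS q hq
    linarith⟩
  obtain ⟨g, hgd, hg⟩ := exists_differentiableOn_of_removable (f := G) hU'o S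
    (fun z hz hzS => (hd z hz.1 hzS).sub (DifferentiableAt.fun_sum fun p hp =>
      (hpk p hp z hz fun h => hzS (h ▸ hp)).const_mul _)) (fun p hp => by
      have h1 := (hρ p hp).sub ((tendsto_sub_mul_poleKernel (B := B) (by linarith) p).const_mul (ρ p))
      have h2 : Tendsto (fun z => (z - p) * ∑ q ∈ S.erase p, ρ q * poleKernel B q z) (𝓝[≠] p)
          (𝓝 0) := by
        have hdiff : DifferentiableAt ℂ (fun z => ∑ q ∈ S.erase p, ρ q * poleKernel B q z) p := ?_
        · exact tendsto_sub_mul_zero_of_continuousAt hdiff.continuousAt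
        refine DifferentiableAt.fun_sum fun q hq => ?_
        have hq' := Finset.mem_erase.1 hq
        exact (hpk q hq'.2 p (hSU p hp) hq'.1.symm).const_mul _
      have h3 := h1.sub h2
      simp only [mul_one, sub_self] at h3
      refine h3.congr fun z => ?_
      simp only [hG]
      rw [← Finset.add_sum_erase S _ hp]
      ring)
  have hstrip : ∀ z : ℂ, a ≤ z.re → z.re ≤ b → z ∈ U' := fun z h1 h2 => ⟨hsub ⟨h1, h2⟩, fun p hp => by
    have := hS p hp
    linarith⟩
  have hGv : VanishesVertically G a b := by
    refine hv.sub ?_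
    have : ∀ T : Finset ℂ, VanishesVertically (fun z => ∑ p ∈ T, ρ p * poleKernel B p z) a b := by
      intro T
      induction T using Finset.induction_on with
      | empty => exact fun ε hε => ⟨0, fun z _ _ _ => by simpa using hε.le⟩
      | insert p T hp ih =>
        have := ((vanishesVertically_poleKernel B p a b).const_mul (-ρ p))
        have := ih.sub this
        intro ε hε
        obtain ⟨T', hT'⟩ := this ε hε
        refine ⟨T', fun z h1 h2 h3 => ?_⟩
        have := hT' z h1 h2 h3
        simpa only [Finset.sum_insert hp, neg_mul, sub_neg_eq_add, add_comm] using this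
    exact this S
  have hline : ∀ c : ℝ, (c = a ∨ c = b) → ∀ τ : ℝ, g (c + τ * I) = G (c + τ * I) := by
    intro c hc τ
    refine hg _ (hstrip _ ?_ ?_) fun hmem => ?_
    · rcases hc with rfl | rfl <;> simp [hab]
    · rcases hc with rfl | rfl <;> simp [hab]
    · have := hS _ hmem
      simp at this
      rcases hc with rfl | rfl <;> linarith
  have hne : ∀ c : ℝ, (c = a ∨ c = b) → ∀ p ∈ S, c ≠ p.re ∧ c - p.re + B ≠ 0 := by
    intro c hc p hp
    have := hS p hp
    rcases hc with rfl | rfl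
    · exact ⟨by linarith, by linarith⟩
    · exact ⟨by linarith, by linarith⟩
  have hki : ∀ c : ℝ, (c = a ∨ c = b) →
      Integrable fun τ : ℝ => ∑ p ∈ S, ρ p * poleKernel B p (c + τ * I) := fun c hc =>
    integrable_finsetSum _ fun p hp =>
      (integrable_poleKernel (hne c hc p hp).1 (hne c hc p hp).2).const_mul _
  have hGa : Integrable fun τ : ℝ => G (a + τ * I) := ha.sub (hki a (Or.inl rfl))
  have hGb : Integrable fun τ : ℝ => G (b + τ * I) := hb.sub (hki b (Or.inr rfl))
  have hgv : VanishesVertically g a b := by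
    intro ε hε
    obtain ⟨T, hT⟩ := hGv ε hε
    obtain ⟨T', hT'⟩ : ∃ T' : ℝ, ∀ p ∈ S, |p.im| < T' := by
      refine ⟨∑ p ∈ S, |p.im| + 1, fun p hp => ?_⟩
      have := Finset.single_le_sum (f := fun p : ℂ => |p.im|) (fun q _ => abs_nonneg _) hp
      linarith
    refine ⟨max T T', fun z h1 h2 h3 => ?_⟩
    rw [hg z (hstrip z h1 h2) fun hz => by
      have := hT' z hz
      linarith [(le_max_right _ _).trans h3]]
    exact hT z h1 h2 ((le_max_left _ _).trans h3)
  have heq := integral_vertical_eq_of_differentiableOn hab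
    (hgd.mono fun z hz => hstrip z hz.1 hz.2) (by simpa [hline a (Or.inl rfl)] using hGa)
    (by simpa [hline b (Or.inr rfl)] using hGb) hgv
  simp_rw [hline a (Or.inl rfl), hline b (Or.inr rfl)] at heq
  have hsplit : ∀ c : ℝ, (c = a ∨ c = b) → (Integrable fun τ : ℝ => H (c + τ * I)) →
      ∫ τ : ℝ, G (c + τ * I) = (∫ τ : ℝ, H (c + τ * I)) -
        ∑ p ∈ S, ρ p * ∫ τ : ℝ, poleKernel B p (c + τ * I) := by
    intro c hc hi
    simp only [hG]
    rw [integral_sub hi (hki c hc), integral_finsetSum _ fun p hp =>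
      (integrable_poleKernel (hne c hc p hp).1 (hne c hc p hp).2).const_mul _]
    simp_rw [integral_const_mul]
  rw [hsplit a (Or.inl rfl) ha, hsplit b (Or.inr rfl) hb] at heq
  have hfin : (∫ τ : ℝ, H (b + τ * I)) - ∫ τ : ℝ, H (a + τ * I) =
      ∑ p ∈ S, (ρ p * (∫ τ : ℝ, poleKernel B p (b + τ * I)) -
        ρ p * ∫ τ : ℝ, poleKernel B p (a + τ * I)) := by
    rw [Finset.sum_sub_distrib]
    linear_combination heq
  rw [hfin, Finset.mul_sum]
  refine Finset.sum_congr rfl fun p hp => ?_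
  have hp' := hS p hp
  rw [integral_poleKernel (hne b (Or.inr rfl) p hp).1 (hne b (Or.inr rfl) p hp).2,
    integral_poleKernel (hne a (Or.inl rfl) p hp).1 (hne a (Or.inl rfl) p hp).2]
  -- The signs give `π (1 - 1) = 0` on the line through `b` and `π (-1 - 1) = -2π` on the one
  -- through `a`, hence `2π` per residue.
  have h1 : |b - p.re| / (b - p.re) = 1 := by
    rw [abs_of_pos (by linarith), div_self (by linarith)]
  have h2 : |b - p.re + B| / (b - p.re + B) = 1 := by
    rw [abs_of_pos (by linarith), div_self (by linarith)]
  have h3 : |a - p.re| / (a - p.re) = -1 := by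
    rw [abs_of_neg (by linarith), neg_div, div_self (by linarith)]
  have h4 : |a - p.re + B| / (a - p.re + B) = 1 := by
    rw [abs_of_pos (by linarith), div_self (by linarith)]
  rw [h1, h2, h3, h4]
  push_cast
  ring

end ResidueTheorem

/-! ### The Mellin–Barnes integral -/

section MellinBarnes

/-- Converts polynomial growth against the decay of Γ into one integrable majorant, through
`|t|^(n+2) / (n+2)! ≤ exp |t|`. -/
lemma pow_mul_exp_neg_le {n : ℕ} {t : ℝ} (ht : 1 ≤ |t|) :
    |t| ^ n * Real.exp (-(Real.pi / 2) * |t|) ≤ 2 * (n + 2).factorial * (1 + t ^ 2)⁻¹ := by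
  have h1 := Real.pow_div_factorial_le_exp |t| (abs_nonneg t) (n + 2)
  have h2 : Real.exp (-(Real.pi / 2) * |t|) ≤ Real.exp (-|t|) := by
    rw [Real.exp_le_exp]
    nlinarith [Real.pi_gt_three, abs_nonneg t]
  have hf : (0 : ℝ) < (n + 2).factorial := by exact_mod_cast Nat.factorial_pos _
  have hle : (1 + t ^ 2) ≤ 2 * |t| ^ 2 := by rw [← sq_abs t]; nlinarith
  rw [← div_eq_mul_inv, le_div_iff₀ (by positivity)]
  calc |t| ^ n * Real.exp (-(Real.pi / 2) * |t|) * (1 + t ^ 2)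
      ≤ |t| ^ n * Real.exp (-|t|) * (2 * |t| ^ 2) := by gcongr
    _ = 2 * (|t| ^ (n + 2) * Real.exp (-|t|)) := by ring
    _ ≤ 2 * (n + 2).factorial := by
        rw [div_le_iff₀ hf] at h1
        have : |t| ^ (n + 2) * Real.exp (-|t|) ≤ (n + 2).factorial := by
          rw [Real.exp_neg, ← div_eq_mul_inv, div_le_iff₀ (Real.exp_pos _)]
          linarith
        gcongr

variable {r₁ r₂ : ℕ} [NeZero r₁] [NeZero r₂]

/-- The factor `Γ(z) L(χ₁, z + s₁) L(χ₂, z + s₂)` of the Mellin–Barnes integrand. -/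
noncomputable def mellinFactor (χ₁ : DirichletCharacter ℂ r₁) (χ₂ : DirichletCharacter ℂ r₂) (s₁ s₂ z : ℂ) : ℂ :=
  Complex.Gamma z * DirichletCharacter.LFunction χ₁ (z + s₁) *
    DirichletCharacter.LFunction χ₂ (z + s₂)

/-- The Mellin–Barnes integrand of `Ξ`. -/
noncomputable def mellinIntegrand (χ₁ : DirichletCharacter ℂ r₁) (χ₂ : DirichletCharacter ℂ r₂) (s₁ s₂ : ℂ)
    (y : ℝ) (z : ℂ) : ℂ :=
  (2 * Real.pi * y : ℂ) ^ (-z) * mellinFactor χ₁ χ₂ s₁ s₂ z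

/-- The integral of the Mellin–Barnes integrand over the line `re z = σ`. -/
noncomputable def lineIntegral (χ₁ : DirichletCharacter ℂ r₁) (χ₂ : DirichletCharacter ℂ r₂) (σ : ℝ)
    (s₁ s₂ : ℂ) (y : ℝ) : ℂ :=
  ∫ τ : ℝ, mellinIntegrand χ₁ χ₂ s₁ s₂ y (σ + τ * I)

lemma norm_two_pi_mul_cpow {y : ℝ} (hy : 0 < y) (z : ℂ) :
    ‖(2 * Real.pi * y : ℂ) ^ z‖ = (2 * Real.pi * y) ^ z.re := by
  rw [show (2 * Real.pi * y : ℂ) = ((2 * Real.pi * y : ℝ) : ℂ) by push_cast; ring,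
    Complex.norm_cpow_eq_rpow_re_of_pos (by positivity)]

lemma norm_LFunction_add_le {N : ℕ} [NeZero N] (χ : DirichletCharacter ℂ N) (s : ℂ) (a b : ℝ) :
    ∃ (C : ℝ) (A : ℕ) (T : ℝ), 0 < C ∧ 1 ≤ T ∧ ∀ s' : ℂ, ‖s' - s‖ ≤ 1 → ∀ z : ℂ, a ≤ z.re →
      z.re ≤ b → T ≤ |z.im| → ‖DirichletCharacter.LFunction χ (z + s')‖ ≤ C * |z.im| ^ A := by
  obtain ⟨C, A, hC, h⟩ := polyBounded_LFunction χ (a + s.re - 1) (b + s.re + 1)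
  -- For `|im z| ≥ |im s| + 2` and `s'` within 1 of `s`, `|im (z + s')|` lies between 1 and `2 |im
  -- z|`; the 2 is the source of `2 ^ A`.
  refine ⟨C * 2 ^ A, A, |s.im| + 2, by positivity, by linarith [abs_nonneg s.im],
    fun s' hs' z h1 h2 h3 => ?_⟩
  have hre := abs_le.1 ((abs_re_le_norm _).trans hs')
  have him := (abs_im_le_norm _).trans hs'
  rw [sub_re] at hre
  have him2 : |s'.im| ≤ |s.im| + 1 := by
    calc |s'.im| = |s.im + (s' - s).im| := by simp
      _ ≤ |s.im| + |(s' - s).im| := abs_add_le _ _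
      _ ≤ _ := by linarith
  have hlow : 1 ≤ |(z + s').im| := by
    have : |z.im| - |s'.im| ≤ |(z + s').im| := by
      have := abs_sub_abs_le_abs_sub z.im (-s'.im)
      rw [abs_neg, sub_neg_eq_add] at this
      simpa using this
    linarith
  have hup : |(z + s').im| ≤ 2 * |z.im| := by
    have : |(z + s').im| ≤ |z.im| + |s'.im| := by simpa using abs_add_le z.im s'.im
    linarith
  calc _ ≤ C * |(z + s').im| ^ A := h (z + s') (by simp; linarith) (by simp; linarith) hlow
    _ ≤ C * (2 * |z.im|) ^ A := by gcongr
    _ = _ := by ring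

/-- The decay of Γ beats the growth of both L-functions. Uniformity in the parameters is what later
gives continuity of the line integral in `(s₁, s₂)`. -/
lemma norm_mellinFactor_le_of_large_im (χ₁ : DirichletCharacter ℂ r₁)
    (χ₂ : DirichletCharacter ℂ r₂) (s₁ s₂ : ℂ) (a b : ℝ) :
    ∃ C T : ℝ, 0 < C ∧ ∀ p : ℂ × ℂ, ‖p.1 - s₁‖ ≤ 1 → ‖p.2 - s₂‖ ≤ 1 → ∀ z : ℂ, a ≤ z.re →
      z.re ≤ b → T ≤ |z.im| → ‖mellinFactor χ₁ χ₂ p.1 p.2 z‖ ≤ C * (1 + z.im ^ 2)⁻¹ := by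
  obtain ⟨C, A, hC, h⟩ := norm_Gamma_le_vertical a b
  obtain ⟨C₁, A₁, T₁, hC₁, hT₁, h₁⟩ := norm_LFunction_add_le χ₁ s₁ a b
  obtain ⟨C₂, A₂, T₂, hC₂, hT₂, h₂⟩ := norm_LFunction_add_le χ₂ s₂ a b
  refine ⟨C * C₁ * C₂ * (2 * (A + A₁ + A₂ + 2).factorial), max T₁ T₂, by positivity,
    fun p hp1 hp2 z ha hb hz => ?_⟩
  have hz1 : T₁ ≤ |z.im| := (le_max_left _ _).trans hz
  have hz2 : T₂ ≤ |z.im| := (le_max_right _ _).trans hz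
  have h0 : 1 ≤ |z.im| := hT₁.trans hz1
  rw [mellinFactor, norm_mul, norm_mul]
  calc _ ≤ (C * |z.im| ^ A * Real.exp (-(Real.pi / 2) * |z.im|)) * (C₁ * |z.im| ^ A₁) *
        (C₂ * |z.im| ^ A₂) := by
        gcongr
        exacts [h z ha hb h0, h₁ _ hp1 z ha hb hz1, h₂ _ hp2 z ha hb hz2]
    _ = C * C₁ * C₂ * (|z.im| ^ (A + A₁ + A₂) * Real.exp (-(Real.pi / 2) * |z.im|)) := by ring
    _ ≤ C * C₁ * C₂ * (2 * (A + A₁ + A₂ + 2).factorial * (1 + z.im ^ 2)⁻¹) := by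
        exact mul_le_mul_of_nonneg_left (pow_mul_exp_neg_le h0) (by positivity)
    _ = _ := by ring

lemma continuousAt_LFunction {N : ℕ} [NeZero N] {χ : DirichletCharacter ℂ N} {s : ℂ}
    (h : χ = 1 → s ≠ 1) : ContinuousAt (DirichletCharacter.LFunction χ) s := by
  refine (DirichletCharacter.differentiableAt_LFunction χ s ?_).continuousAt
  by_cases hχ : χ = 1
  · exact Or.inl (h hχ)
  · exact Or.inr hχ

lemma ne_of_re_ne {z w : ℂ} (h : z.re ≠ w.re) : z ≠ w := fun e => h (e ▸ rfl)

lemma continuousAt_Gamma {z : ℂ} (h : ∀ k : ℕ, z ≠ -k) : ContinuousAt Complex.Gamma z :=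
  (Complex.differentiableAt_Gamma z h).continuousAt

/-- The line `re z = σ` avoids the poles of the Mellin–Barnes integrand. -/
def LineAvoidsPoles (χ₁ : DirichletCharacter ℂ r₁) (χ₂ : DirichletCharacter ℂ r₂) (σ : ℝ)
    (s₁ s₂ : ℂ) : Prop :=
  (∀ k : ℕ, σ ≠ -k) ∧ (χ₁ = 1 → σ + s₁.re ≠ 1) ∧ (χ₂ = 1 → σ + s₂.re ≠ 1)

lemma LineAvoidsPoles.eventually {χ₁ : DirichletCharacter ℂ r₁} {χ₂ : DirichletCharacter ℂ r₂}
    {σ : ℝ} {s₁ s₂ : ℂ} (h : LineAvoidsPoles χ₁ χ₂ σ s₁ s₂) :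
    ∃ δ > 0, δ ≤ 1 ∧ ∀ p : ℂ × ℂ, dist p (s₁, s₂) ≤ δ → LineAvoidsPoles χ₁ χ₂ σ p.1 p.2 := by
  have h1 : ∀ᶠ p : ℂ × ℂ in 𝓝 (s₁, s₂), χ₁ = 1 → σ + p.1.re ≠ 1 := by
    by_cases hχ : χ₁ = 1
    · have hc : ContinuousAt (fun p : ℂ × ℂ => σ + p.1.re) (s₁, s₂) := by fun_prop
      filter_upwards [hc.eventually_ne (h.2.1 hχ)] with p hp _ using hp
    · exact Eventually.of_forall fun p h => absurd h hχ
  have h2 : ∀ᶠ p : ℂ × ℂ in 𝓝 (s₁, s₂), χ₂ = 1 → σ + p.2.re ≠ 1 := by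
    by_cases hχ : χ₂ = 1
    · have hc : ContinuousAt (fun p : ℂ × ℂ => σ + p.2.re) (s₁, s₂) := by fun_prop
      filter_upwards [hc.eventually_ne (h.2.2 hχ)] with p hp _ using hp
    · exact Eventually.of_forall fun p h => absurd h hχ
  obtain ⟨ε, hε, hball⟩ := Metric.eventually_nhds_iff_ball.1 (h1.and h2)
  refine ⟨min (ε / 2) 1, by positivity, min_le_right _ _, fun p hp => ?_⟩
  have := hball p (Metric.mem_ball.2 (by
    have := min_le_left (ε / 2) 1
    linarith))
  exact ⟨h.1, this.1, this.2⟩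

lemma LineAvoidsPoles.continuousAt {χ₁ : DirichletCharacter ℂ r₁} {χ₂ : DirichletCharacter ℂ r₂}
    {σ : ℝ} {s₁ s₂ : ℂ} (h : LineAvoidsPoles χ₁ χ₂ σ s₁ s₂) (τ : ℝ) :
    ContinuousAt (fun q : (ℂ × ℂ) × ℝ => mellinFactor χ₁ χ₂ q.1.1 q.1.2 (σ + q.2 * I))
      ((s₁, s₂), τ) := by
  unfold mellinFactor
  refine ContinuousAt.mul (ContinuousAt.mul ?_ ?_) ?_
  · refine ContinuousAt.comp (g := Complex.Gamma)
      (f := fun q : (ℂ × ℂ) × ℝ => (σ + q.2 * I : ℂ)) (continuousAt_Gamma fun k => ?_) (by fun_prop)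
    exact ne_of_re_ne (by simpa using h.1 k)
  · refine ContinuousAt.comp (g := DirichletCharacter.LFunction χ₁)
      (f := fun q : (ℂ × ℂ) × ℝ => (σ + q.2 * I + q.1.1 : ℂ))
      (continuousAt_LFunction fun hχ => ?_) (by fun_prop)
    exact ne_of_re_ne (by simpa using h.2.1 hχ)
  · refine ContinuousAt.comp (g := DirichletCharacter.LFunction χ₂)
      (f := fun q : (ℂ × ℂ) × ℝ => (σ + q.2 * I + q.1.2 : ℂ))
      (continuousAt_LFunction fun hχ => ?_) (by fun_prop)
    exact ne_of_re_ne (by simpa using h.2.2 hχ)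

/-- At large height the factor decays; at bounded height it is continuous on a compact set of
parameters and heights. The resulting majorant serves integrability, the bound in `y` and dominated
convergence. -/
lemma LineAvoidsPoles.exists_bound {χ₁ : DirichletCharacter ℂ r₁} {χ₂ : DirichletCharacter ℂ r₂}
    {σ : ℝ} {s₁ s₂ : ℂ} (h : LineAvoidsPoles χ₁ χ₂ σ s₁ s₂) :
    ∃ δ > 0, ∃ C > 0, ∀ p : ℂ × ℂ, dist p (s₁, s₂) ≤ δ → ∀ τ : ℝ,
      ‖mellinFactor χ₁ χ₂ p.1 p.2 (σ + τ * I)‖ ≤ C * (1 + τ ^ 2)⁻¹ := by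
  obtain ⟨δ, hδ, hδ1, hav⟩ := h.eventually
  obtain ⟨C, T, hC, hlarge⟩ := norm_mellinFactor_le_of_large_im χ₁ χ₂ s₁ s₂ σ σ
  have hK : IsCompact (Metric.closedBall (s₁, s₂) δ ×ˢ Icc (-|T|) |T|) :=
    (isCompact_closedBall _ _).prod isCompact_Icc
  obtain ⟨D, hD⟩ := hK.exists_bound_of_continuousOn
    (f := fun q : (ℂ × ℂ) × ℝ => mellinFactor χ₁ χ₂ q.1.1 q.1.2 (σ + q.2 * I))
    fun q hq => ((hav q.1 hq.1).continuousAt q.2).continuousWithinAt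
  refine ⟨δ, hδ, C + |D| * (1 + T ^ 2), by positivity, fun p hp τ => ?_⟩
  have hpos : (0 : ℝ) < (1 + τ ^ 2)⁻¹ := by positivity
  rcases le_total T |τ| with hτ | hτ
  · have hp1 : ‖p.1 - s₁‖ ≤ 1 := by
      rw [← dist_eq_norm]
      exact ((le_max_left _ _).trans hp).trans hδ1
    have hp2 : ‖p.2 - s₂‖ ≤ 1 := by
      rw [← dist_eq_norm]
      exact ((le_max_right _ _).trans hp).trans hδ1
    have := hlarge p hp1 hp2 (σ + τ * I) (by simp) (by simp) (by simpa using hτ)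
    have him : (σ + τ * I : ℂ).im = τ := by simp
    rw [him] at this
    refine this.trans ?_
    gcongr
    have : 0 ≤ |D| * (1 + T ^ 2) := by positivity
    linarith
  · have hτ' : τ ^ 2 ≤ T ^ 2 := by
      rw [← sq_abs τ]
      have := abs_nonneg τ
      gcongr
    have h1 : 1 ≤ (1 + T ^ 2) * (1 + τ ^ 2)⁻¹ := by
      rw [← div_eq_mul_inv, one_le_div (by positivity)]
      linarith
    have := hD (p, τ) ⟨hp, abs_le.1 (hτ.trans (le_abs_self T))⟩
    calc _ ≤ D := this
      _ ≤ |D| * 1 := by rw [mul_one]; exact le_abs_self D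
      _ ≤ |D| * ((1 + T ^ 2) * (1 + τ ^ 2)⁻¹) := by gcongr
      _ ≤ _ := by
        have : 0 ≤ C * (1 + τ ^ 2)⁻¹ := by positivity
        nlinarith

lemma continuous_two_pi_mul_cpow {y : ℝ} (hy : 0 < y) (σ : ℝ) :
    Continuous fun τ : ℝ => (2 * Real.pi * y : ℂ) ^ (-(σ + τ * I : ℂ)) := by
  have hne : (2 * Real.pi * y : ℂ) ≠ 0 := by
    exact_mod_cast (by positivity : 2 * Real.pi * y ≠ 0)
  exact Continuous.const_cpow (by fun_prop) (Or.inl hne)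

lemma LineAvoidsPoles.aestronglyMeasurable {χ₁ : DirichletCharacter ℂ r₁}
    {χ₂ : DirichletCharacter ℂ r₂} {σ : ℝ} {s₁ s₂ : ℂ} (h : LineAvoidsPoles χ₁ χ₂ σ s₁ s₂)
    {y : ℝ} (hy : 0 < y) :
    AEStronglyMeasurable fun τ : ℝ => mellinIntegrand χ₁ χ₂ s₁ s₂ y (σ + τ * I) := by
  refine Continuous.aestronglyMeasurable ((continuous_two_pi_mul_cpow hy σ).mul ?_)
  refine continuous_iff_continuousAt.2 fun τ => ?_
  exact (h.continuousAt τ).comp (f := fun τ : ℝ => ((s₁, s₂), τ)) (by fun_prop)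

lemma norm_mellinIntegrand_line {χ₁ : DirichletCharacter ℂ r₁} {χ₂ : DirichletCharacter ℂ r₂}
    {σ : ℝ} {s₁ s₂ : ℂ} {y : ℝ} (hy : 0 < y) (τ : ℝ) :
    ‖mellinIntegrand χ₁ χ₂ s₁ s₂ y (σ + τ * I)‖ =
      (2 * Real.pi * y) ^ (-σ) * ‖mellinFactor χ₁ χ₂ s₁ s₂ (σ + τ * I)‖ := by
  rw [mellinIntegrand, norm_mul, norm_two_pi_mul_cpow hy]
  simp

lemma LineAvoidsPoles.integrable {χ₁ : DirichletCharacter ℂ r₁} {χ₂ : DirichletCharacter ℂ r₂}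
    {σ : ℝ} {s₁ s₂ : ℂ} (h : LineAvoidsPoles χ₁ χ₂ σ s₁ s₂) {y : ℝ} (hy : 0 < y) :
    Integrable fun τ : ℝ => mellinIntegrand χ₁ χ₂ s₁ s₂ y (σ + τ * I) := by
  obtain ⟨δ, hδ, C, hC, hb⟩ := h.exists_bound
  refine ((integrable_inv_one_add_sq.const_mul C).const_mul ((2 * Real.pi * y) ^ (-σ))).mono'
    (h.aestronglyMeasurable hy) (Eventually.of_forall fun τ => ?_)
  rw [norm_mellinIntegrand_line hy]
  gcongr
  exact hb (s₁, s₂) (by simpa using hδ.le) τ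

/-- `y` enters the modulus of the integrand only through `(2πy)^(-σ)`, so a line far to the left
gives a high power of `y`. -/
lemma LineAvoidsPoles.norm_lineIntegral_le {χ₁ : DirichletCharacter ℂ r₁}
    {χ₂ : DirichletCharacter ℂ r₂} {σ : ℝ} {s₁ s₂ : ℂ} (h : LineAvoidsPoles χ₁ χ₂ σ s₁ s₂) :
    ∃ C > 0, ∀ y : ℝ, 0 < y → ‖lineIntegral χ₁ χ₂ σ s₁ s₂ y‖ ≤ C * y ^ (-σ) := by
  obtain ⟨δ, hδ, C, hC, hb⟩ := h.exists_bound
  refine ⟨(2 * Real.pi) ^ (-σ) * (C * Real.pi), by positivity, fun y hy => ?_⟩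
  have := norm_integral_le_of_norm_le
    (f := fun τ : ℝ => mellinIntegrand χ₁ χ₂ s₁ s₂ y (σ + τ * I))
    ((integrable_inv_one_add_sq.const_mul C).const_mul ((2 * Real.pi * y) ^ (-σ)))
    (Eventually.of_forall fun τ => by
      rw [norm_mellinIntegrand_line hy]
      gcongr
      exact hb (s₁, s₂) (by simpa using hδ.le) τ)
  rw [integral_const_mul, integral_const_mul, integral_univ_inv_one_add_sq,
    Real.mul_rpow (by positivity) hy.le] at this
  refine this.trans (le_of_eq ?_)
  ring

lemma LineAvoidsPoles.continuousAt_lineIntegral {χ₁ : DirichletCharacter ℂ r₁}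
    {χ₂ : DirichletCharacter ℂ r₂} {σ : ℝ} {s₁ s₂ : ℂ} (h : LineAvoidsPoles χ₁ χ₂ σ s₁ s₂)
    {y : ℝ} (hy : 0 < y) :
    ContinuousAt (fun p : ℂ × ℂ => lineIntegral χ₁ χ₂ σ p.1 p.2 y) (s₁, s₂) := by
  obtain ⟨δ, hδ, C, hC, hb⟩ := h.exists_bound
  obtain ⟨δ', hδ', -, hav⟩ := h.eventually
  unfold lineIntegral
  refine continuousAt_of_dominated
    (bound := fun τ => (2 * Real.pi * y) ^ (-σ) * (C * (1 + τ ^ 2)⁻¹)) ?_ ?_ ?_ ?_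
  · filter_upwards [Metric.closedBall_mem_nhds (s₁, s₂) hδ'] with p hp
    exact (hav p hp).aestronglyMeasurable hy
  · filter_upwards [Metric.closedBall_mem_nhds (s₁, s₂) hδ] with p hp
    refine Eventually.of_forall fun τ => ?_
    rw [norm_mellinIntegrand_line hy]
    gcongr
    exact hb p hp τ
  · exact (integrable_inv_one_add_sq.const_mul C).const_mul _
  · refine Eventually.of_forall fun τ => ?_
    unfold mellinIntegrand
    refine continuousAt_const.mul ?_
    exact (h.continuousAt τ).comp (f := fun p : ℂ × ℂ => (p, τ)) (by fun_prop)

end MellinBarnes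

/-! ### `Ξ` as a Mellin–Barnes integral -/

section XiMellinBarnes

lemma integrable_Gamma_line {c : ℝ} (hc : 0 < c) :
    Integrable fun τ : ℝ => Complex.Gamma (c + τ * I) := by
  obtain ⟨C, A, hC, h⟩ := norm_Gamma_le_vertical c c
  have hcont : Continuous fun τ : ℝ => Complex.Gamma (c + τ * I) :=
    continuous_iff_continuousAt.2 fun τ => ContinuousAt.comp (g := Complex.Gamma)
      (f := fun τ : ℝ => (c + τ * I : ℂ)) (continuousAt_Gamma fun k => ne_of_re_ne (by
        have : (0 : ℝ) ≤ k := k.cast_nonneg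
        simp
        linarith)) (by fun_prop)
  obtain ⟨D, hD⟩ := (isCompact_Icc (a := (-1 : ℝ)) (b := 1)).exists_bound_of_continuousOn
    hcont.continuousOn
  refine (integrable_inv_one_add_sq.const_mul (C * (2 * (A + 2).factorial) + |D| * 2)).mono'
    hcont.aestronglyMeasurable (Eventually.of_forall fun τ => ?_)
  rcases le_total 1 |τ| with hτ | hτ
  · have := h (c + τ * I) (by simp) (by simp) (by simpa using hτ)
    rw [show (c + τ * I : ℂ).im = τ by simp, mul_assoc] at this
    calc _ ≤ C * (|τ| ^ A * Real.exp (-(Real.pi / 2) * |τ|)) := this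
      _ ≤ C * (2 * (A + 2).factorial * (1 + τ ^ 2)⁻¹) :=
        mul_le_mul_of_nonneg_left (pow_mul_exp_neg_le hτ) hC.le
      _ ≤ _ := by
        have : 0 ≤ |D| * 2 * (1 + τ ^ 2)⁻¹ := by positivity
        linarith
  · have h1 : 1 ≤ 2 * (1 + τ ^ 2)⁻¹ := by
      rw [← div_eq_mul_inv, one_le_div (by positivity), ← sq_abs]
      nlinarith [abs_nonneg τ]
    calc _ ≤ D := hD τ (abs_le.1 hτ)
      _ ≤ |D| * 1 := by rw [mul_one]; exact le_abs_self D
      _ ≤ |D| * (2 * (1 + τ ^ 2)⁻¹) := by gcongr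
      _ ≤ _ := by
        have : 0 ≤ C * (2 * (A + 2).factorial) * (1 + τ ^ 2)⁻¹ := by positivity
        linarith

lemma mellin_exp_neg {s : ℂ} (hs : 0 < s.re) :
    mellin (fun t : ℝ => Complex.exp (-t)) s = Complex.Gamma s := by
  rw [Complex.Gamma_eq_integral hs, Complex.GammaIntegral, mellin]
  refine setIntegral_congr_fun measurableSet_Ioi fun t _ => ?_
  simp [mul_comm]

/-- The Cahen–Mellin integral. -/
lemma integral_Gamma_mul_cpow_neg {c x : ℝ} (hc : 0 < c) (hx : 0 < x) :
    ∫ τ : ℝ, (x : ℂ) ^ (-(c + τ * I : ℂ)) * Complex.Gamma (c + τ * I) =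
      2 * Real.pi * Complex.exp (-x) := by
  have hre : ∀ τ : ℝ, 0 < (c + τ * I : ℂ).re := fun τ => by simpa using hc
  have hm : ∀ τ : ℝ, mellin (fun t : ℝ => Complex.exp (-t)) (c + τ * I) =
      Complex.Gamma (c + τ * I) := fun τ => mellin_exp_neg (hre τ)
  have hconv : MellinConvergent (fun t : ℝ => Complex.exp (-t)) (c : ℂ) := by
    have := Complex.GammaIntegral_convergent (s := c) (by simpa using hc)
    refine this.congr_fun (fun t _ => ?_) measurableSet_Ioi
    simp [mul_comm]
  -- Γ is the Mellin transform of `exp (-t)`; its integrability on the line permits Mellin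
  -- inversion.
  have := mellinInv_mellin_eq c (fun t : ℝ => Complex.exp (-t)) hx hconv (by
    unfold VerticalIntegrable
    simp_rw [hm]
    exact integrable_Gamma_line hc) (by fun_prop)
  rw [mellinInv] at this
  simp_rw [hm, smul_eq_mul] at this
  rw [← this, Complex.real_smul]
  generalize ∫ τ : ℝ, (x : ℂ) ^ (-(c + τ * I : ℂ)) * Complex.Gamma (c + τ * I) = J
  have hpi : (Real.pi : ℂ) ≠ 0 := by exact_mod_cast Real.pi_ne_zero
  push_cast
  field_simp

variable {r₁ r₂ : ℕ}

lemma norm_dirichletCharacter_div_cpow_le {N : ℕ} (χ : DirichletCharacter ℂ N) (n : ℕ+) (s : ℂ) :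
    ‖χ ((n : ℕ) : ZMod N) / ((n : ℕ) : ℂ) ^ s‖ ≤ ((n : ℕ) : ℝ) ^ (-s.re) := by
  rw [norm_div, Complex.norm_natCast_cpow_of_pos n.pos, Real.rpow_neg (by positivity), div_eq_mul_inv]
  exact mul_le_of_le_one_left (by positivity) (χ.norm_le_one _)

lemma summable_pnat_rpow {c : ℝ} (hc : 1 < c) : Summable fun n : ℕ+ => ((n : ℕ) : ℝ) ^ (-c) :=
  summable_pnat_iff_summable_nat.2 (Real.summable_nat_rpow.2 (by linarith))

lemma hasSum_LFunction_pnat {N : ℕ} [NeZero N] (χ : DirichletCharacter ℂ N) {s : ℂ}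
    (hs : 1 < s.re) : HasSum (fun n : ℕ+ => χ ((n : ℕ) : ZMod N) / ((n : ℕ) : ℂ) ^ s)
      (DirichletCharacter.LFunction χ s) := by
  rw [DirichletCharacter.LFunction_eq_LSeries χ hs]
  have h := (ZMod.LSeriesSummable_of_one_lt_re χ hs).hasSum
  have h0 : LSeries.term (fun n : ℕ => χ (n : ZMod N)) s 0 = 0 := LSeries.term_zero _ _
  have := (hasSum_pnat_iff (f := LSeries.term (fun n : ℕ => χ (n : ZMod N)) s)
    (a := LSeries (fun n : ℕ => χ (n : ZMod N)) s)).2 (by rw [h0, add_zero]; exact h)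
  refine this.congr_fun ?_ |> fun h => h
  intro n
  rw [LSeries.term_of_ne_zero n.ne_zero]

/-- The integrand of the `p`-th term of `Ξ`. -/
noncomputable def mellinSummand (χ₁ : DirichletCharacter ℂ r₁) (χ₂ : DirichletCharacter ℂ r₂)
    (s₁ s₂ : ℂ) (y : ℝ) (z : ℂ) (p : ℕ+ × ℕ+) : ℂ :=
  (2 * Real.pi * y : ℂ) ^ (-z) * Complex.Gamma z *
    (χ₁ ((p.1 : ℕ) : ZMod r₁) / ((p.1 : ℕ) : ℂ) ^ (z + s₁) *
      (χ₂ ((p.2 : ℕ) : ZMod r₂) / ((p.2 : ℕ) : ℂ) ^ (z + s₂)))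

/-- All bases are nonnegative reals, so the complex powers combine; `z` is left only in a
Cahen–Mellin integrand. -/
lemma mellinSummand_eq (χ₁ : DirichletCharacter ℂ r₁) (χ₂ : DirichletCharacter ℂ r₂)
    (s₁ s₂ : ℂ) {y : ℝ} (hy : 0 < y) (z : ℂ) (p : ℕ+ × ℕ+) :
    mellinSummand χ₁ χ₂ s₁ s₂ y z p = (χ₁ ((p.1 : ℕ) : ZMod r₁) / ((p.1 : ℕ) : ℂ) ^ s₁ *
      (χ₂ ((p.2 : ℕ) : ZMod r₂) / ((p.2 : ℕ) : ℂ) ^ s₂)) *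
      (((2 * Real.pi * y * ((p.1 : ℕ) * (p.2 : ℕ)) : ℝ) : ℂ) ^ (-z) * Complex.Gamma z) := by
  have hn1 : ((p.1 : ℕ) : ℂ) ≠ 0 := by exact_mod_cast p.1.ne_zero
  have hn2 : ((p.2 : ℕ) : ℂ) ≠ 0 := by exact_mod_cast p.2.ne_zero
  have hpos : (0 : ℝ) ≤ 2 * Real.pi * y := by positivity
  have e : ((2 * Real.pi * y * ((p.1 : ℕ) * (p.2 : ℕ)) : ℝ) : ℂ) ^ (-z) =
      (2 * Real.pi * y : ℂ) ^ (-z) * (((p.1 : ℕ) : ℂ) ^ (-z) * ((p.2 : ℕ) : ℂ) ^ (-z)) := by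
    have hnn : (0 : ℝ) ≤ ((p.1 : ℕ) : ℝ) * ((p.2 : ℕ) : ℝ) := by positivity
    rw [Complex.ofReal_mul, Complex.mul_cpow_ofReal_nonneg hpos hnn]
    congr 1
    · push_cast
      rfl
    · rw [Complex.ofReal_mul,
        Complex.mul_cpow_ofReal_nonneg (Nat.cast_nonneg _) (Nat.cast_nonneg _)]
      push_cast
      rfl
  rw [e, mellinSummand, Complex.cpow_add _ _ hn1, Complex.cpow_add _ _ hn2, Complex.cpow_neg,
    Complex.cpow_neg, Complex.cpow_neg]
  have a1 : ((p.1 : ℕ) : ℂ) ^ z ≠ 0 := by simp [Complex.cpow_eq_zero_iff, hn1]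
  have a2 : ((p.2 : ℕ) : ℂ) ^ z ≠ 0 := by simp [Complex.cpow_eq_zero_iff, hn2]
  field_simp

variable [NeZero r₁] [NeZero r₂]

lemma hasSum_mellinSummand (χ₁ : DirichletCharacter ℂ r₁) (χ₂ : DirichletCharacter ℂ r₂)
    {s₁ s₂ z : ℂ} (h1 : 1 < (z + s₁).re) (h2 : 1 < (z + s₂).re) (y : ℝ) :
    HasSum (mellinSummand χ₁ χ₂ s₁ s₂ y z) (mellinIntegrand χ₁ χ₂ s₁ s₂ y z) := by
  have e1 := hasSum_LFunction_pnat χ₁ h1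
  have e2 := hasSum_LFunction_pnat χ₂ h2
  have n1 : Summable fun n : ℕ+ => ‖χ₁ ((n : ℕ) : ZMod r₁) / ((n : ℕ) : ℂ) ^ (z + s₁)‖ :=
    Summable.of_nonneg_of_le (fun _ => norm_nonneg _)
      (fun n => norm_dirichletCharacter_div_cpow_le χ₁ n _) (summable_pnat_rpow h1)
  have n2 : Summable fun n : ℕ+ => ‖χ₂ ((n : ℕ) : ZMod r₂) / ((n : ℕ) : ℂ) ^ (z + s₂)‖ :=
    Summable.of_nonneg_of_le (fun _ => norm_nonneg _)
      (fun n => norm_dirichletCharacter_div_cpow_le χ₂ n _) (summable_pnat_rpow h2)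
  have hs := summable_mul_of_summable_norm n1 n2
  have := (e1.mul e2 hs).mul_left ((2 * Real.pi * y : ℂ) ^ (-z) * Complex.Gamma z)
  have e : mellinIntegrand χ₁ χ₂ s₁ s₂ y z = (2 * Real.pi * y : ℂ) ^ (-z) * Complex.Gamma z *
      (DirichletCharacter.LFunction χ₁ (z + s₁) * DirichletCharacter.LFunction χ₂ (z + s₂)) := by
    rw [mellinIntegrand, mellinFactor]
    ring
  rw [e]
  exact this

lemma nome_pow (y : ℝ) (k : ℕ) : nome y ^ k = Complex.exp (-((2 * Real.pi * y * k : ℝ) : ℂ)) := by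
  rw [nome, ← Complex.exp_nat_mul]
  congr 1
  push_cast
  ring

/-- The double series `Ξ` converges and is a Mellin–Barnes integral. -/
theorem hasSum_xiSummand (χ₁ : DirichletCharacter ℂ r₁) (χ₂ : DirichletCharacter ℂ r₂)
    {s₁ s₂ : ℂ} {c : ℝ} (hc : 0 < c) (h1 : 1 < c + s₁.re) (h2 : 1 < c + s₂.re) {y : ℝ}
    (hy : 0 < y) :
    HasSum (xiSummand χ₁ χ₂ s₁ s₂ (nome y))
      ((2 * Real.pi : ℂ)⁻¹ * lineIntegral χ₁ χ₂ c s₁ s₂ y) := by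
  have hpi : (Real.pi : ℂ) ≠ 0 := by exact_mod_cast Real.pi_ne_zero
  have hx : ∀ p : ℕ+ × ℕ+, 0 < 2 * Real.pi * y * ((p.1 : ℕ) * (p.2 : ℕ)) := fun p => by
    have := p.1.pos
    have := p.2.pos
    positivity
  have hG := integrable_Gamma_line hc
  have hnormF : ∀ (p : ℕ+ × ℕ+) (τ : ℝ), ‖mellinSummand χ₁ χ₂ s₁ s₂ y (c + τ * I) p‖ ≤
      (2 * Real.pi * y) ^ (-c) * (((p.1 : ℕ) : ℝ) ^ (-(c + s₁.re)) *
        ((p.2 : ℕ) : ℝ) ^ (-(c + s₂.re))) * ‖Complex.Gamma (c + τ * I)‖ := fun p τ => by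
    rw [mellinSummand, norm_mul, norm_mul, norm_mul, norm_two_pi_mul_cpow hy]
    have b1 := norm_dirichletCharacter_div_cpow_le χ₁ p.1 (c + τ * I + s₁)
    have b2 := norm_dirichletCharacter_div_cpow_le χ₂ p.2 (c + τ * I + s₂)
    rw [show (c + τ * I + s₁).re = c + s₁.re by simp] at b1
    rw [show (c + τ * I + s₂).re = c + s₂.re by simp] at b2
    rw [show (-(c + τ * I : ℂ)).re = -c by simp]
    calc _ ≤ (2 * Real.pi * y) ^ (-c) * ‖Complex.Gamma (c + τ * I)‖ *
          (((p.1 : ℕ) : ℝ) ^ (-(c + s₁.re)) * ((p.2 : ℕ) : ℝ) ^ (-(c + s₂.re))) := by gcongr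
      _ = _ := by ring
  have hFint : ∀ p, Integrable fun τ : ℝ => mellinSummand χ₁ χ₂ s₁ s₂ y (c + τ * I) p := fun p => by
    refine (hG.norm.const_mul _).mono' ?_ (Eventually.of_forall (hnormF p))
    simp_rw [mellinSummand_eq χ₁ χ₂ s₁ s₂ hy]
    refine (AEStronglyMeasurable.mul ?_ hG.1).const_mul _
    have hne : ((2 * Real.pi * y * ((p.1 : ℕ) * (p.2 : ℕ)) : ℝ) : ℂ) ≠ 0 := by
      exact_mod_cast (hx p).ne'
    exact (Continuous.const_cpow (by fun_prop) (Or.inl hne)).aestronglyMeasurable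
  have hsum : Summable fun p : ℕ+ × ℕ+ => ∫ τ : ℝ, ‖mellinSummand χ₁ χ₂ s₁ s₂ y (c + τ * I) p‖ := by
    have hm : Summable fun p : ℕ+ × ℕ+ => ((p.1 : ℕ) : ℝ) ^ (-(c + s₁.re)) *
        ((p.2 : ℕ) : ℝ) ^ (-(c + s₂.re)) :=
      (summable_pnat_rpow h1).mul_of_nonneg (summable_pnat_rpow h2) (fun _ => by positivity)
        (fun _ => by positivity)
    refine Summable.of_nonneg_of_le (fun p => integral_nonneg fun _ => norm_nonneg _) (fun p => ?_)
      ((hm.mul_left ((2 * Real.pi * y) ^ (-c))).mul_right (∫ τ : ℝ, ‖Complex.Gamma (c + τ * I)‖))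
    rw [← integral_const_mul]
    exact integral_mono (hFint p).norm (hG.norm.const_mul _) (hnormF p)
  -- Sum and integral are interchanged: termwise the integral is `2π` times a term of Ξ, while under
  -- the integral the sum is the product of the two L-series.
  have := (hasSum_integral_of_summable_integral_norm hFint hsum).mul_left ((2 * Real.pi : ℂ)⁻¹)
  have htsum : ∀ τ : ℝ, ∑' p, mellinSummand χ₁ χ₂ s₁ s₂ y (c + τ * I) p =
      mellinIntegrand χ₁ χ₂ s₁ s₂ y (c + τ * I) := fun τ =>
    (hasSum_mellinSummand χ₁ χ₂ (by simpa using h1) (by simpa using h2) y).tsum_eq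
  simp_rw [htsum] at this
  refine this.congr_fun ?_ |> fun h => h
  intro p
  simp_rw [mellinSummand_eq χ₁ χ₂ s₁ s₂ hy]
  rw [integral_const_mul, integral_Gamma_mul_cpow_neg hc (hx p), xiSummand, nome_pow]
  push_cast
  field_simp

end XiMellinBarnes

/-! ### Residues of the Mellin–Barnes integrand and the expansion at generic parameters -/

section Residues

/-- Induction on `k` through `Γ(z) = Γ(z + 1) / z`, which carries the pole at `-k` to the one at
`-(k + 1)`. -/
lemma tendsto_add_nat_mul_Gamma (k : ℕ) :
    Tendsto (fun z : ℂ => (z + k) * Complex.Gamma z) (𝓝[≠] (-k : ℂ))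
      (𝓝 ((-1) ^ k / (k.factorial : ℂ))) := by
  induction k with
  | zero => simpa using Complex.tendsto_self_mul_Gamma_nhds_zero
  | succ k ih =>
    have hk : (-((k + 1 : ℕ) : ℂ)) ≠ 0 := by
      rw [neg_ne_zero]
      exact_mod_cast Nat.succ_ne_zero k
    have hshift : Tendsto (fun z : ℂ => z + 1) (𝓝[≠] (-((k + 1 : ℕ) : ℂ))) (𝓝[≠] (-k : ℂ)) := by
      refine tendsto_nhdsWithin_iff.2 ⟨?_, ?_⟩
      · have : Tendsto (fun z : ℂ => z + 1) (𝓝 (-((k + 1 : ℕ) : ℂ))) (𝓝 (-((k + 1 : ℕ) : ℂ) + 1)) :=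
          (by fun_prop : Continuous fun z : ℂ => z + 1).tendsto _
        have e : (-((k + 1 : ℕ) : ℂ) + 1) = -k := by push_cast; ring
        rw [e] at this
        exact this.mono_left nhdsWithin_le_nhds
      · filter_upwards [self_mem_nhdsWithin] with z hz h
        refine hz ?_
        simp only [mem_singleton_iff] at h ⊢
        push_cast
        linear_combination h
    have hinv : Tendsto (fun z : ℂ => z⁻¹) (𝓝[≠] (-((k + 1 : ℕ) : ℂ)))
        (𝓝 (-((k + 1 : ℕ) : ℂ))⁻¹) :=
      (continuousAt_inv₀ hk).tendsto.mono_left nhdsWithin_le_nhds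
    have h := (ih.comp hshift).mul hinv
    have hval : (-1 : ℂ) ^ k / (k.factorial : ℂ) * (-((k + 1 : ℕ) : ℂ))⁻¹ =
        (-1) ^ (k + 1) / ((k + 1).factorial : ℂ) := by
      have h1 : (k.factorial : ℂ) ≠ 0 := by exact_mod_cast k.factorial_ne_zero
      have h2 : ((k + 1 : ℕ) : ℂ) ≠ 0 := neg_ne_zero.1 hk
      rw [Nat.factorial_succ, Nat.cast_mul]
      field_simp
      ring
    rw [hval] at h
    refine h.congr' ?_
    have hne : ∀ᶠ z : ℂ in 𝓝[≠] (-((k + 1 : ℕ) : ℂ)), z ≠ 0 :=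
      eventually_nhdsWithin_of_eventually_nhds (eventually_ne_nhds hk)
    filter_upwards [hne] with z hz
    simp only [Function.comp]
    rw [Complex.Gamma_add_one z hz]
    push_cast
    field_simp
    ring

lemma prod_one_sub_inv_eq_totient_div (N : ℕ) [NeZero N] :
    ∏ p ∈ N.primeFactors, (1 - (p : ℂ)⁻¹) = (N.totient : ℂ) / N := by
  have hN : (N : ℂ) ≠ 0 := by exact_mod_cast NeZero.ne N
  rw [eq_div_iff hN, mul_comm]
  have := Nat.totient_eq_mul_prod_factors N
  have h2 := congrArg (fun q : ℚ => (q : ℂ)) this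
  push_cast at h2
  exact h2.symm

lemma LFunction_residue_of_eq_one {N : ℕ} [NeZero N] {χ : DirichletCharacter ℂ N} (h : χ = 1) :
    Tendsto (fun s => (s - 1) * DirichletCharacter.LFunction χ s) (𝓝[≠] 1)
      (𝓝 ((N.totient : ℂ) / N)) := by
  subst h
  rw [← prod_one_sub_inv_eq_totient_div]
  exact DirichletCharacter.LFunctionTrivChar_residue_one

variable {r₁ r₂ : ℕ} [NeZero r₁] [NeZero r₂]
variable {χ₁ : DirichletCharacter ℂ r₁} {χ₂ : DirichletCharacter ℂ r₂}

lemma mellinIntegrand_swap (s₁ s₂ : ℂ) (y : ℝ) (z : ℂ) :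
    mellinIntegrand χ₁ χ₂ s₁ s₂ y z = mellinIntegrand χ₂ χ₁ s₂ s₁ y z := by
  unfold mellinIntegrand mellinFactor
  ring

lemma two_pi_mul_ne_zero {y : ℝ} (hy : 0 < y) : (2 * Real.pi * y : ℂ) ≠ 0 := by
  exact_mod_cast (by positivity : 2 * Real.pi * y ≠ 0)

lemma differentiableAt_mellinIntegrand {s₁ s₂ z : ℂ} {y : ℝ} (hy : 0 < y) (h0 : ∀ k : ℕ, z ≠ -k)
    (h1 : χ₁ = 1 → z ≠ 1 - s₁) (h2 : χ₂ = 1 → z ≠ 1 - s₂) :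
    DifferentiableAt ℂ (mellinIntegrand χ₁ χ₂ s₁ s₂ y) z := by
  have aux : ∀ {N : ℕ} [NeZero N] {χ : DirichletCharacter ℂ N} {s : ℂ}, (χ = 1 → z ≠ 1 - s) →
      DifferentiableAt ℂ (fun z => DirichletCharacter.LFunction χ (z + s)) z := by
    intro N _ χ s h
    refine DifferentiableAt.comp z (g := DirichletCharacter.LFunction χ) (f := fun z => z + s)
      (DirichletCharacter.differentiableAt_LFunction χ _ ?_) (by fun_prop)
    by_cases hχ : χ = 1
    · exact Or.inl fun e => h hχ (by linear_combination e)
    · exact Or.inr hχ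
  unfold mellinIntegrand mellinFactor
  exact (DifferentiableAt.const_cpow (by fun_prop) (Or.inl (two_pi_mul_ne_zero hy))).mul
    (((Complex.differentiableAt_Gamma z h0).mul (aux h1)).mul (aux h2))

lemma continuousAt_two_pi_cpow {y : ℝ} (hy : 0 < y) (p : ℂ) :
    ContinuousAt (fun z : ℂ => (2 * Real.pi * y : ℂ) ^ (-z)) p :=
  (DifferentiableAt.const_cpow (by fun_prop) (Or.inl (two_pi_mul_ne_zero hy))).continuousAt

lemma continuousAt_LFunction_add {N : ℕ} [NeZero N] {χ : DirichletCharacter ℂ N} {s p : ℂ}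
    (h : χ = 1 → p + s ≠ 1) :
    ContinuousAt (fun z => DirichletCharacter.LFunction χ (z + s)) p :=
  ContinuousAt.comp (g := DirichletCharacter.LFunction χ) (f := fun z => z + s)
    (continuousAt_LFunction h) (by fun_prop)

/-- Under these conditions Γ alone is singular at `-k`, with residue `(-1)^k / k!`. -/
lemma residue_mellinIntegrand_neg_nat {s₁ s₂ : ℂ} {y : ℝ} (hy : 0 < y) (k : ℕ)
    (h1 : χ₁ = 1 → s₁ ≠ k + 1) (h2 : χ₂ = 1 → s₂ ≠ k + 1) :
    Tendsto (fun z => (z - (-k : ℂ)) * mellinIntegrand χ₁ χ₂ s₁ s₂ y z) (𝓝[≠] (-k : ℂ))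
      (𝓝 (pertCoeff χ₁ χ₂ s₁ s₂ k * (y : ℂ) ^ k)) := by
  have c0 := continuousAt_two_pi_cpow hy (-k)
  have c1 : ContinuousAt (fun z => DirichletCharacter.LFunction χ₁ (z + s₁)) (-k) :=
    continuousAt_LFunction_add fun h e => h1 h (by linear_combination e)
  have c2 : ContinuousAt (fun z => DirichletCharacter.LFunction χ₂ (z + s₂)) (-k) :=
    continuousAt_LFunction_add fun h e => h2 h (by linear_combination e)
  have hc := ((c0.mul c1).mul c2).tendsto.mono_left (nhdsWithin_le_nhds (s := {(-k : ℂ)}ᶜ))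
  have h := (tendsto_add_nat_mul_Gamma k).mul hc
  have hval : (-1 : ℂ) ^ k / (k.factorial : ℂ) * ((2 * Real.pi * y : ℂ) ^ (-(-k : ℂ)) *
      DirichletCharacter.LFunction χ₁ (-k + s₁) * DirichletCharacter.LFunction χ₂ (-k + s₂)) =
      pertCoeff χ₁ χ₂ s₁ s₂ k * (y : ℂ) ^ k := by
    rw [neg_neg, Complex.cpow_natCast, pertCoeff, neg_add_eq_sub, neg_add_eq_sub]
    rw [neg_pow (2 * Real.pi : ℂ) k, mul_pow (2 * Real.pi : ℂ) (y : ℂ) k]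
    ring
  rw [← hval]
  refine h.congr fun z => ?_
  simp only [Pi.mul_apply]
  unfold mellinIntegrand mellinFactor
  ring

/-- The pole is that of `L(χ₂, ·)` at 1, with residue `φ(r₂) / r₂`; `h0` keeps Γ regular there and
`h1` keeps `L(χ₁, ·)` regular. -/
lemma residue_mellinIntegrand_one_sub {s₁ s₂ : ℂ} {y : ℝ} (hy : 0 < y) (hχ : χ₂ = 1)
    (h0 : ∀ n : ℕ, s₂ ≠ n + 1) (h1 : χ₁ = 1 → s₁ ≠ s₂) :
    Tendsto (fun z => (z - (1 - s₂)) * mellinIntegrand χ₁ χ₂ s₁ s₂ y z) (𝓝[≠] (1 - s₂))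
      (𝓝 ((y : ℂ) ^ (s₂ - 1) * coeffA χ₁ χ₂ s₁ s₂)) := by
  have c0 := continuousAt_two_pi_cpow hy (1 - s₂)
  have cG : ContinuousAt Complex.Gamma (1 - s₂) := continuousAt_Gamma fun k e => h0 k (by
    linear_combination -e)
  have c1 : ContinuousAt (fun z => DirichletCharacter.LFunction χ₁ (z + s₁)) (1 - s₂) :=
    continuousAt_LFunction_add fun h e => h1 h (by linear_combination e)
  have hc := ((c0.mul cG).mul c1).tendsto.mono_left (nhdsWithin_le_nhds (s := {1 - s₂}ᶜ))
  have hshift : Tendsto (fun z : ℂ => z + s₂) (𝓝[≠] (1 - s₂)) (𝓝[≠] 1) := by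
    refine tendsto_nhdsWithin_iff.2 ⟨?_, ?_⟩
    · have : Tendsto (fun z : ℂ => z + s₂) (𝓝 (1 - s₂)) (𝓝 (1 - s₂ + s₂)) :=
        (by fun_prop : Continuous fun z : ℂ => z + s₂).tendsto _
      rw [sub_add_cancel] at this
      exact this.mono_left nhdsWithin_le_nhds
    · filter_upwards [self_mem_nhdsWithin] with z hz h
      refine hz ?_
      simp only [mem_singleton_iff] at h ⊢
      linear_combination h
  have h := hc.mul ((LFunction_residue_of_eq_one hχ).comp hshift)
  have hval : (2 * Real.pi * y : ℂ) ^ (-(1 - s₂)) * Complex.Gamma (1 - s₂) *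
      DirichletCharacter.LFunction χ₁ (1 - s₂ + s₁) * ((r₂.totient : ℂ) / r₂) =
      (y : ℂ) ^ (s₂ - 1) * coeffA χ₁ χ₂ s₁ s₂ := by
    have hp : (2 * Real.pi * y : ℂ) ^ (s₂ - 1) =
        (2 * Real.pi : ℂ) ^ (s₂ - 1) * (y : ℂ) ^ (s₂ - 1) := by
      have := Complex.mul_cpow_ofReal_nonneg (a := 2 * Real.pi) (b := y) (by positivity) hy.le (s₂ - 1)
      push_cast at this
      exact this
    rw [coeffA, if_pos hχ, neg_sub, hp, show 1 - s₂ + s₁ = s₁ + 1 - s₂ by ring]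
    ring
  rw [← hval]
  refine h.congr fun z => ?_
  simp only [Function.comp, Pi.mul_apply]
  unfold mellinIntegrand mellinFactor
  ring

lemma vanishesVertically_mellinIntegrand (s₁ s₂ : ℂ) {y : ℝ} (hy : 0 < y) (a b : ℝ) :
    VanishesVertically (mellinIntegrand χ₁ χ₂ s₁ s₂ y) a b := by
  obtain ⟨C, T, hC, h⟩ := norm_mellinFactor_le_of_large_im χ₁ χ₂ s₁ s₂ a b
  have hcont : ContinuousOn (fun σ : ℝ => (2 * Real.pi * y) ^ (-σ)) (Icc a b) :=
    (Continuous.rpow continuous_const (by fun_prop)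
      fun _ => Or.inl (by positivity : 2 * Real.pi * y ≠ 0)).continuousOn
  obtain ⟨D, hD⟩ := isCompact_Icc.exists_bound_of_continuousOn hcont
  intro ε hε
  refine ⟨max T (1 + |D| * C / ε), fun z h1 h2 h3 => ?_⟩
  have hz := h (s₁, s₂) (by simp) (by simp) z h1 h2 ((le_max_left _ _).trans h3)
  have hz2 := (le_max_right _ _).trans h3
  have hq : 0 ≤ |D| * C / ε := by positivity
  have hDz := hD z.re ⟨h1, h2⟩
  rw [Real.norm_of_nonneg (by positivity)] at hDz
  rw [mellinIntegrand, norm_mul, norm_two_pi_mul_cpow hy, neg_re]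
  calc _ ≤ |D| * (C * (1 + z.im ^ 2)⁻¹) := by
        gcongr
        exact hDz.trans (le_abs_self D)
    _ = |D| * C / (1 + z.im ^ 2) := by ring
    _ ≤ ε := by
        rw [div_le_iff₀ (by positivity), ← div_le_iff₀' hε, ← sq_abs]
        nlinarith [abs_nonneg z.im]

/-- At generic parameters `Ξ` is a partial sum of its expansion plus an integral over a line to the
left of the poles. -/
theorem Xi_eq_pertPartial_add_lineIntegral {s₁ s₂ : ℂ} (hgen : Generic χ₁ χ₂ s₁ s₂) (M : ℕ)
    (h1 : χ₁ = 1 → s₁.re < M + 3 / 2) (h2 : χ₂ = 1 → s₂.re < M + 3 / 2) {y : ℝ} (hy : 0 < y) :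
    Xi χ₁ χ₂ s₁ s₂ (nome y) = pertPartial χ₁ χ₂ s₁ s₂ (M + 1) y +
      (2 * Real.pi : ℂ)⁻¹ * lineIntegral χ₁ χ₂ (-M - 1 / 2) s₁ s₂ y := by
  classical
  obtain ⟨g1, g2, g3⟩ := hgen
  -- Halfway between the poles `-M` and `-M - 1` of Γ; `h1` and `h2` put `1 - s₁` and `1 - s₂` to
  -- its right.
  set a : ℝ := -M - 1 / 2 with ha
  have hM : (0 : ℝ) ≤ M := M.cast_nonneg
  obtain ⟨c, hc0, hc1, hc2⟩ : ∃ c : ℝ, 0 < c ∧ 1 < c + s₁.re ∧ 1 < c + s₂.re := by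
    refine ⟨2 + |s₁.re| + |s₂.re|, by positivity, ?_, ?_⟩
    · linarith [neg_abs_le s₁.re, abs_nonneg s₂.re]
    · linarith [neg_abs_le s₂.re, abs_nonneg s₁.re]
  have hac : a ≤ c := by linarith
  set S0 : Finset ℂ := (Finset.range (M + 1)).image fun k : ℕ => (-k : ℂ) with hS0
  set S1 : Finset ℂ := if χ₁ = 1 then {1 - s₁} else ∅ with hS1
  set S2 : Finset ℂ := if χ₂ = 1 then {1 - s₂} else ∅ with hS2
  have m0 : ∀ p, p ∈ S0 ↔ ∃ k : ℕ, k < M + 1 ∧ (-k : ℂ) = p := by simp [hS0]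
  have m1 : ∀ p, p ∈ S1 ↔ χ₁ = 1 ∧ p = 1 - s₁ := fun p => by
    simp only [hS1]; split_ifs with h <;> simp [h]
  have m2 : ∀ p, p ∈ S2 ↔ χ₂ = 1 ∧ p = 1 - s₂ := fun p => by
    simp only [hS2]; split_ifs with h <;> simp [h]
  set H := mellinIntegrand χ₁ χ₂ s₁ s₂ y with hH
  -- Residues defined as limits form one function on all three families of poles; `r0`, `r1`, `r2`
  -- evaluate it.
  set ρ : ℂ → ℂ := fun p => limUnder (𝓝[≠] p) fun z => (z - p) * H z with hρ
  have r0 : ∀ k : ℕ, Tendsto (fun z => (z - (-k : ℂ)) * H z) (𝓝[≠] (-k : ℂ))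
      (𝓝 (pertCoeff χ₁ χ₂ s₁ s₂ k * (y : ℂ) ^ k)) := fun k =>
    residue_mellinIntegrand_neg_nat hy k (fun h => g1 h k) (fun h => g2 h k)
  have r1 : χ₁ = 1 → Tendsto (fun z => (z - (1 - s₁)) * H z) (𝓝[≠] (1 - s₁))
      (𝓝 ((y : ℂ) ^ (s₁ - 1) * coeffA χ₂ χ₁ s₂ s₁)) := fun h => by
    have := residue_mellinIntegrand_one_sub (χ₁ := χ₂) (χ₂ := χ₁) (s₁ := s₂) (s₂ := s₁) hy h (g1 h)
      fun h' => (g3 h h').symm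
    refine this.congr fun z => ?_
    rw [mellinIntegrand_swap]
  have r2 : χ₂ = 1 → Tendsto (fun z => (z - (1 - s₂)) * H z) (𝓝[≠] (1 - s₂))
      (𝓝 ((y : ℂ) ^ (s₂ - 1) * coeffA χ₁ χ₂ s₁ s₂)) := fun h =>
    residue_mellinIntegrand_one_sub hy h (g2 h) fun h' => g3 h' h
  have havoid : ∀ σ : ℝ, (σ = a ∨ σ = c) → LineAvoidsPoles χ₁ χ₂ σ s₁ s₂ := by
    rintro σ (rfl | rfl)
    · refine ⟨fun k e => ?_, fun h e => ?_, fun h e => ?_⟩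
      · have : ((2 * k : ℕ) : ℝ) = ((2 * M + 1 : ℕ) : ℝ) := by
          push_cast
          linarith
        have := Nat.cast_injective this
        omega
      · linarith [h1 h]
      · linarith [h2 h]
    · refine ⟨fun k e => ?_, fun h e => ?_, fun h e => ?_⟩
      · have : (0 : ℝ) ≤ k := k.cast_nonneg
        linarith
      · linarith
      · linarith
  have hres := integral_vertical_sub_eq_sum_residues (H := H) hac
    (U := {z : ℂ | -M - 1 < z.re}) (isOpen_lt continuous_const continuous_re)
    (fun z hz => by
      have := hz.1
      simp only [mem_ofPred_eq]
      linarith) (S0 ∪ S1 ∪ S2)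
    (fun p hp => by
      simp only [Finset.mem_union, m0, m1, m2] at hp
      rcases hp with (⟨k, hk, rfl⟩ | ⟨h, rfl⟩) | ⟨h, rfl⟩
      · have : (k : ℝ) ≤ M := by exact_mod_cast Nat.lt_succ_iff.1 hk
        have : (0 : ℝ) ≤ k := k.cast_nonneg
        simp only [neg_re, natCast_re]
        constructor <;> linarith
      · have := h1 h
        simp only [sub_re, one_re]
        constructor <;> linarith
      · have := h2 h
        simp only [sub_re, one_re]
        constructor <;> linarith)
    (fun z hz hzS => by
      simp only [Finset.mem_union, m0, m1, m2, not_or] at hzS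
      refine differentiableAt_mellinIntegrand hy (fun k e => ?_) (fun h e => hzS.1.2 ⟨h, e⟩)
        (fun h e => hzS.2 ⟨h, e⟩)
      refine hzS.1.1 ⟨k, ?_, e.symm⟩
      rw [e] at hz
      simp only [mem_ofPred_eq, neg_re, natCast_re] at hz
      have : (k : ℝ) < (M + 1 : ℕ) := by push_cast; linarith
      exact_mod_cast this)
    ρ (fun p hp => by
      simp only [Finset.mem_union, m0, m1, m2] at hp
      refine tendsto_nhds_limUnder ?_
      rcases hp with (⟨k, hk, rfl⟩ | ⟨h, rfl⟩) | ⟨h, rfl⟩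
      exacts [⟨_, r0 k⟩, ⟨_, r1 h⟩, ⟨_, r2 h⟩])
    ((havoid a (Or.inl rfl)).integrable hy) ((havoid c (Or.inr rfl)).integrable hy)
    (vanishesVertically_mellinIntegrand s₁ s₂ hy a c)
  -- Genericity says precisely that the three families do not meet, so the residues add up without
  -- overlap.
  have d12 : Disjoint S1 S2 := by
    rw [Finset.disjoint_left]
    intro p hp hp'
    rw [m1] at hp
    rw [m2] at hp'
    exact g3 hp.1 hp'.1 (by linear_combination hp.2 - hp'.2)
  have d01 : Disjoint S0 S1 := by
    rw [Finset.disjoint_left]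
    intro p hp hp'
    rw [m0] at hp
    rw [m1] at hp'
    obtain ⟨k, hk, rfl⟩ := hp
    exact g1 hp'.1 k (by linear_combination hp'.2)
  have d02 : Disjoint S0 S2 := by
    rw [Finset.disjoint_left]
    intro p hp hp'
    rw [m0] at hp
    rw [m2] at hp'
    obtain ⟨k, hk, rfl⟩ := hp
    exact g2 hp'.1 k (by linear_combination hp'.2)
  have e0 : ∑ p ∈ S0, ρ p = ∑ k ∈ Finset.range (M + 1), pertCoeff χ₁ χ₂ s₁ s₂ k * (y : ℂ) ^ k := by
    rw [hS0, Finset.sum_image fun i _ j _ h => by simpa using h]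
    exact Finset.sum_congr rfl fun k _ => (r0 k).limUnder_eq
  have e1 : ∑ p ∈ S1, ρ p = (y : ℂ) ^ (s₁ - 1) * coeffA χ₂ χ₁ s₂ s₁ := by
    by_cases h : χ₁ = 1
    · rw [hS1, if_pos h, Finset.sum_singleton]
      exact (r1 h).limUnder_eq
    · rw [hS1, if_neg h, Finset.sum_empty, coeffA, if_neg h, mul_zero]
  have e2 : ∑ p ∈ S2, ρ p = (y : ℂ) ^ (s₂ - 1) * coeffA χ₁ χ₂ s₁ s₂ := by
    by_cases h : χ₂ = 1
    · rw [hS2, if_pos h, Finset.sum_singleton]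
      exact (r2 h).limUnder_eq
    · rw [hS2, if_neg h, Finset.sum_empty, coeffA, if_neg h, mul_zero]
  rw [Finset.sum_union (Finset.disjoint_union_left.2 ⟨d02, d12⟩), Finset.sum_union d01, e0, e1, e2]
    at hres
  rw [Xi, (hasSum_xiSummand χ₁ χ₂ hc0 hc1 hc2 hy).tsum_eq, pertPartial, isolatedTerms]
  have hpi : (Real.pi : ℂ) ≠ 0 := by exact_mod_cast Real.pi_ne_zero
  change lineIntegral χ₁ χ₂ c s₁ s₂ y - lineIntegral χ₁ χ₂ a s₁ s₂ y = _ at hres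
  rw [sub_eq_iff_eq_add.1 hres]
  field_simp
  ring

end Residues

/-! ### Cancellation of the poles of `Γ` and `L` at a positive integer -/

section PoleCancellation

/-- `U` continues `(s - (n + 1)) Γ(1 - s)` across its pole. It starts from `-Γ(2 - s)`, where `ψ(1)
= -γ`, and `U (s - 1) / (1 - s)` raises `n` by one. The quotient rule then reproduces `ψ(n + 2) =
ψ(n + 1) + 1 / (n + 1)`. -/
lemma exists_hasDerivAt_sub_mul_Gamma_one_sub (n : ℕ) : ∃ U : ℂ → ℂ,
    HasDerivAt U ((-1) ^ n / (n.factorial : ℂ) * Complex.digamma (n + 1)) (n + 1) ∧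
      U (n + 1) = -((-1) ^ n / (n.factorial : ℂ)) ∧
      ∀ᶠ s in 𝓝[≠] ((n : ℂ) + 1), U s = (s - (n + 1)) * Complex.Gamma (1 - s) := by
  induction n with
  | zero =>
    refine ⟨fun s => -Complex.Gamma (2 - s), ?_, ?_, ?_⟩
    · have h1 : HasDerivAt Complex.Gamma (-(Real.eulerMascheroniConstant : ℂ)) (2 - (1 : ℂ)) := by
        rw [show (2 : ℂ) - 1 = 1 by norm_num]
        exact Complex.hasDerivAt_Gamma_one
      have h2 : HasDerivAt (fun s : ℂ => -Complex.Gamma (2 - s))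
          (- -(-(Real.eulerMascheroniConstant : ℂ))) 1 := (h1.comp_const_sub 2 1).neg
      simpa [Complex.digamma_one] using h2
    · norm_num
    · filter_upwards [self_mem_nhdsWithin] with s hs
      have hs1 : (1 - s) ≠ 0 := fun h => hs (by
        simp only [mem_singleton_iff]
        push_cast
        linear_combination -h)
      rw [show (2 : ℂ) - s = (1 - s) + 1 by ring, Complex.Gamma_add_one _ hs1]
      push_cast
      ring
  | succ n ih =>
    obtain ⟨U, hU, hU0, hUe⟩ := ih
    have hn : ((n : ℂ) + 1) ≠ 0 := by exact_mod_cast Nat.succ_ne_zero n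
    have hf : (n.factorial : ℂ) ≠ 0 := by exact_mod_cast n.factorial_ne_zero
    have hpt : ((n + 1 : ℕ) : ℂ) + 1 - 1 = n + 1 := by push_cast; ring
    refine ⟨fun s => -U (s - 1) / (s - 1), ?_, ?_, ?_⟩
    · have h1 : HasDerivAt (fun s => U (s - 1)) ((-1) ^ n / (n.factorial : ℂ) *
          Complex.digamma (n + 1)) (((n + 1 : ℕ) : ℂ) + 1) := by
        refine HasDerivAt.comp_sub_const _ 1 ?_
        rw [hpt]
        exact hU
      have h2 := h1.neg.div ((hasDerivAt_id (((n + 1 : ℕ) : ℂ) + 1)).sub_const 1) (by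
        simp only [id]
        rw [hpt]
        exact hn)
      refine h2.congr_deriv ?_
      simp only [id, Pi.neg_apply]
      rw [hpt, hU0, Nat.cast_succ, Complex.digamma_apply_add_one ((n : ℂ) + 1) fun m => ne_of_re_ne (by
        have : (0 : ℝ) ≤ m := m.cast_nonneg
        have : (0 : ℝ) ≤ n := n.cast_nonneg
        simp
        linarith), Nat.factorial_succ]
      push_cast
      field_simp
      ring
    · simp only
      rw [hpt, hU0, Nat.factorial_succ]
      push_cast
      field_simp
      ring
    · have hshift : Tendsto (fun s : ℂ => s - 1) (𝓝[≠] (((n + 1 : ℕ) : ℂ) + 1))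
          (𝓝[≠] ((n : ℂ) + 1)) := by
        refine tendsto_nhdsWithin_iff.2 ⟨?_, ?_⟩
        · have : Tendsto (fun z : ℂ => z - 1) (𝓝 (((n + 1 : ℕ) : ℂ) + 1))
              (𝓝 (((n + 1 : ℕ) : ℂ) + 1 - 1)) :=
            (by fun_prop : Continuous fun z : ℂ => z - 1).tendsto _
          rw [hpt] at this
          exact this.mono_left nhdsWithin_le_nhds
        · filter_upwards [self_mem_nhdsWithin] with z hz h
          refine hz ?_
          simp only [mem_singleton_iff] at h ⊢
          push_cast
          linear_combination h
      have hne : ∀ᶠ s : ℂ in 𝓝[≠] (((n + 1 : ℕ) : ℂ) + 1), s ≠ 1 := by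
        refine eventually_nhdsWithin_of_eventually_nhds (eventually_ne_nhds fun h => ?_)
        rw [Nat.cast_succ] at h
        exact hn (by linear_combination h)
      filter_upwards [hshift.eventually hUe, hne] with s hs hs1
      have h1 : 1 - s ≠ 0 := fun h => hs1 (by linear_combination -h)
      have h2 : s - 1 ≠ 0 := sub_ne_zero.2 hs1
      rw [hs, show 1 - (s - 1) = (1 - s) + 1 by ring, Complex.Gamma_add_one _ h1]
      push_cast
      field_simp
      ring

lemma hasDerivAt_one_sub_cpow_neg {p : ℕ} (hp : p ≠ 0) :
    HasDerivAt (fun s : ℂ => 1 - (p : ℂ) ^ (-s)) ((p : ℂ)⁻¹ * Complex.log p) 1 := by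
  have hp' : (p : ℂ) ≠ 0 := by exact_mod_cast hp
  have h := ((hasDerivAt_id (1 : ℂ)).neg.const_cpow (c := (p : ℂ)) (Or.inl hp')).const_sub 1
  refine h.congr_deriv ?_
  simp [Complex.cpow_neg]

/-- Logarithmic differentiation: at `s = 1` each prime contributes `p⁻¹ log p / (1 - p⁻¹) = log p /
(p - 1)`. -/
lemma hasDerivAt_euler_factors (N : ℕ) [NeZero N] :
    HasDerivAt (fun s : ℂ => ∏ p ∈ N.primeFactors, (1 - (p : ℂ) ^ (-s)))
      ((N.totient : ℂ) / N * (∑ p ∈ N.primeFactors, Real.log p / ((p : ℝ) - 1) : ℝ)) 1 := by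
  have h := HasDerivAt.fun_finsetProd (u := N.primeFactors)
    (f := fun (p : ℕ) (s : ℂ) => 1 - (p : ℂ) ^ (-s)) (x := (1 : ℂ))
    (f' := fun p => (p : ℂ)⁻¹ * Complex.log p) fun p hp =>
      hasDerivAt_one_sub_cpow_neg (Nat.prime_of_mem_primeFactors hp).ne_zero
  refine h.congr_deriv ?_
  rw [← prod_one_sub_inv_eq_totient_div, Complex.ofReal_sum, Finset.mul_sum]
  refine Finset.sum_congr rfl fun p hp => ?_
  have hpp := Nat.prime_of_mem_primeFactors hp
  have hp0 : (p : ℂ) ≠ 0 := by exact_mod_cast hpp.ne_zero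
  have hp1 : (p : ℂ) - 1 ≠ 0 := sub_ne_zero.2 (by exact_mod_cast hpp.one_lt.ne')
  rw [← Finset.mul_prod_erase _ _ hp]
  simp only [Complex.cpow_neg, Complex.cpow_one, smul_eq_mul]
  rw [show Complex.log (p : ℂ) = ((Real.log p : ℝ) : ℂ) by
    rw [Complex.ofReal_log (by positivity)]; simp]
  push_cast
  field_simp

lemma hasDerivAt_update_sub_one_mul_riemannZeta :
    HasDerivAt (Function.update (fun s : ℂ => (s - 1) * riemannZeta s) 1 1)
      (Real.eulerMascheroniConstant : ℂ) 1 := by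
  rw [hasDerivAt_iff_tendsto_slope]
  refine tendsto_riemannZeta_sub_one_div.congr' ?_
  filter_upwards [self_mem_nhdsWithin] with s hs
  have hs1 : s - 1 ≠ 0 := sub_ne_zero.2 hs
  rw [slope_def_field, Function.update_self, Function.update_of_ne hs]
  field_simp

/-- The principal L-function is ζ times the Euler factors of the primes dividing `N`; γ comes from ζ
and the prime sum from these factors. -/
lemma exists_hasDerivAt_sub_one_mul_LFunction {N : ℕ} [NeZero N] {χ : DirichletCharacter ℂ N}
    (hχ : χ = 1) : ∃ W : ℂ → ℂ,
    HasDerivAt W ((N.totient : ℂ) / N * ((∑ p ∈ N.primeFactors, Real.log p / ((p : ℝ) - 1) : ℝ) +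
      (Real.eulerMascheroniConstant : ℂ))) 1 ∧ W 1 = (N.totient : ℂ) / N ∧
      ∀ s, s ≠ 1 → W s = (s - 1) * DirichletCharacter.LFunction χ s := by
  subst hχ
  have hprod : ∏ p ∈ N.primeFactors, (1 - (p : ℂ) ^ (-(1 : ℂ))) = (N.totient : ℂ) / N := by
    rw [← prod_one_sub_inv_eq_totient_div]
    simp only [Complex.cpow_neg, Complex.cpow_one]
  refine ⟨fun s => (∏ p ∈ N.primeFactors, (1 - (p : ℂ) ^ (-s))) *
    Function.update (fun s : ℂ => (s - 1) * riemannZeta s) 1 1 s, ?_, ?_, fun s hs => ?_⟩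
  · refine ((hasDerivAt_euler_factors N).mul hasDerivAt_update_sub_one_mul_riemannZeta).congr_deriv ?_
    rw [Function.update_self, hprod]
    ring
  · simp only
    rw [Function.update_self, hprod, mul_one]
  · simp only
    rw [Function.update_of_ne hs, ← DirichletCharacter.LFunctionTrivChar,
      DirichletCharacter.LFunctionTrivChar_eq_mul_riemannZeta hs]
    ring

variable {r₁ r₂ : ℕ} [NeZero r₁] [NeZero r₂]
variable {χ₁ : DirichletCharacter ℂ r₁} {χ₂ : DirichletCharacter ℂ r₂}

/-- The finite limit of the two singular terms at `s₂ = n + 1`. -/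
theorem tendsto_logTerm (hχ₂ : χ₂ = 1) (n : ℕ) (s₁ : ℂ) (hs₁ : χ₁ = 1 → s₁ ≠ n + 1) {y : ℝ}
    (hy : 0 < y) :
    Tendsto (fun s : ℂ =>
          (2 * Real.pi * y : ℂ) ^ (s - 1) * Complex.Gamma (1 - s) *
              DirichletCharacter.LFunction χ₁ (s₁ + 1 - s) * ((r₂.totient : ℂ) / (r₂ : ℂ)) +
            (-(2 * Real.pi * y : ℂ)) ^ n / (n.factorial : ℂ) *
              DirichletCharacter.LFunction χ₁ (s₁ - n) * DirichletCharacter.LFunction χ₂ (s - n))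
        (𝓝[≠] ((n : ℂ) + 1)) (𝓝 (logTerm χ₁ r₂ s₁ n y)) := by
  obtain ⟨U, hU, hU0, hUe⟩ := exists_hasDerivAt_sub_mul_Gamma_one_sub n
  obtain ⟨W, hW, hW0, hWe⟩ := exists_hasDerivAt_sub_one_mul_LFunction hχ₂
  set X : ℂ := 2 * Real.pi * y with hX
  set a : ℂ := (n : ℂ) + 1 with ha
  have hX0 : X ≠ 0 := two_pi_mul_ne_zero hy
  have hL : HasDerivAt (fun s => DirichletCharacter.LFunction χ₁ (s₁ + 1 - s))
      (-deriv (DirichletCharacter.LFunction χ₁) (s₁ - n)) a := by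
    have hd : HasDerivAt (DirichletCharacter.LFunction χ₁)
        (deriv (DirichletCharacter.LFunction χ₁) (s₁ - n)) (s₁ + 1 - a) := by
      rw [show s₁ + 1 - a = s₁ - n by rw [ha]; ring]
      refine (DirichletCharacter.differentiableAt_LFunction χ₁ _ ?_).hasDerivAt
      by_cases h : χ₁ = 1
      · exact Or.inl fun e => hs₁ h (by linear_combination e)
      · exact Or.inr h
    exact hd.comp_const_sub _ _
  have hP : HasDerivAt (fun s : ℂ => X ^ (s - 1)) (X ^ n * Complex.log X) a := by
    have := ((hasDerivAt_id a).sub_const 1).const_cpow (c := X) (Or.inl hX0)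
    refine this.congr_deriv ?_
    simp only [id, ha, add_sub_cancel_right, Complex.cpow_natCast, mul_one]
  have hW' : HasDerivAt (fun s => W (s - n)) ((r₂.totient : ℂ) / r₂ *
      ((∑ p ∈ r₂.primeFactors, Real.log p / ((p : ℝ) - 1) : ℝ) +
      (Real.eulerMascheroniConstant : ℂ))) a := by
    have : HasDerivAt W ((r₂.totient : ℂ) / r₂ *
      ((∑ p ∈ r₂.primeFactors, Real.log p / ((p : ℝ) - 1) : ℝ) +
      (Real.eulerMascheroniConstant : ℂ))) (a - n) := by
      rw [ha, add_sub_cancel_left]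
      exact hW
    exact this.comp_sub_const _ _
  -- This sum is `s - a` times the expression in question, continued to `a`. Its value at `a` is 0,
  -- because `U a` and `W 1` give opposite contributions, so its slope is that expression and the
  -- limit is its derivative.
  have hF := (((hP.mul hU).mul hL).mul_const ((r₂.totient : ℂ) / r₂)).add
    (hW'.const_mul ((-X) ^ n / (n.factorial : ℂ) * DirichletCharacter.LFunction χ₁ (s₁ - n)))
  rw [hasDerivAt_iff_tendsto_slope] at hF
  have ea1 : a - 1 = n := by rw [ha]; ring
  have ea2 : s₁ + 1 - a = s₁ - n := by rw [ha]; ring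
  have ea3 : a - n = 1 := by rw [ha]; ring
  have hval : logTerm χ₁ r₂ s₁ n y = _ := rfl
  refine Tendsto.congr' ?_ (hF.trans (le_of_eq (congrArg 𝓝 ?_)))
  · filter_upwards [hUe, self_mem_nhdsWithin] with s hs hsa
    have hsa' : s - a ≠ 0 := sub_ne_zero.2 hsa
    have hsn : s - n ≠ 1 := fun h => hsa (by
      simp only [mem_singleton_iff, ha]
      linear_combination h)
    rw [slope_def_field, div_eq_iff hsa']
    simp only [Pi.mul_apply, Pi.add_apply]
    rw [hs, hU0, hWe _ hsn, ea1, ea2, ea3, hW0, Complex.cpow_natCast, neg_pow X n, ha]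
    ring
  · simp only [Pi.mul_apply]
    rw [hU0, ea1, ea2, Complex.cpow_natCast, logTerm, ← hX, neg_pow X n]
    rw [show Complex.log X = ((Real.log (2 * Real.pi * y) : ℝ) : ℂ) by
      rw [Complex.ofReal_log (by positivity), hX]
      push_cast
      rfl]
    ring

end PoleCancellation

/-! ### The asymptotic expansions -/

section Expansions

lemma isBigO_pow_of_norm_le_rpow {f : ℝ → ℂ} {C σ : ℝ} {N : ℕ} (hσ : (N : ℝ) ≤ σ)
    (hf : ∀ y : ℝ, 0 < y → ‖f y‖ ≤ C * y ^ σ) : f =O[𝓝[>] (0 : ℝ)] fun y : ℝ => y ^ N := by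
  refine IsBigO.of_bound |C| ?_
  filter_upwards [Ioo_mem_nhdsGT (zero_lt_one' ℝ)] with y hy
  have h1 : y ^ σ ≤ y ^ (N : ℝ) := Real.rpow_le_rpow_of_exponent_ge hy.1 hy.2.le hσ
  rw [Real.rpow_natCast] at h1
  rw [Real.norm_of_nonneg (pow_nonneg hy.1.le N)]
  calc ‖f y‖ ≤ C * y ^ σ := hf y hy.1
    _ ≤ |C| * y ^ σ := by
        have := Real.rpow_nonneg hy.1.le σ
        gcongr
        exact le_abs_self C
    _ ≤ _ := by gcongr

lemma isBigO_pow_pow {N K : ℕ} (h : N ≤ K) :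
    (fun y : ℝ => y ^ K) =O[𝓝[>] (0 : ℝ)] fun y : ℝ => y ^ N :=
  isBigO_pow_of_norm_le_rpow (f := fun y : ℝ => ((y ^ K : ℝ) : ℂ)) (C := 1) (σ := K)
    (by exact_mod_cast h) (fun y hy => by
      rw [Complex.norm_real, Real.norm_of_nonneg (by positivity), Real.rpow_natCast, one_mul])
    |>.norm_left.congr_left (fun y => Complex.norm_real _) |>.of_norm_left

lemma isBigO_sum_Ico_pow (a : ℕ → ℂ) (N K : ℕ) :
    (fun y : ℝ => ∑ k ∈ Finset.Ico N K, a k * (y : ℂ) ^ k) =O[𝓝[>] (0 : ℝ)] fun y : ℝ => y ^ N := by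
  refine IsBigO.fun_sum fun k hk => ?_
  refine isBigO_pow_of_norm_le_rpow (C := ‖a k‖) (σ := k)
    (by exact_mod_cast (Finset.mem_Ico.1 hk).1) fun y hy => ?_
  rw [norm_mul, norm_pow, Complex.norm_real, Real.norm_of_nonneg hy.le, Real.rpow_natCast]

variable {r₁ r₂ : ℕ} {χ₁ : DirichletCharacter ℂ r₁} {χ₂ : DirichletCharacter ℂ r₂}

lemma lineAvoidsPoles_neg_sub_half {s₁ s₂ : ℂ} {M : ℕ} (h1 : χ₁ = 1 → s₁.re < M + 3 / 2)
    (h2 : χ₂ = 1 → s₂.re < M + 3 / 2) : LineAvoidsPoles χ₁ χ₂ (-M - 1 / 2) s₁ s₂ := by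
  refine ⟨fun k e => ?_, fun h e => ?_, fun h e => ?_⟩
  · have : ((2 * k : ℕ) : ℝ) = ((2 * M + 1 : ℕ) : ℝ) := by
      push_cast
      linarith
    have := Nat.cast_injective this
    omega
  · linarith [h1 h]
  · linarith [h2 h]

variable [NeZero r₁] [NeZero r₂]

lemma isBigO_lineIntegral {s₁ s₂ : ℂ} {M N : ℕ} (hNM : N ≤ M)
    (h1 : χ₁ = 1 → s₁.re < M + 3 / 2) (h2 : χ₂ = 1 → s₂.re < M + 3 / 2) :
    (fun y : ℝ => (2 * Real.pi : ℂ)⁻¹ * lineIntegral χ₁ χ₂ (-M - 1 / 2) s₁ s₂ y)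
      =O[𝓝[>] (0 : ℝ)] fun y : ℝ => y ^ N := by
  obtain ⟨C, hC, h⟩ := (lineAvoidsPoles_neg_sub_half h1 h2).norm_lineIntegral_le
  refine IsBigO.const_mul_left (isBigO_pow_of_norm_le_rpow (C := C) (σ := -(-M - 1 / 2)) ?_ h) _
  have : (N : ℝ) ≤ M := by exact_mod_cast hNM
  linarith

lemma exists_nat_re_lt (N : ℕ) (s₁ s₂ : ℂ) :
    ∃ M : ℕ, N ≤ M ∧ s₁.re < M + 3 / 2 ∧ s₂.re < M + 3 / 2 := by
  obtain ⟨K, hK⟩ := exists_nat_ge (max s₁.re s₂.re)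
  have h1 := (le_max_left _ _).trans hK
  have h2 := (le_max_right _ _).trans hK
  refine ⟨N + K, by omega, ?_, ?_⟩ <;> push_cast <;> have := N.cast_nonneg (α := ℝ) <;> linarith

lemma pertPartial_eq_add_sum_Ico (s₁ s₂ : ℂ) {N K : ℕ} (h : N ≤ K) (y : ℝ) :
    pertPartial χ₁ χ₂ s₁ s₂ K y = pertPartial χ₁ χ₂ s₁ s₂ N y +
      ∑ k ∈ Finset.Ico N K, pertCoeff χ₁ χ₂ s₁ s₂ k * (y : ℂ) ^ k := by
  rw [pertPartial, pertPartial, ← Finset.sum_range_add_sum_Ico _ h]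
  ring

/-- The unified expansion at generic parameters. -/
theorem poincareExpansion_of_generic {s₁ s₂ : ℂ} (hgen : Generic χ₁ χ₂ s₁ s₂) :
    PoincareExpansion (fun y => Xi χ₁ χ₂ s₁ s₂ (nome y)) (isolatedTerms χ₁ χ₂ s₁ s₂)
      (pertCoeff χ₁ χ₂ s₁ s₂) := by
  intro N
  -- `M` may have to exceed `N` for the line to pass the poles `1 - s₁` and `1 - s₂`; the surplus
  -- terms `N ≤ k ≤ M` are `O(y ^ N)`.
  obtain ⟨M, hNM, h1, h2⟩ := exists_nat_re_lt N s₁ s₂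
  refine ((isBigO_sum_Ico_pow (pertCoeff χ₁ χ₂ s₁ s₂) N (M + 1)).add
    (isBigO_lineIntegral (χ₁ := χ₁) (χ₂ := χ₂) hNM (fun _ => h1) (fun _ => h2))).congr' ?_
      EventuallyEq.rfl
  filter_upwards [self_mem_nhdsWithin] with y hy
  rw [Xi_eq_pertPartial_add_lineIntegral hgen M (fun _ => h1) (fun _ => h2) hy,
    pertPartial_eq_add_sum_Ico s₁ s₂ (by omega : N ≤ M + 1), pertPartial]
  ring

lemma continuousAt_pertCoeff {s₁ s₂ : ℂ} {k : ℕ} (h1 : χ₁ = 1 → s₁ ≠ k + 1)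
    (h2 : χ₂ = 1 → s₂ ≠ k + 1) :
    ContinuousAt (fun p : ℂ × ℂ => pertCoeff χ₁ χ₂ p.1 p.2 k) (s₁, s₂) := by
  unfold pertCoeff
  refine continuousAt_const.mul (ContinuousAt.mul ?_ ?_)
  · exact ContinuousAt.comp (g := DirichletCharacter.LFunction χ₁) (f := fun p : ℂ × ℂ => p.1 - k)
      (continuousAt_LFunction fun h e => h1 h (by linear_combination e)) (by fun_prop)
  · exact ContinuousAt.comp (g := DirichletCharacter.LFunction χ₂) (f := fun p : ℂ × ℂ => p.2 - k)
      (continuousAt_LFunction fun h e => h2 h (by linear_combination e)) (by fun_prop)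

/-- A single line `re z = c` represents Ξ for all nearby parameters, so continuity is inherited from
the line integral. -/
lemma continuousAt_Xi (s₁ s₂ : ℂ) {y : ℝ} (hy : 0 < y) :
    ContinuousAt (fun p : ℂ × ℂ => Xi χ₁ χ₂ p.1 p.2 (nome y)) (s₁, s₂) := by
  set c : ℝ := 2 + |s₁.re| + |s₂.re| with hc
  have hc0 : 0 < c := by positivity
  have hc1 : 1 < c + s₁.re := by linarith [neg_abs_le s₁.re, abs_nonneg s₂.re]
  have hc2 : 1 < c + s₂.re := by linarith [neg_abs_le s₂.re, abs_nonneg s₁.re]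
  have havoid : LineAvoidsPoles χ₁ χ₂ c s₁ s₂ := by
    refine ⟨fun k e => ?_, fun _ => hc1.ne', fun _ => hc2.ne'⟩
    have : (0 : ℝ) ≤ k := k.cast_nonneg
    linarith
  refine (continuousAt_const.mul (havoid.continuousAt_lineIntegral hy)
    (f := fun _ => (2 * Real.pi : ℂ)⁻¹)).congr ?_
  have e1 : ∀ᶠ p : ℂ × ℂ in 𝓝 (s₁, s₂), 1 < c + p.1.re :=
    (by fun_prop : ContinuousAt (fun p : ℂ × ℂ => c + p.1.re) (s₁, s₂)).eventually_const_lt hc1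
  have e2 : ∀ᶠ p : ℂ × ℂ in 𝓝 (s₁, s₂), 1 < c + p.2.re :=
    (by fun_prop : ContinuousAt (fun p : ℂ × ℂ => c + p.2.re) (s₁, s₂)).eventually_const_lt hc2
  filter_upwards [e1, e2] with p h1 h2
  exact (hasSum_xiSummand χ₁ χ₂ hc0 h1 h2 hy).tsum_eq.symm

/-- The expansion at arbitrary parameters, as a limit of the generic one. -/
theorem exists_limit_expansion (s₁ s₂ : ℂ) (N : ℕ) (h1 : χ₁ = 1 → ∀ k : ℕ, s₁ = k + 1 → k < N)
    (h2 : χ₂ = 1 → ∀ k : ℕ, s₂ = k + 1 → k < N) :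
    ∃ R : ℝ → ℂ, (∀ y : ℝ, 0 < y →
      Tendsto (fun p : ℂ × ℂ => pertPartial χ₁ χ₂ p.1 p.2 N y)
        (𝓝[{p : ℂ × ℂ | Generic χ₁ χ₂ p.1 p.2}] (s₁, s₂)) (𝓝 (R y))) ∧
      (fun y : ℝ => Xi χ₁ χ₂ s₁ s₂ (nome y) - R y) =O[𝓝[>] (0 : ℝ)] (fun y : ℝ => y ^ N) := by
  obtain ⟨M, hNM, m1, m2⟩ := exists_nat_re_lt N s₁ s₂
  -- `R` is defined from the other side of the identity: Ξ, the shifted integral and the surplus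
  -- terms are continuous at `(s₁, s₂)`, so no cancellation of poles has to be computed.
  refine ⟨fun y => Xi χ₁ χ₂ s₁ s₂ (nome y) -
    (2 * Real.pi : ℂ)⁻¹ * lineIntegral χ₁ χ₂ (-M - 1 / 2) s₁ s₂ y -
    ∑ k ∈ Finset.Ico N (M + 1), pertCoeff χ₁ χ₂ s₁ s₂ k * (y : ℂ) ^ k, fun y hy => ?_, ?_⟩
  · have cX := continuousAt_Xi (χ₁ := χ₁) (χ₂ := χ₂) s₁ s₂ hy
    have cL := (lineAvoidsPoles_neg_sub_half (χ₁ := χ₁) (χ₂ := χ₂) (fun _ => m1)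
      (fun _ => m2)).continuousAt_lineIntegral hy
    have cS : ContinuousAt (fun p : ℂ × ℂ => ∑ k ∈ Finset.Ico N (M + 1),
        pertCoeff χ₁ χ₂ p.1 p.2 k * (y : ℂ) ^ k) (s₁, s₂) := by
      refine tendsto_finsetSum _ fun k hk => ?_
      have hk' := (Finset.mem_Ico.1 hk).1
      exact (continuousAt_pertCoeff (fun h e => by have := h1 h k e; omega)
        (fun h e => by have := h2 h k e; omega)).mul continuousAt_const
    have cT := ((cX.tendsto.sub (cL.tendsto.const_mul (2 * Real.pi : ℂ)⁻¹)).sub cS.tendsto).mono_left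
      (nhdsWithin_le_nhds (s := {p : ℂ × ℂ | Generic χ₁ χ₂ p.1 p.2}))
    refine cT.congr' ?_
    have e1 : ∀ᶠ p : ℂ × ℂ in 𝓝 (s₁, s₂), p.1.re < M + 3 / 2 :=
      (by fun_prop : ContinuousAt (fun p : ℂ × ℂ => p.1.re) (s₁, s₂)).eventually_lt_const m1
    have e2 : ∀ᶠ p : ℂ × ℂ in 𝓝 (s₁, s₂), p.2.re < M + 3 / 2 :=
      (by fun_prop : ContinuousAt (fun p : ℂ × ℂ => p.2.re) (s₁, s₂)).eventually_lt_const m2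
    filter_upwards [self_mem_nhdsWithin, eventually_nhdsWithin_of_eventually_nhds e1,
      eventually_nhdsWithin_of_eventually_nhds e2] with p hp hp1 hp2
    rw [Xi_eq_pertPartial_add_lineIntegral hp M (fun _ => hp1) (fun _ => hp2) hy,
      pertPartial_eq_add_sum_Ico p.1 p.2 (by omega : N ≤ M + 1)]
    ring
  · refine ((isBigO_sum_Ico_pow (pertCoeff χ₁ χ₂ s₁ s₂) N (M + 1)).add
      (isBigO_lineIntegral (χ₁ := χ₁) (χ₂ := χ₂) hNM (fun _ => m1) (fun _ => m2))).congr_left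
        fun y => ?_
    ring

lemma eventually_ne_natCast_add_one (n : ℕ) :
    ∀ᶠ s : ℂ in 𝓝[≠] ((n : ℂ) + 1), ∀ k : ℕ, s ≠ k + 1 := by
  filter_upwards [self_mem_nhdsWithin, eventually_nhdsWithin_of_eventually_nhds
    (Metric.ball_mem_nhds ((n : ℂ) + 1) one_pos)] with s hs hball k hk

  have hball : dist s ((n : ℂ) + 1) < 1 := hball
  rw [hk, Complex.dist_eq, add_sub_add_right_eq_sub] at hball
  have e : (k : ℂ) - n = (((k : ℤ) - n : ℤ) : ℂ) := by push_cast; rfl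
  rw [e, Complex.norm_intCast] at hball
  have : |(k : ℤ) - n| < 1 := by exact_mod_cast hball
  have hkn : (k : ℤ) = n := by
    rw [Int.abs_lt_one_iff] at this
    omega
  have : k = n := by exact_mod_cast hkn
  exact hs (by rw [hk, this]; rfl)

/-- The expansion with a logarithm at `s₂ = n + 1` for a principal second character. -/
theorem poincareExpansion_logTerm (hχ₂ : χ₂ = 1) (n : ℕ) (s₁ : ℂ)
    (hs₁ : χ₁ = 1 → ∀ k : ℕ, s₁ ≠ k + 1) :
    PoincareExpansion (fun y => Xi χ₁ χ₂ s₁ (n + 1) (nome y))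
      (fun y => logTerm χ₁ r₂ s₁ n y + (y : ℂ) ^ (s₁ - 1) * coeffA χ₂ χ₁ (n + 1) s₁)
      (fun k => if k = n then 0 else pertCoeff χ₁ χ₂ s₁ (n + 1) k) := by
  intro N
  set b : ℕ → ℂ := fun k => if k = n then 0 else pertCoeff χ₁ χ₂ s₁ (n + 1) k with hb
  set K : ℕ := max N (n + 1) with hK
  have hNK : N ≤ K := le_max_left _ _
  have hnK : n + 1 ≤ K := le_max_right _ _
  obtain ⟨R, hR, hO⟩ := exists_limit_expansion (χ₁ := χ₁) (χ₂ := χ₂) s₁ (n + 1) K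
    (fun h k e => absurd e (hs₁ h k)) (fun h k e => by
      have : (n : ℂ) = k := by linear_combination e
      have : n = k := by exact_mod_cast this
      omega)
  have hRy : ∀ y : ℝ, 0 < y → R y = logTerm χ₁ r₂ s₁ n y +
      (y : ℂ) ^ (s₁ - 1) * coeffA χ₂ χ₁ (n + 1) s₁ + ∑ k ∈ Finset.range K, b k * (y : ℂ) ^ k := by
    intro y hy
    have hpath : Tendsto (fun s : ℂ => (s₁, s)) (𝓝[≠] ((n : ℂ) + 1))
        (𝓝[{p : ℂ × ℂ | Generic χ₁ χ₂ p.1 p.2}] (s₁, (n : ℂ) + 1)) := by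
      refine tendsto_nhdsWithin_iff.2 ⟨?_, ?_⟩
      · exact ((by fun_prop : Continuous fun s : ℂ => (s₁, s)).tendsto _).mono_left
          nhdsWithin_le_nhds
      · have hne : ∀ᶠ s : ℂ in 𝓝[≠] ((n : ℂ) + 1), χ₁ = 1 → s₁ ≠ s := by
          by_cases h : χ₁ = 1
          · filter_upwards [eventually_nhdsWithin_of_eventually_nhds
              (eventually_ne_nhds (hs₁ h n).symm)] with s hs _ using hs.symm
          · exact Eventually.of_forall fun s h' => absurd h' h
        filter_upwards [eventually_ne_natCast_add_one n, hne] with s h1 h2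
        exact ⟨hs₁, fun _ => h1, fun h _ => h2 h⟩
    refine tendsto_nhds_unique ((hR y hy).comp hpath) ?_
    have t1 := tendsto_logTerm (χ₁ := χ₁) hχ₂ n s₁ (fun h => hs₁ h n) hy
    have t2 : Tendsto (fun s : ℂ => (y : ℂ) ^ (s₁ - 1) * coeffA χ₂ χ₁ s s₁) (𝓝[≠] ((n : ℂ) + 1))
        (𝓝 ((y : ℂ) ^ (s₁ - 1) * coeffA χ₂ χ₁ (n + 1) s₁)) := by
      refine Tendsto.const_mul _ ?_
      unfold coeffA
      split_ifs with h
      · refine Tendsto.mul_const _ (Tendsto.const_mul _ ?_)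
        have : ContinuousAt (fun s : ℂ => DirichletCharacter.LFunction χ₂ (s + 1 - s₁))
            ((n : ℂ) + 1) :=
          ContinuousAt.comp (g := DirichletCharacter.LFunction χ₂) (f := fun s : ℂ => s + 1 - s₁)
            (continuousAt_LFunction fun _ e => hs₁ h n (by linear_combination -e)) (by fun_prop)
        exact this.tendsto.mono_left nhdsWithin_le_nhds
      · exact tendsto_const_nhds
    have t3 : Tendsto (fun s : ℂ => ∑ k ∈ (Finset.range K).erase n,
        pertCoeff χ₁ χ₂ s₁ s k * (y : ℂ) ^ k) (𝓝[≠] ((n : ℂ) + 1))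
        (𝓝 (∑ k ∈ (Finset.range K).erase n, pertCoeff χ₁ χ₂ s₁ (n + 1) k * (y : ℂ) ^ k)) := by
      refine tendsto_finsetSum _ fun k hk => Tendsto.mul_const _ ?_
      have hkn := (Finset.mem_erase.1 hk).1
      have hc := continuousAt_pertCoeff (χ₁ := χ₁) (χ₂ := χ₂) (s₁ := s₁) (s₂ := (n : ℂ) + 1) (k := k)
        (fun h => hs₁ h k) (fun _ e => hkn (by
          have : (n : ℂ) = k := by linear_combination e
          exact_mod_cast this.symm))
      exact (hc.comp (f := fun s : ℂ => (s₁, s)) (by fun_prop)).tendsto.mono_left nhdsWithin_le_nhds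
    have hbsum : ∑ k ∈ Finset.range K, b k * (y : ℂ) ^ k =
        ∑ k ∈ (Finset.range K).erase n, pertCoeff χ₁ χ₂ s₁ (n + 1) k * (y : ℂ) ^ k := by
      rw [← Finset.add_sum_erase _ _ (Finset.mem_range.2 hnK)]
      simp only [hb, if_true, zero_mul, zero_add]
      refine Finset.sum_congr rfl fun k hk => ?_
      rw [if_neg (Finset.mem_erase.1 hk).1]
    rw [hbsum]
    refine ((t1.add t2).add t3).congr fun s => ?_
    simp only [Function.comp, pertPartial, isolatedTerms]
    rw [← Finset.add_sum_erase (Finset.range K) _ (Finset.mem_range.2 hnK)]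
    have hp : (2 * Real.pi * y : ℂ) ^ (s - 1) =
        (2 * Real.pi : ℂ) ^ (s - 1) * (y : ℂ) ^ (s - 1) := by
      have := Complex.mul_cpow_ofReal_nonneg (a := 2 * Real.pi) (b := y) (by positivity) hy.le (s - 1)
      push_cast at this
      exact this
    have hcA : coeffA χ₁ χ₂ s₁ s = (2 * Real.pi : ℂ) ^ (s - 1) * Complex.Gamma (1 - s) *
        DirichletCharacter.LFunction χ₁ (s₁ + 1 - s) * ((r₂.totient : ℂ) / (r₂ : ℂ)) := if_pos hχ₂
    rw [hp, hcA, pertCoeff, ← neg_mul, mul_pow]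
    ring
  refine ((hO.trans (isBigO_pow_pow hNK)).add (isBigO_sum_Ico_pow b N K)).congr' ?_
    EventuallyEq.rfl
  filter_upwards [self_mem_nhdsWithin] with y hy
  rw [hRy y hy, ← Finset.sum_range_add_sum_Ico _ hNK]
  ring

end Expansions

end TwistedLambert

namespace TwistedLambert

open Complex DirichletCharacter

/-! ### Trivial zeros and termination -/

section TrivialZeros

lemma even_of_apply_neg_one {r : ℕ} {χ : DirichletCharacter ℂ r} {κ : ℕ}
    (hχ : χ (-1) = (-1) ^ κ) (h : κ = 0) : χ.Even := by
  rw [h, pow_zero] at hχ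
  exact hχ

lemma odd_of_apply_neg_one {r : ℕ} {χ : DirichletCharacter ℂ r} {κ : ℕ}
    (hχ : χ (-1) = (-1) ^ κ) (h : κ = 1) : χ.Odd := by
  rw [h, pow_one] at hχ
  exact hχ

/-- The trivial zeros of a Dirichlet `L`-function. -/
theorem LFunction_trivial_zero {r : ℕ} [NeZero r] {χ : DirichletCharacter ℂ r} {κ : ℕ}
    (hκ : κ ≤ 1) (hχ : χ (-1) = (-1) ^ κ) {j : ℕ} (hj : χ ≠ 1 ∨ 1 ≤ j) :
    LFunction χ (-(κ : ℂ) - 2 * (j : ℂ)) = 0 := by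
  rcases Nat.le_one_iff_eq_zero_or_eq_one.1 hκ with h | h
  · have hev := even_of_apply_neg_one hχ h
    rcases Nat.eq_zero_or_pos j with h0 | h0
    · have hne : χ ≠ 1 := hj.resolve_right (by omega)
      have hr : r ≠ 1 := fun hr => hne (level_one' _ hr)
      have := ZMod.LFunction_apply_zero_of_even hev.to_fun
      rw [χ.map_zero' hr, neg_zero, zero_div] at this
      have hL : LFunction χ 0 = 0 := this
      simpa [h, h0] using hL
    · have : NeZero j := ⟨h0.ne'⟩
      simpa [h] using hev.LFunction_neg_two_mul_nat j
  · have := (odd_of_apply_neg_one hχ h).LFunction_neg_two_mul_nat_sub_one j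
    rw [← this, h]
    congr 1
    push_cast
    ring

lemma completedLFunction_ne_zero {r : ℕ} [NeZero r] (χ : DirichletCharacter ℂ r) {s : ℂ}
    (hs : 1 < s.re) : completedLFunction χ s ≠ 0 := by
  have hs1 : s ≠ 1 := by rintro rfl; simp at hs
  have hs0 : s ≠ 0 := by rintro rfl; simp at hs; linarith
  intro h
  have := LFunction_eq_completed_div_gammaFactor χ s (.inl hs0)
  rw [h, zero_div] at this
  exact LFunction_ne_zero_of_one_le_re χ (.inr hs1) hs.le this

lemma rootNumber_ne_zero {r : ℕ} [NeZero r] {χ : DirichletCharacter ℂ r} (hχ : χ.IsPrimitive) :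
    rootNumber χ ≠ 0 := by
  intro h
  have := hχ.completedLFunction_one_sub (-1)
  rw [h, mul_zero, zero_mul] at this
  exact completedLFunction_ne_zero χ (by norm_num) this

lemma gammaFactor_ne_zero {r : ℕ} {χ : DirichletCharacter ℂ r} {κ : ℕ}
    (hκ : κ ≤ 1) (hχ : χ (-1) = (-1) ^ κ) {s : ℂ}
    (hs : ∀ j : ℕ, s ≠ -(κ : ℂ) - 2 * (j : ℂ)) : gammaFactor χ s ≠ 0 := by
  rcases Nat.le_one_iff_eq_zero_or_eq_one.1 hκ with h | h
  · rw [(even_of_apply_neg_one hχ h).gammaFactor_def, Ne, Gammaℝ_eq_zero_iff]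
    rintro ⟨j, hj⟩
    exact hs j (by rw [hj, h]; push_cast; ring)
  · rw [(odd_of_apply_neg_one hχ h).gammaFactor_def, Ne, Gammaℝ_eq_zero_iff]
    rintro ⟨j, hj⟩
    exact hs j (by rw [eq_sub_of_add_eq hj, h]; push_cast; ring)

lemma LFunction_ne_zero_of_isPrimitive_of_re_neg {r : ℕ} [NeZero r] {χ : DirichletCharacter ℂ r}
    (hp : χ.IsPrimitive) {κ : ℕ} (hκ : κ ≤ 1) (hχ : χ (-1) = (-1) ^ κ) {s : ℂ} (hs0 : s.re < 0)
    (hs : ∀ j : ℕ, s ≠ -(κ : ℂ) - 2 * (j : ℂ)) : LFunction χ s ≠ 0 := by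
  have hne : s ≠ 0 := by rintro rfl; simp at hs0
  rw [LFunction_eq_completed_div_gammaFactor χ s (.inl hne)]
  refine div_ne_zero ?_ (gammaFactor_ne_zero hκ hχ hs)
  have := hp.completedLFunction_one_sub (1 - s)
  rw [sub_sub_cancel] at this
  rw [this]
  refine mul_ne_zero (mul_ne_zero ?_ (rootNumber_ne_zero hp))
    (completedLFunction_ne_zero _ (by rw [sub_re, one_re]; linarith))
  rw [Ne, cpow_eq_zero_iff]
  exact fun h => NeZero.ne r (by exact_mod_cast h.1)

lemma one_sub_mul_cpow_ne_zero {r : ℕ} (χ : DirichletCharacter ℂ r) {p : ℕ} (hp : p.Prime)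
    {s : ℂ} (hs : s.re < 0) : 1 - χ p * (p : ℂ) ^ (-s) ≠ 0 := by
  intro h
  have h1 : ‖χ p‖ * (p : ℝ) ^ (-s.re) = 1 := by
    have := congrArg norm (sub_eq_zero.1 h).symm
    rwa [norm_mul, norm_natCast_cpow_of_pos hp.pos, neg_re, norm_one] at this
  by_cases hu : IsUnit (p : ZMod r)
  · have h2 : ‖χ p‖ = 1 := by simpa using χ.unit_norm_eq_one hu.unit
    rw [h2, one_mul] at h1
    have := Real.one_lt_rpow (x := (p : ℝ)) (by exact_mod_cast hp.one_lt) (neg_pos.2 hs)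
    linarith
  · rw [χ.map_nonunit hu, norm_zero, zero_mul] at h1
    exact zero_ne_one h1

/-- In the open left half plane an `L`-function has only its trivial zeros. -/
theorem LFunction_ne_zero_of_re_neg {r : ℕ} [NeZero r] {χ : DirichletCharacter ℂ r}
    {κ : ℕ} (hκ : κ ≤ 1) (hχ : χ (-1) = (-1) ^ κ) {s : ℂ} (hs0 : s.re < 0)
    (hs : ∀ j : ℕ, s ≠ -(κ : ℂ) - 2 * (j : ℂ)) : LFunction χ s ≠ 0 := by
  have : NeZero χ.conductor := ⟨χ.conductor_ne_zero⟩
  have hs1 : s ≠ 1 := by rintro rfl; simp at hs0; linarith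
  have key := LFunction_changeLevel χ.conductor_dvd_level χ.primitiveCharacter (.inr hs1)
  rw [changeLevel_primitiveCharacter] at key
  rw [key]
  refine mul_ne_zero (LFunction_ne_zero_of_isPrimitive_of_re_neg χ.primitiveCharacter_isPrimitive hκ
    ?_ hs0 hs) (Finset.prod_ne_zero_iff.2 fun p hp =>
      one_sub_mul_cpow_ne_zero _ (Nat.prime_of_mem_primeFactors hp) hs0)
  have := χ.primitiveCharacter_apply_of_isCoprime (a := -1) isCoprime_one_left.neg_left
  push_cast at this
  rw [this, hχ]

end TrivialZeros

section Termination

variable {r₁ r₂ : ℕ} [NeZero r₁] [NeZero r₂] {χ₁ : DirichletCharacter ℂ r₁}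
  {χ₂ : DirichletCharacter ℂ r₂}

lemma pertCoeff_eq_zero_iff (s₁ s₂ : ℂ) (k : ℕ) :
    pertCoeff χ₁ χ₂ s₁ s₂ k = 0 ↔ LFunction χ₁ (s₁ - k) = 0 ∨ LFunction χ₂ (s₂ - k) = 0 := by
  have h : (-(2 * Real.pi : ℂ)) ^ k / (k.factorial : ℂ) ≠ 0 :=
    div_ne_zero (pow_ne_zero _ (neg_ne_zero.2 (by simp [Real.pi_ne_zero])))
      (by exact_mod_cast k.factorial_ne_zero)
  rw [pertCoeff, mul_eq_zero, or_iff_right h, mul_eq_zero]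

lemma exists_eq_of_LFunction_sub_eq_zero {r : ℕ} [NeZero r] {χ : DirichletCharacter ℂ r}
    {κ : ℕ} (hκ : κ ≤ 1) (hχ : χ (-1) = (-1) ^ κ) {s : ℂ} {k : ℕ} (hk : s.re < k)
    (h : LFunction χ (s - k) = 0) : ∃ j : ℤ, s = ((k - κ - 2 * j : ℤ) : ℂ) := by
  by_contra! hc
  refine LFunction_ne_zero_of_re_neg hκ hχ (s := s - k) (by simpa using hk) (fun j hj => ?_) h
  refine hc j ?_
  rw [sub_eq_iff_eq_add.1 hj]
  push_cast
  ring

/-- The power series of the expansion terminates exactly for integral parameters of the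
appropriate parity. -/
theorem pertCoeff_eventually_zero_iff {κ₁ κ₂ : ℕ} (hκ₁ : κ₁ ≤ 1) (hκ₂ : κ₂ ≤ 1)
    (hχ₁ : χ₁ (-1) = (-1) ^ κ₁) (hχ₂ : χ₂ (-1) = (-1) ^ κ₂) (s₁ s₂ : ℂ) :
    (∃ K : ℕ, ∀ k : ℕ, K ≤ k → pertCoeff χ₁ χ₂ s₁ s₂ k = 0) ↔
      ∃ m₁ m₂ : ℤ, s₁ = m₁ ∧ s₂ = m₂ ∧ m₁ + m₂ ≡ (κ₁ : ℤ) + (κ₂ : ℤ) + 1 [ZMOD 2] := by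
  constructor
  · rintro ⟨K, hK⟩
    obtain ⟨k₁, hk₁⟩ := exists_nat_gt s₁.re
    obtain ⟨k₂, hk₂⟩ := exists_nat_gt s₂.re
    have zero : ∀ k, K + k₁ + k₂ ≤ k →
        (∃ j : ℤ, s₁ = ((k - κ₁ - 2 * j : ℤ) : ℂ)) ∨ ∃ j : ℤ, s₂ = ((k - κ₂ - 2 * j : ℤ) : ℂ) := by
      intro k hk
      have h1 : (k₁ : ℝ) ≤ k := by exact_mod_cast (by omega : k₁ ≤ k)
      have h2 : (k₂ : ℝ) ≤ k := by exact_mod_cast (by omega : k₂ ≤ k)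
      exact ((pertCoeff_eq_zero_iff s₁ s₂ k).1 (hK k (by omega))).imp
        (exists_eq_of_LFunction_sub_eq_zero hκ₁ hχ₁ (hk₁.trans_le h1))
        (exists_eq_of_LFunction_sub_eq_zero hκ₂ hχ₂ (hk₂.trans_le h2))
    have h0 := zero _ le_rfl
    have h1 := zero (K + k₁ + k₂ + 1) (by omega)
    generalize K + k₁ + k₂ = k at h0 h1
    simp only [Nat.cast_add, Nat.cast_one] at h1
    have parity : ∀ {κ i j : ℤ} {s : ℂ}, s = ((k - κ - 2 * i : ℤ) : ℂ) →
        s ≠ (((k : ℤ) + 1 - κ - 2 * j : ℤ) : ℂ) := by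
      intro κ i j s h h'
      have := Int.cast_injective (h.symm.trans h')
      omega
    rcases h0 with ⟨i, hi⟩ | ⟨i, hi⟩ <;> rcases h1 with ⟨j, hj⟩ | ⟨j, hj⟩
    · exact absurd hj (parity hi)
    · exact ⟨_, _, hi, hj, by rw [Int.modEq_iff_dvd]; omega⟩
    · exact ⟨_, _, hj, hi, by rw [Int.modEq_iff_dvd]; omega⟩
    · exact absurd hj (parity hi)
  · rintro ⟨m₁, m₂, rfl, rfl, hm⟩
    have zero : ∀ {r : ℕ} [NeZero r] {χ : DirichletCharacter ℂ r} {κ : ℕ}, κ ≤ 1 →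
        χ (-1) = (-1) ^ κ → ∀ {m : ℤ} {k : ℕ}, m + κ + 2 ≤ k → 2 ∣ (k : ℤ) - κ - m →
          LFunction χ ((m : ℂ) - k) = 0 := by
      intro r _ χ κ hκ hχ m k hk hd
      obtain ⟨j, hj⟩ := hd
      lift j to ℕ using by omega
      rw [← LFunction_trivial_zero hκ hχ (j := j) (.inr (by omega))]
      congr 1
      have : (((k : ℤ) - κ - m : ℤ) : ℂ) = ((2 * j : ℤ) : ℂ) := congrArg _ hj
      push_cast at this
      linear_combination -this
    rw [Int.modEq_iff_dvd] at hm
    refine ⟨(m₁ + κ₁ + 2).toNat + (m₂ + κ₂ + 2).toNat, fun k hk => ?_⟩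
    rw [pertCoeff_eq_zero_iff]
    by_cases hd : 2 ∣ (k : ℤ) - κ₁ - m₁
    · exact .inl (zero hκ₁ hχ₁ (by omega) hd)
    · exact .inr (zero hκ₂ hχ₂ (by omega) (by omega))

end Termination

/-! ### Lambert series -/

lemma summable_xiSummand {r₁ r₂ : ℕ} [NeZero r₁] [NeZero r₂] (χ₁ : DirichletCharacter ℂ r₁)
    (χ₂ : DirichletCharacter ℂ r₂) (s₁ s₂ : ℂ) {y : ℝ} (hy : 0 < y) :
    Summable (xiSummand χ₁ χ₂ s₁ s₂ (nome y)) := by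
  have h1 := neg_abs_le s₁.re
  have h2 := neg_abs_le s₂.re
  have h3 := abs_nonneg s₁.re
  have h4 := abs_nonneg s₂.re
  exact (hasSum_xiSummand χ₁ χ₂ (c := 2 + |s₁.re| + |s₂.re|) (by linarith) (by linarith)
    (by linarith) hy).summable

lemma norm_nome_lt_one {y : ℝ} (hy : 0 < y) : ‖nome y‖ < 1 := by
  have h : (-(2 * Real.pi * y) : ℂ) = ((-(2 * Real.pi * y) : ℝ) : ℂ) := by push_cast; rfl
  rw [nome, h, Complex.norm_exp_ofReal, Real.exp_lt_one_iff]
  have := Real.pi_pos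
  nlinarith [mul_pos this hy]

lemma tsum_pnat_pow {z : ℂ} (hz : ‖z‖ < 1) : ∑' m : ℕ+, z ^ (m : ℕ) = z / (1 - z) := by
  rw [tsum_pnat_eq_tsum_succ (f := fun m => z ^ m)]
  simp_rw [pow_succ]
  rw [tsum_mul_right, tsum_geometric_of_norm_lt_one hz]
  ring

section Lambert

variable {r : ℕ} [NeZero r] {χ : DirichletCharacter ℂ r}

/-- The twisted Lambert series as a double series. -/
theorem lambert_eq_Xi (s : ℂ) {y : ℝ} (hy : 0 < y) :
    lambert χ s (nome y) = Xi χ (1 : DirichletCharacter ℂ 1) s 0 (nome y) := by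
  rw [Xi, (summable_xiSummand χ _ s 0 hy).tsum_prod, lambert]
  refine tsum_congr fun n => ?_
  have hz : ‖nome y ^ (n : ℕ)‖ < 1 := by
    rw [norm_pow]
    exact pow_lt_one₀ (norm_nonneg _) (norm_nome_lt_one hy) n.ne_zero
  rw [← tsum_pnat_pow hz, ← tsum_mul_left]
  refine tsum_congr fun m => ?_
  have h1 : (1 : DirichletCharacter ℂ 1) ((m : ℕ) : ZMod 1) = 1 :=
    MulChar.one_apply (isUnit_of_subsingleton _)
  rw [xiSummand, h1, cpow_zero, div_one, mul_one, pow_mul]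

/-- The Lambert series of polylogarithms as a double series. -/
theorem lambertTilde_eq_Xi (s : ℂ) {y : ℝ} (hy : 0 < y) :
    lambertTilde χ s (nome y) = Xi χ (1 : DirichletCharacter ℂ 1) 0 s (nome y) := by
  rw [Xi, (summable_xiSummand χ _ 0 s hy).tsum_prod, lambertTilde]
  refine tsum_congr fun n => ?_
  rw [polylog, ← tsum_mul_left]
  refine tsum_congr fun m => ?_
  have h1 : (1 : DirichletCharacter ℂ 1) ((m : ℕ) : ZMod 1) = 1 :=
    MulChar.one_apply (isUnit_of_subsingleton _)
  rw [xiSummand, h1, cpow_zero, div_one, pow_mul]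
  ring

lemma tendsto_riemannZeta_neg_div_Gamma :
    Tendsto (fun z : ℂ => riemannZeta (-z) / Complex.Gamma (z + 1)) (𝓝[≠] (-1)) (𝓝 (-1)) := by
  have hneg : Tendsto (fun z : ℂ => -z) (𝓝[≠] (-1)) (𝓝[≠] 1) := by
    refine tendsto_nhdsWithin_iff.2 ⟨?_, ?_⟩
    · have : Tendsto (fun z : ℂ => -z) (𝓝 (-1)) (𝓝 1) := by
        simpa using (continuous_neg (G := ℂ)).tendsto (-1)
      exact this.mono_left nhdsWithin_le_nhds
    · filter_upwards [self_mem_nhdsWithin] with z hz h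
      exact hz (by simpa using congrArg Neg.neg h)
  have h1 := riemannZeta_residue_one.comp hneg
  have hG : Tendsto (fun z : ℂ => Complex.Gamma (z + 2)) (𝓝[≠] (-1)) (𝓝 1) := by
    have hc : ContinuousAt (fun z : ℂ => Complex.Gamma (z + 2)) (-1) := by
      refine ContinuousAt.comp (g := Complex.Gamma) ?_ (by fun_prop)
      refine (Complex.differentiableAt_Gamma _ fun m h => ?_).continuousAt
      have := congrArg Complex.re h
      have hm : (0 : ℝ) ≤ m := m.cast_nonneg
      norm_num at this
      linarith
    have : Complex.Gamma (-1 + 2) = 1 := by rw [show (-1 + 2 : ℂ) = 1 by ring, Complex.Gamma_one]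
    have ht := hc.tendsto
    rw [this] at ht
    exact ht.mono_left nhdsWithin_le_nhds
  have h2 := (h1.div hG one_ne_zero).neg
  rw [div_one] at h2
  refine h2.congr' ?_
  filter_upwards [self_mem_nhdsWithin] with z hz
  have hz1 : z + 1 ≠ 0 := fun h => hz (eq_neg_of_add_eq_zero_left h)
  have hrec : Complex.Gamma (z + 2) = (z + 1) * Complex.Gamma (z + 1) := by
    rw [← Complex.Gamma_add_one _ hz1]
    congr 1
    ring
  change -((-z - 1) * riemannZeta (-z) / Complex.Gamma (z + 2)) = _
  rw [hrec, show (-z - 1) * riemannZeta (-z) = -((z + 1) * riemannZeta (-z)) by ring, neg_div,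
    neg_neg, mul_div_mul_left _ _ hz1]

/-- The isolated term of the twisted Lambert series as the term of index `-1`. -/
theorem tendsto_lambert_isolatedTerm (hχ : χ ≠ 1) (s : ℂ) {y : ℝ} (hy : 0 < y) :
    Tendsto (fun z : ℂ => (-(2 * Real.pi * y : ℂ)) ^ z / Complex.Gamma (z + 1) *
        (riemannZeta (-z) * LFunction χ (s - z)))
      (𝓝[≠] (-1)) (𝓝 (LFunction χ (s + 1) / (2 * Real.pi * y))) := by
  have hw : (-(2 * Real.pi * y : ℂ)) ≠ 0 := by
    simp [Real.pi_ne_zero, hy.ne']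
  have hpow : Tendsto (fun z : ℂ => (-(2 * Real.pi * y : ℂ)) ^ z) (𝓝[≠] (-1))
      (𝓝 ((-(2 * Real.pi * y : ℂ)) ^ (-1 : ℂ))) :=
    (continuousAt_const_cpow hw).tendsto.mono_left nhdsWithin_le_nhds
  have hL : Tendsto (fun z : ℂ => LFunction χ (s - z)) (𝓝[≠] (-1)) (𝓝 (LFunction χ (s - -1))) := by
    have := (differentiable_LFunction hχ).continuous.comp (continuous_sub_left s)
    exact (this.tendsto (-1)).mono_left nhdsWithin_le_nhds
  have h := (hpow.mul tendsto_riemannZeta_neg_div_Gamma).mul hL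
  rw [cpow_neg_one, sub_neg_eq_add, inv_neg, neg_mul_neg, mul_one, inv_mul_eq_div] at h
  refine h.congr fun z => ?_
  ring

lemma cpow_mul_two_pi {y : ℝ} (hy : 0 < y) (z : ℂ) :
    (y : ℂ) ^ z * (2 * Real.pi : ℂ) ^ z = (2 * Real.pi * y : ℂ) ^ z := by
  have h := mul_cpow_ofReal_nonneg (a := 2 * Real.pi) (b := y) (by positivity) hy.le z
  push_cast at h
  rw [h, mul_comm]

lemma PoincareExpansion.congr {f g E F : ℝ → ℂ} {a b : ℕ → ℂ} (h : PoincareExpansion f E a)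
    (hf : ∀ y, 0 < y → f y = g y) (hE : ∀ y, 0 < y → E y = F y) (ha : ∀ k, a k = b k) :
    PoincareExpansion g F b := by
  intro N
  refine (h N).congr' ?_ EventuallyEq.rfl
  filter_upwards [self_mem_nhdsWithin] with y hy
  rw [hf y hy, hE y hy]
  simp only [ha]

lemma isolatedTerms_modOne (hχ : χ ≠ 1) (s₁ s₂ : ℂ) {y : ℝ} (hy : 0 < y) :
    isolatedTerms χ (1 : DirichletCharacter ℂ 1) s₁ s₂ y =
      (2 * Real.pi * y : ℂ) ^ (s₂ - 1) * Complex.Gamma (1 - s₂) * LFunction χ (s₁ + 1 - s₂) := by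
  rw [isolatedTerms, coeffA, coeffA, if_pos rfl, if_neg hχ, ← cpow_mul_two_pi hy]
  simp
  ring

theorem poincareExpansion_lambert (hχ : χ ≠ 1) (s : ℂ) :
    PoincareExpansion (fun y => lambert χ s (nome y))
      (fun y => LFunction χ (s + 1) / (2 * Real.pi * y))
      (fun k => (-(2 * Real.pi : ℂ)) ^ k / (k.factorial : ℂ) *
        (riemannZeta (-k) * LFunction χ (s - k))) := by
  have hgen : Generic χ (1 : DirichletCharacter ℂ 1) s 0 :=
    ⟨fun h => absurd h hχ, fun _ n => (Nat.cast_add_one_ne_zero n).symm, fun h => absurd h hχ⟩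
  refine (poincareExpansion_of_generic hgen).congr (fun y hy => (lambert_eq_Xi s hy).symm)
    (fun y hy => ?_) fun k => ?_
  · rw [isolatedTerms_modOne hχ _ _ hy, zero_sub, cpow_neg_one, sub_zero, sub_zero,
      Complex.Gamma_one, mul_one, div_eq_mul_inv, mul_comm]
  · rw [pertCoeff, LFunction_modOne_eq, zero_sub]
    ring

theorem poincareExpansion_lambertTilde (hχ : χ ≠ 1) {s : ℂ} (hs : ∀ n : ℕ, s ≠ n + 1) :
    PoincareExpansion (fun y => lambertTilde χ s (nome y))
      (fun y => (2 * Real.pi * y : ℂ) ^ (s - 1) * Complex.Gamma (1 - s) * LFunction χ (1 - s))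
      (fun k => (-(2 * Real.pi : ℂ)) ^ k / (k.factorial : ℂ) *
        (riemannZeta (s - k) * LFunction χ (-k))) := by
  have hgen : Generic χ (1 : DirichletCharacter ℂ 1) 0 s :=
    ⟨fun h => absurd h hχ, fun _ => hs, fun h => absurd h hχ⟩
  refine (poincareExpansion_of_generic hgen).congr (fun y hy => (lambertTilde_eq_Xi s hy).symm)
    (fun y hy => ?_) fun k => ?_
  · rw [isolatedTerms_modOne hχ _ _ hy, zero_add]
  · rw [pertCoeff, LFunction_modOne_eq, zero_sub]
    ring

theorem poincareExpansion_lambertTilde_natCast_add_one (hχ : χ ≠ 1) (n : ℕ) :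
    PoincareExpansion (fun y => lambertTilde χ (n + 1) (nome y)) (logTerm χ 1 0 n)
      (fun k => if k = n then 0 else (-(2 * Real.pi : ℂ)) ^ k / (k.factorial : ℂ) *
        (riemannZeta (n + 1 - k) * LFunction χ (-k))) := by
  refine (poincareExpansion_logTerm (χ₂ := (1 : DirichletCharacter ℂ 1)) rfl n 0
    fun h => absurd h hχ).congr (fun y hy => (lambertTilde_eq_Xi _ hy).symm)
    (fun y hy => ?_) fun k => ?_
  · rw [coeffA, if_neg hχ, mul_zero, add_zero]
  · split_ifs
    · rfl
    · rw [pertCoeff, LFunction_modOne_eq, zero_sub]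
      ring

end Lambert

end TwistedLambert
theorem mainTheorem2 {r₁ r₂ : ℕ} [NeZero r₁] [NeZero r₂]
    (χ₁ : DirichletCharacter ℂ r₁) (χ₂ : DirichletCharacter ℂ r₂)
    (κ₁ κ₂ : ℕ) (hκ₁ : κ₁ ≤ 1) (hκ₂ : κ₂ ≤ 1)
    (hχ₁ : χ₁ (-1) = (-1) ^ κ₁) (hχ₂ : χ₂ (-1) = (-1) ^ κ₂) :
    -- absolute convergence of the double series
    (∀ (s₁ s₂ : ℂ) (y : ℝ), 0 < y →
      Summable (TwistedLambert.xiSummand χ₁ χ₂ s₁ s₂ (TwistedLambert.nome y))) ∧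
    -- the expansion when neither character is principal
    (χ₁ ≠ 1 → χ₂ ≠ 1 → ∀ s₁ s₂ : ℂ,
      TwistedLambert.PoincareExpansion
        (fun y => TwistedLambert.Xi χ₁ χ₂ s₁ s₂ (TwistedLambert.nome y)) (fun _ => 0)
        (TwistedLambert.pertCoeff χ₁ χ₂ s₁ s₂)) ∧
    -- the unified expansion at non-singular parameters
    (∀ s₁ s₂ : ℂ, TwistedLambert.Generic χ₁ χ₂ s₁ s₂ →
      TwistedLambert.PoincareExpansion
        (fun y => TwistedLambert.Xi χ₁ χ₂ s₁ s₂ (TwistedLambert.nome y))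
        (TwistedLambert.isolatedTerms χ₁ χ₂ s₁ s₂)
        (TwistedLambert.pertCoeff χ₁ χ₂ s₁ s₂)) ∧
    -- a principal second character and `s₂ → n + 1`: the two singular terms have a finite limit
    (χ₂ = 1 → ∀ (n : ℕ) (s₁ : ℂ), (χ₁ = 1 → s₁ ≠ n + 1) → ∀ y : ℝ, 0 < y →
      Tendsto (fun s : ℂ =>
          (2 * Real.pi * y : ℂ) ^ (s - 1) * Complex.Gamma (1 - s) *
              DirichletCharacter.LFunction χ₁ (s₁ + 1 - s) * ((r₂.totient : ℂ) / (r₂ : ℂ)) +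
            (-(2 * Real.pi * y : ℂ)) ^ n / (n.factorial : ℂ) *
              DirichletCharacter.LFunction χ₁ (s₁ - n) * DirichletCharacter.LFunction χ₂ (s - n))
        (𝓝[≠] ((n : ℂ) + 1)) (𝓝 (TwistedLambert.logTerm χ₁ r₂ s₁ n y))) ∧
    -- a principal second character and `s₂ = n + 1`: the expansion with a logarithm
    (χ₂ = 1 → ∀ (n : ℕ) (s₁ : ℂ), (χ₁ = 1 → ∀ k : ℕ, s₁ ≠ k + 1) →
      TwistedLambert.PoincareExpansion
        (fun y => TwistedLambert.Xi χ₁ χ₂ s₁ (n + 1) (TwistedLambert.nome y))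
        (fun y => TwistedLambert.logTerm χ₁ r₂ s₁ n y +
          (y : ℂ) ^ (s₁ - 1) * TwistedLambert.coeffA χ₂ χ₁ (n + 1) s₁)
        (fun k => if k = n then 0 else TwistedLambert.pertCoeff χ₁ χ₂ s₁ (n + 1) k)) ∧
    -- all parameters: the expansion as the limit of the one at non-singular parameters
    (∀ (s₁ s₂ : ℂ) (N : ℕ),
      (χ₁ = 1 → ∀ k : ℕ, s₁ = k + 1 → k < N) → (χ₂ = 1 → ∀ k : ℕ, s₂ = k + 1 → k < N) →
      ∃ R : ℝ → ℂ,
        (∀ y : ℝ, 0 < y →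
          Tendsto (fun p : ℂ × ℂ => TwistedLambert.pertPartial χ₁ χ₂ p.1 p.2 N y)
            (𝓝[{p : ℂ × ℂ | TwistedLambert.Generic χ₁ χ₂ p.1 p.2}] (s₁, s₂)) (𝓝 (R y))) ∧
        (fun y : ℝ => TwistedLambert.Xi χ₁ χ₂ s₁ s₂ (TwistedLambert.nome y) - R y)
          =O[𝓝[>] (0 : ℝ)] (fun y : ℝ => y ^ N)) ∧
    -- termination, and the trivial zeros which cause it
    (∀ s₁ s₂ : ℂ,
      (∃ K : ℕ, ∀ k : ℕ, K ≤ k → TwistedLambert.pertCoeff χ₁ χ₂ s₁ s₂ k = 0) ↔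
        ∃ m₁ m₂ : ℤ, s₁ = m₁ ∧ s₂ = m₂ ∧ m₁ + m₂ ≡ (κ₁ : ℤ) + (κ₂ : ℤ) + 1 [ZMOD 2]) ∧
    (∀ j : ℕ, (χ₁ ≠ 1 ∨ 1 ≤ j) →
      DirichletCharacter.LFunction χ₁ (-(κ₁ : ℂ) - 2 * (j : ℂ)) = 0) ∧
    (∀ j : ℕ, (χ₂ ≠ 1 ∨ 1 ≤ j) →
      DirichletCharacter.LFunction χ₂ (-(κ₂ : ℂ) - 2 * (j : ℂ)) = 0) ∧
    -- one trivial character, `(s₁, s₂) = (s, 0)`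
    (χ₁ ≠ 1 → ∀ s : ℂ,
      (∀ y : ℝ, 0 < y →
        TwistedLambert.lambert χ₁ s (TwistedLambert.nome y) =
          TwistedLambert.Xi χ₁ (1 : DirichletCharacter ℂ 1) s 0 (TwistedLambert.nome y)) ∧
      (∀ y : ℝ, 0 < y →
        Tendsto (fun z : ℂ => (-(2 * Real.pi * y : ℂ)) ^ z / Complex.Gamma (z + 1) *
            (riemannZeta (-z) * DirichletCharacter.LFunction χ₁ (s - z)))
          (𝓝[≠] (-1)) (𝓝 (DirichletCharacter.LFunction χ₁ (s + 1) / (2 * Real.pi * y)))) ∧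
      TwistedLambert.PoincareExpansion
        (fun y => TwistedLambert.lambert χ₁ s (TwistedLambert.nome y))
        (fun y => DirichletCharacter.LFunction χ₁ (s + 1) / (2 * Real.pi * y))
        (fun k => (-(2 * Real.pi : ℂ)) ^ k / (k.factorial : ℂ) *
          (riemannZeta (-k) * DirichletCharacter.LFunction χ₁ (s - k)))) ∧
    -- one trivial character, `(s₁, s₂) = (0, s)`
    (χ₁ ≠ 1 →
      (∀ (s : ℂ) (y : ℝ), 0 < y →
        TwistedLambert.lambertTilde χ₁ s (TwistedLambert.nome y) =
          TwistedLambert.Xi χ₁ (1 : DirichletCharacter ℂ 1) 0 s (TwistedLambert.nome y)) ∧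
      (∀ s : ℂ, (∀ n : ℕ, s ≠ n + 1) →
        TwistedLambert.PoincareExpansion
          (fun y => TwistedLambert.lambertTilde χ₁ s (TwistedLambert.nome y))
          (fun y => (2 * Real.pi * y : ℂ) ^ (s - 1) * Complex.Gamma (1 - s) *
            DirichletCharacter.LFunction χ₁ (1 - s))
          (fun k => (-(2 * Real.pi : ℂ)) ^ k / (k.factorial : ℂ) *
            (riemannZeta (s - k) * DirichletCharacter.LFunction χ₁ (-k)))) ∧
      (∀ n : ℕ,
        TwistedLambert.PoincareExpansion
          (fun y => TwistedLambert.lambertTilde χ₁ (n + 1) (TwistedLambert.nome y))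
          (TwistedLambert.logTerm χ₁ 1 0 n)
          (fun k => if k = n then 0 else (-(2 * Real.pi : ℂ)) ^ k / (k.factorial : ℂ) *
            (riemannZeta (n + 1 - k) * DirichletCharacter.LFunction χ₁ (-k))))) := by
  refine ⟨fun s₁ s₂ y hy => TwistedLambert.summable_xiSummand χ₁ χ₂ s₁ s₂ hy, fun h1 h2 s₁ s₂ => ?_,
    fun s₁ s₂ hgen => TwistedLambert.poincareExpansion_of_generic hgen,
    fun h n s₁ hs₁ y hy => TwistedLambert.tendsto_logTerm h n s₁ hs₁ hy,
    fun h n s₁ hs₁ => TwistedLambert.poincareExpansion_logTerm h n s₁ hs₁,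
    fun s₁ s₂ N h1 h2 => TwistedLambert.exists_limit_expansion s₁ s₂ N h1 h2,
    TwistedLambert.pertCoeff_eventually_zero_iff hκ₁ hκ₂ hχ₁ hχ₂,
    fun j hj => TwistedLambert.LFunction_trivial_zero hκ₁ hχ₁ hj,
    fun j hj => TwistedLambert.LFunction_trivial_zero hκ₂ hχ₂ hj,
    fun h s => ⟨fun y hy => TwistedLambert.lambert_eq_Xi s hy,
      fun y hy => TwistedLambert.tendsto_lambert_isolatedTerm h s hy,
      TwistedLambert.poincareExpansion_lambert h s⟩,
    fun h => ⟨fun s y hy => TwistedLambert.lambertTilde_eq_Xi s hy,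
      fun s hs => TwistedLambert.poincareExpansion_lambertTilde h hs,
      TwistedLambert.poincareExpansion_lambertTilde_natCast_add_one h⟩⟩
  refine (TwistedLambert.poincareExpansion_of_generic (χ₁ := χ₁) (χ₂ := χ₂) (s₁ := s₁) (s₂ := s₂)
    ⟨fun h => absurd h h1, fun h => absurd h h2, fun h => absurd h h1⟩).congr
    (fun _ _ => rfl) (fun y _ => ?_) fun _ => rfl
  rw [TwistedLambert.isolatedTerms, TwistedLambert.coeffA, TwistedLambert.coeffA, if_neg h1,
    if_neg h2, mul_zero, mul_zero, add_zero]
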